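/- **Setting.** Let $j\in\{3/2,2,5/2,\dots\}$ and $\theta\in[0,2\pi)$. Let $J_x,J_y,J_z$ be the spin-$j$ operators on $\mathbb C^{2j+1}$, $\sigma_x,\sigma_y,\sigma_z$ the Pauli matrices, $|j,j\rangle$ the unit eigenvector of $J_z$ with eigenvalue $j$, $U_g^{(j)}$ the spin-$j$ unitary representing a rotation $g$, $U_g=U_g^{(1/2)}$, $V_\theta=\cos\frac\theta2\,I-i\sin\frac\theta2\,\sigma_z$ and $V_{\theta,g}=U_gV_\theta U_g^\dagger$ (the rotation by $\theta$ about the axis $\mathbf n=g\,\mathbf e_z$). Let $\mathrm dg$ be the normalized Haar measure of the rotation group, $\mathrm d\mathbf n$ the uniform probability measure on the unit sphere, and $\mathrm d\psi$ the unitarily invariant probability measure on pure qubit states. **Quantum strategy.** A memory, a spin $j$ in the state $U_g^{(j)}|j,j\rangle$, interacts with the target qubit through the Heisenberg gate $$U_\theta=\exp\Big[-i f(\theta)\,\frac{J_x\otimes\sigma_x+J_y\otimes\sigma_y+J_z\otimes\sigma_z}{2j+1}\Big],\qquad f(\theta)=\operatorname{arccot}\Big[\cot\theta+\frac1{(2j+1)\sin\theta}\Big]+s(\theta),$$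 where $\operatorname{arccot}$ takes values in $(0,\pi)$, $s=0$ on $[0,\pi]$, $s=\pi$ on $(\pi,2\pi)$, and $f(0)=0$, $f(\pi)=\pi$. Averaged over the target's input state, one access changes the memory state by $\widetilde{\mathcal C}_\theta(\rho)=\operatorname{Tr}_{\rm target}[U_\theta(\rho\otimes\tfrac I2)U_\theta^\dagger]$. The average fidelity of the $n$-th access ($n\ge1$) is $$F(j,\theta,n)=\int \mathrm dg\int \mathrm d\psi\;\langle\psi|V_{\theta,g}^\dagger\operatorname{Tr}_{\rm memory}\Big[U_\theta\Big(\widetilde{\mathcal C}_\theta^{\,n-1}\big(U_g^{(j)}|j,j\rangle\langle j,j|U_g^{(j)\dagger}\big)\otimes|\psi\rangle\langle\psi|\Big)U_\theta^\dagger\Big]V_{\theta,g}|\psi\rangle .$$ **Classical benchmarks.** A measure-and-operate (MO) strategy is a map $\mathcal C(\rho)=\sum_y\mathcal O_y(\operatorname{Tr}_{\rm probe}[(P_y\otimes I)\rho])$ with a POVM $(P_y)$ on the probe, with any finite number of outcomes, and qubit channels $\mathcal O_y$. Two benchmarks are considered. 1. Learning from a spin coherent state: the supremum over MO strategies $\mathcal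 C$ of $\int \mathrm d\mathbf n\int \mathrm d\psi\,\langle\psi|V_{\theta,\mathbf n}^\dagger\,\mathcal C(|j,j\rangle_{\mathbf n}\langle j,j|_{\mathbf n}\otimes|\psi\rangle\langle\psi|)\,V_{\theta,\mathbf n}|\psi\rangle$. Here $|j,j\rangle_{\mathbf n}$ is the state $|j,j\rangle$ rotated so that the $z$-axis goes to $\mathbf n$, and $V_{\theta,\mathbf n}=\cos\frac\theta2 I-i\sin\frac\theta2\,\mathbf n\cdot\boldsymbol\sigma$. 2. Learning from the gate $U_g^{(j)}$: the supremum over finite-dimensional auxiliary systems $A$, unit vectors $\chi\in\mathbb C^{2j+1}\otimes A$, and MO strategies with probe $\mathbb C^{2j+1}\otimes A$, of $\int \mathrm dg\int \mathrm d\psi\,\langle\psi|V_{\theta,g}^\dagger\,\mathcal C(|\chi_g\rangle\langle\chi_g|\otimes|\psi\rangle\langle\psi|)\,V_{\theta,g}|\psi\rangle$, where $\chi_g=(U_g^{(j)}\otimes I)\chi$. **Statement.** (a) For every $K$ there is a constant $c$ such that for all $\theta\in[0,2\pi)$, all $j\in\{3/2,2,\dots\}$ and all integers $1\le n\le Kj$,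 $$\Big|F(j,\theta,n)-\Big(1-\frac{1-\cos\theta}{3j}\cdot\frac{n(1-\cos\theta)+j}{j}\Big)\Big|\le\frac c{j^2}.$$ (b) For every $\theta\in(0,2\pi)$ there is a constant $c$ such that for all sufficiently large $j$ and for each of the two benchmarks $B$ there is an integer $N\ge1$ such that, for every $n\ge1$, $F(j,\theta,n)>B$ if and only if $n\le N$, and $$\Big|N-\frac j{1-\cos\theta}\Big|\le c .$$ That is, the quantum advantage persists for exactly $N=\frac{j}{1-\cos\theta}+O(1)=O(j)$ accesses. -/

import Mathlib

open scoped Matrix Kronecker ComplexOrder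

noncomputable section

namespace SpinMemory

/-! Spin operators.  A spin `j` is described by the natural number `d = 2j`; its Hilbert space has
the orthonormal basis `|j, j - k⟩`, `k : Fin (d + 1)`, of eigenvectors of `J_z`. -/

/-- Complex square matrices, i.e. operators on the Hilbert space with basis `ι`. -/
abbrev Op (ι : Type) : Type := Matrix ι ι ℂ

/-- The raising operator `J₊ |j, m⟩ = √((j - m)(j + m + 1)) |j, m + 1⟩`. -/
def spinRaise (d : ℕ) : Op (Fin (d + 1)) :=
  Matrix.of fun i l =>
    if (i : ℕ) + 1 = (l : ℕ) then ((Real.sqrt ((l : ℝ) * ((d : ℝ) + 1 - (l : ℝ))) : ℝ) : ℂ) else 0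

/-- `J_x = (J₊ + J₋) / 2`. -/
def spinX (d : ℕ) : Op (Fin (d + 1)) := (1 / 2 : ℂ) • (spinRaise d + (spinRaise d)ᴴ)

/-- `J_y = (J₊ - J₋) / (2i)`. -/
def spinY (d : ℕ) : Op (Fin (d + 1)) := (1 / (2 * Complex.I)) • (spinRaise d - (spinRaise d)ᴴ)

/-- `J_z |j, m⟩ = m |j, m⟩`. -/
def spinZ (d : ℕ) : Op (Fin (d + 1)) := Matrix.diagonal fun k => (d : ℂ) / 2 - ((k : ℕ) : ℂ)

/-- The Pauli matrices. -/
def pauliX : Op (Fin 2) := !![0, 1; 1, 0]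
def pauliY : Op (Fin 2) := !![0, -Complex.I; Complex.I, 0]
def pauliZ : Op (Fin 2) := !![1, 0; 0, -1]

/-- The state `|j, j⟩`. -/
def topKet (d : ℕ) : Fin (d + 1) → ℂ := Pi.single 0 1

/-- The rank-one operator `|v⟩⟨v|`. -/
def ketBra {ι : Type} (v : ι → ℂ) : Op ι := Matrix.vecMulVec v (star v)

/-- The operator `U_g^{(j)} = e^{-iα J_z} e^{-iβ J_y} e^{-iγ J_z}` representing the rotation `g`
with Euler angles `(α, β, γ)` on a spin-`j` particle. -/
def rotation (d : ℕ) (α β γ : ℝ) : Op (Fin (d + 1)) :=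
  NormedSpace.exp ((-(Complex.I * (α : ℂ))) • spinZ d) *
    NormedSpace.exp ((-(Complex.I * (β : ℂ))) • spinY d) *
    NormedSpace.exp ((-(Complex.I * (γ : ℂ))) • spinZ d)

/-- The spin coherent state `|j, j⟩_n` (up to an irrelevant phase), where
`n = (sin ϑ cos φ, sin ϑ sin φ, cos ϑ)`: the state `|j, j⟩` rotated so that the `z`-axis goes
to `n`. -/
def coherentKet (d : ℕ) (ϑ φ : ℝ) : Fin (d + 1) → ℂ := rotation d φ ϑ 0 *ᵥ topKet d

/-- The pure qubit state with Bloch vector `(sin ϑ cos φ, sin ϑ sin φ, cos ϑ)`. -/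
def qubitKet (ϑ φ : ℝ) : Fin 2 → ℂ :=
  ![((Real.cos (ϑ / 2) : ℝ) : ℂ), Complex.exp (Complex.I * (φ : ℂ)) * ((Real.sin (ϑ / 2) : ℝ) : ℂ)]

/-! Averages. -/

/-- Average over the rotation-invariant probability distribution on the unit sphere, in
spherical coordinates. -/
def sphereAverage (G : ℝ → ℝ → ℝ) : ℝ :=
  (1 / (4 * Real.pi)) *
    ∫ ϑ in (0 : ℝ)..Real.pi, ∫ φ in (0 : ℝ)..(2 * Real.pi), G ϑ φ * Real.sin ϑ

/-- Average over the normalized Haar measure of the rotation group, in Euler angles. -/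
def haarAverage (G : ℝ → ℝ → ℝ → ℝ) : ℝ :=
  (1 / (8 * Real.pi ^ 2)) *
    ∫ α in (0 : ℝ)..(2 * Real.pi), ∫ β in (0 : ℝ)..Real.pi, ∫ γ in (0 : ℝ)..(2 * Real.pi),
      G α β γ * Real.sin β

/-- Average over the unitarily invariant probability distribution on pure qubit states. -/
def pureStateAverage (G : (Fin 2 → ℂ) → ℝ) : ℝ := sphereAverage fun ϑ φ => G (qubitKet ϑ φ)

/-! Target gates. -/

/-- `V_{θ,n} = cos(θ/2) I - i sin(θ/2) n·σ` for `n = (sin ϑ cos φ, sin ϑ sin φ, cos ϑ)`. -/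
def axisGate (θ ϑ φ : ℝ) : Op (Fin 2) :=
  ((Real.cos (θ / 2) : ℝ) : ℂ) • (1 : Op (Fin 2)) -
    (Complex.I * ((Real.sin (θ / 2) : ℝ) : ℂ)) •
      (((Real.sin ϑ * Real.cos φ : ℝ) : ℂ) • pauliX + ((Real.sin ϑ * Real.sin φ : ℝ) : ℂ) • pauliY +
        ((Real.cos ϑ : ℝ) : ℂ) • pauliZ)

/-- `V_{θ,g} = U_g V_θ U_g†`, with `V_θ` the rotation by `θ` about the `z`-axis. -/
def rotatedGate (θ α β γ : ℝ) : Op (Fin 2) :=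
  rotation 1 α β γ * axisGate θ 0 0 * (rotation 1 α β γ)ᴴ

/-! Channels and fidelities. -/

/-- Partial trace over the first factor. -/
def traceFst {ι κ : Type} [Fintype ι] (X : Op (ι × κ)) : Op κ :=
  Matrix.of fun a b => ∑ i, X (i, a) (i, b)

/-- Partial trace over the second factor. -/
def traceSnd {ι κ : Type} [Fintype κ] (X : Op (ι × κ)) : Op ι :=
  Matrix.of fun a b => ∑ i, X (a, i) (b, i)

/-- Completely positive trace-preserving maps of a qubit, through a Kraus decomposition. -/
def IsQubitChannel (Φ : Op (Fin 2) → Op (Fin 2)) : Prop :=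
  ∃ (r : ℕ) (K : Fin r → Op (Fin 2)),
    ∑ s, (K s)ᴴ * K s = 1 ∧ ∀ X, Φ X = ∑ s, K s * X * (K s)ᴴ

/-- Measure-and-operate maps from (probe `ι`) ⊗ (target qubit) to the target qubit: measure a POVM
`P` on the probe, store the outcome `y` in a classical memory of arbitrary finite size, and apply a
channel `O y` to the target. -/
def IsMeasureAndOperate {ι : Type} [Fintype ι] [DecidableEq ι]
    (C : Op (ι × Fin 2) → Op (Fin 2)) : Prop :=
  ∃ (k : ℕ) (P : Fin k → Op ι) (O : Fin k → Op (Fin 2) → Op (Fin 2)),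
    (∀ y, (P y).PosSemidef) ∧ ∑ y, P y = 1 ∧ (∀ y, IsQubitChannel (O y)) ∧
      ∀ ρ, C ρ = ∑ y, O y (traceFst ((P y ⊗ₖ (1 : Op (Fin 2))) * ρ))

/-- The input-output fidelity `∫ dψ ⟨ψ| V† C(ρ ⊗ |ψ⟩⟨ψ|) V |ψ⟩` with which the map `C`, run with
the memory in the state `ρ`, simulates the gate `V`. -/
def gateFidelity {ι : Type} (V : Op (Fin 2)) (C : Op (ι × Fin 2) → Op (Fin 2)) (ρ : Op ι) : ℝ :=
  pureStateAverage fun ψ => (star (V *ᵥ ψ) ⬝ᵥ (C (ρ ⊗ₖ ketBra ψ) *ᵥ (V *ᵥ ψ))).re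

/-- Average fidelity of the map `C` when learning from the spin coherent state `|j, j⟩_n`. -/
def coherentFidelity (d : ℕ) (θ : ℝ) (C : Op (Fin (d + 1) × Fin 2) → Op (Fin 2)) : ℝ :=
  sphereAverage fun ϑ φ => gateFidelity (axisGate θ ϑ φ) C (ketBra (coherentKet d ϑ φ))

/-- Average fidelity of the map `C` when learning from one use of the gate `U_g^{(j)}`, applied to
the spin-`j` part of the state `χ` of the spin and an `a`-dimensional auxiliary system. -/
def gateLearningFidelity (d a : ℕ) (θ : ℝ) (χ : Fin (d + 1) × Fin a → ℂ)
    (C : Op ((Fin (d + 1) × Fin a) × Fin 2) → Op (Fin 2)) : ℝ :=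
  haarAverage fun α β γ =>
    gateFidelity (rotatedGate θ α β γ) C
      (ketBra ((rotation d α β γ ⊗ₖ (1 : Op (Fin a))) *ᵥ χ))

/-- The benchmark for learning from a spin coherent state: the supremum of the average fidelity
over all strategies with a purely classical memory. -/
def coherentBenchmark (d : ℕ) (θ : ℝ) : ℝ :=
  sSup {F | ∃ C : Op (Fin (d + 1) × Fin 2) → Op (Fin 2),
    IsMeasureAndOperate C ∧ F = coherentFidelity d θ C}

/-- The benchmark for learning from a rotation gate: the supremum of the average fidelity over all
auxiliary systems, all (normalized) input states and all strategies with a purely classical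
memory. -/
def gateBenchmark (d : ℕ) (θ : ℝ) : ℝ :=
  sSup {F | ∃ (a : ℕ) (χ : Fin (d + 1) × Fin a → ℂ)
      (C : Op ((Fin (d + 1) × Fin a) × Fin 2) → Op (Fin 2)),
    ∑ i, ‖χ i‖ ^ 2 = 1 ∧ IsMeasureAndOperate C ∧ F = gateLearningFidelity d a θ χ C}

/-! The Heisenberg interaction and the reuse of the memory. -/

/-- The function `f(θ) = arccot[cot θ + 1/((2j+1) sin θ)] + s(θ)` for `θ ∈ [0, 2π)`, where `arccot`
takes values in `(0, π)` and `s(θ)` is `0` for `θ ≤ π` and `π` for `θ > π`; it is extended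
continuously to the zeros `θ = 0, π` of the sine. -/
def interactionAngle (d : ℕ) (θ : ℝ) : ℝ :=
  if Real.sin θ = 0 then θ
  else Real.pi / 2 -
      Real.arctan (Real.cos θ / Real.sin θ + 1 / (((d : ℝ) + 1) * Real.sin θ)) +
    (if θ ≤ Real.pi then 0 else Real.pi)

/-- `U_θ = exp[-i f(θ) (J·σ) / (2j+1)]`. -/
def heisenbergGate (d : ℕ) (θ : ℝ) : Op (Fin (d + 1) × Fin 2) :=
  NormedSpace.exp ((-(Complex.I * ((interactionAngle d θ / ((d : ℝ) + 1) : ℝ) : ℂ))) •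
    (spinX d ⊗ₖ pauliX + spinY d ⊗ₖ pauliY + spinZ d ⊗ₖ pauliZ))

/-- The effect of the interaction on the target: the memory is traced out. -/
def heisenbergChannel (d : ℕ) (θ : ℝ) (ρ : Op (Fin (d + 1) × Fin 2)) : Op (Fin 2) :=
  traceFst (heisenbergGate d θ * ρ * (heisenbergGate d θ)ᴴ)

/-- The effect of one access on the memory, for a uniformly random (hence, on average, maximally
mixed) target state. -/
def memoryUpdate (d : ℕ) (θ : ℝ) (ρ : Op (Fin (d + 1))) : Op (Fin (d + 1)) :=
  traceSnd (heisenbergGate d θ * (ρ ⊗ₖ ((1 / 2 : ℂ) • (1 : Op (Fin 2)))) *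
    (heisenbergGate d θ)ᴴ)

/-- The average fidelity `F(j, θ, n)` at the `n`-th access (`n ≥ 1`): the memory starts in
`U_g^{(j)} |j, j⟩`, has already been accessed `n - 1` times, and is now used to simulate
`V_{θ,g}`. -/
def reuseFidelity (d : ℕ) (θ : ℝ) (n : ℕ) : ℝ :=
  haarAverage fun α β γ =>
    gateFidelity (rotatedGate θ α β γ) (heisenbergChannel d θ)
      ((memoryUpdate d θ)^[n - 1] (ketBra (rotation d α β γ *ᵥ topKet d)))

end SpinMemory

end

open scoped Matrix Kronecker ComplexOrder

noncomputable section

namespace SpinMemory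

/-! Averages. -/

/-! Quantum side. With S = J·σ one has S² = j(j+1) - S, so (2S + 1)/(2j + 1) is an involution and
U_θ is, up to a phase, p - iqS with q = 2 sin(f/2)/(2j + 1) (`spinDotPauli_sq`,
`heisenbergGate_eq`). After averaging over ψ, the fidelity with V_{θ,n} sees the memory only through
the expectations of 1, J_n and J_n² (`gateFidelity_heisenberg_axisGate`). In the Heisenberg picture
one access multiplies J_n by 1 - q² and J_n² - j(j+1)/3 by 1 - 3q² (`memoryUpdate_iterate_trace`).
Hence F is the same for all g and is an explicit combination, with nonnegative coefficients, of a
constant and the powers (1 - q²)^(n-1) and (1 - 3q²)^(n-1) (`reuseFidelity_eq`); in particular it is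
nonincreasing in n (`accessFidelity_antitone`).

Put ε = 1/(2j + 1). The angle f is the argument of e^{iθ} + ε (`interactionAngle_trig`), and q² =
2(1 - cos f)ε². For n ≤ Kj the product (n - 1)ε stays bounded, and an expansion in ε leaves ε² times
a polynomial in variables from a compact box (`accessRemainder_spec`, `accessRemainder_bounded`).
This gives (a), uniformly in θ.

Classical side. A measure-and-operate strategy has fidelity Σ_y p_y (2 + Σ_s |tr V†K_{y,s}|²)/6. For
the gate benchmark, averaging over the last Euler angle destroys the coherences of the probe between
different weights m, so only rotated eigenstates ρ_m(n) of J_n matter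
(`integral_trace_mul_ketBra_rotation`). By Cauchy-Schwarz the fidelity is then controlled by
averages of (n·u)² tr(Qρ_m(n)), that is, by the operators ∫ n_a n_b ρ_m(n) dn. These form a
symmetric tensor operator, hence are combinations of (J_aJ_b + J_bJ_a)/2 and δ_ab
(`IsTensorOp.exists_eq`), with coefficients found by contraction (`moments_eq`). The extremal
weights are m = ±j, and the result is the upper bound `gateLearningFidelity_le`. For the lower
bound, the coherent-state measurement followed by the gate about the estimated axis suffices
(`exists_coherentFidelity_ge`); convexity makes it a finite POVM. Learning from a coherent state is
a special case of learning from the gate, so both benchmarks lie between these bounds and equal 1 -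
2D/(3j) + O(j⁻²), where D = 1 - cos θ (`benchmark_asymptotics`).

Comparison. The difference F - B is D(j - nD)/(3j²) + O(j⁻²). Since F is nonincreasing, it falls to
the level B exactly once, within O(1) of n = j/D (`exists_crossing`). -/

theorem integral_circle_quadratic (a b c e f : ℝ) :
    ∫ φ in (0 : ℝ)..(2 * Real.pi), (a + b * Real.cos φ + c * Real.sin φ + e * Real.cos φ ^ 2 +
      f * (Real.sin φ * Real.cos φ)) = 2 * Real.pi * a + Real.pi * e := by
  have hi : ∀ g : ℝ → ℝ, Continuous g →
      IntervalIntegrable g MeasureTheory.volume 0 (2 * Real.pi) :=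
    fun g hg => hg.intervalIntegrable _ _
  rw [intervalIntegral.integral_add (hi _ (by fun_prop)) (hi _ (by fun_prop)),
    intervalIntegral.integral_add (hi _ (by fun_prop)) (hi _ (by fun_prop)),
    intervalIntegral.integral_add (hi _ (by fun_prop)) (hi _ (by fun_prop)),
    intervalIntegral.integral_add (hi _ (by fun_prop)) (hi _ (by fun_prop))]
  simp only [intervalIntegral.integral_const_mul, integral_cos, integral_sin, integral_cos_sq,
    integral_sin_mul_cos₁, intervalIntegral.integral_const, smul_eq_mul]
  simp
  ring

theorem integral_cos_quadratic_mul_sin (a b c : ℝ) :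
    ∫ ϑ in (0 : ℝ)..Real.pi, (a + b * Real.cos ϑ + c * Real.cos ϑ ^ 2) * Real.sin ϑ =
      2 * a + 2 / 3 * c := by
  have h : ∀ ϑ : ℝ, HasDerivAt (fun ϑ => -(a * Real.cos ϑ + b / 2 * Real.cos ϑ ^ 2 +
      c / 3 * Real.cos ϑ ^ 3)) ((a + b * Real.cos ϑ + c * Real.cos ϑ ^ 2) * Real.sin ϑ) ϑ := by
    intro ϑ
    have hc := Real.hasDerivAt_cos ϑ
    convert! (((hc.const_mul a).add ((hc.pow 2).const_mul (b / 2))).add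
      ((hc.pow 3).const_mul (c / 3))).neg using 1
    simp
    ring
  rw [intervalIntegral.integral_eq_sub_of_hasDerivAt (fun ϑ _ => h ϑ)
    (Continuous.intervalIntegrable (by fun_prop) _ _)]
  simp
  ring

theorem cos_half_sq (ϑ : ℝ) : Real.cos (ϑ / 2) ^ 2 = (1 + Real.cos ϑ) / 2 := by
  have := Real.cos_sq (ϑ / 2)
  rw [this]; ring_nf

theorem sin_half_sq (ϑ : ℝ) : Real.sin (ϑ / 2) ^ 2 = (1 - Real.cos ϑ) / 2 := by
  rw [Real.sin_sq, cos_half_sq]; ring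

/-- In terms of the Bloch vector the half angles disappear, so averages over pure states become
integrals of trigonometric polynomials in ϑ and φ. -/
theorem qubitKet_mul_star (ϑ φ : ℝ) (s p : Fin 2) :
    qubitKet ϑ φ s * star (qubitKet ϑ φ p) =
      (!![(1 + Real.cos ϑ : ℂ) / 2, (Real.cos φ - Complex.I * Real.sin φ) * Real.sin ϑ / 2;
        (Real.cos φ + Complex.I * Real.sin φ) * Real.sin ϑ / 2, (1 - Real.cos ϑ : ℂ) / 2] :
        Op (Fin 2)) s p := by
  have h1 : (Real.cos (ϑ / 2) : ℂ) ^ 2 = (1 + Real.cos ϑ : ℂ) / 2 := by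
    exact_mod_cast cos_half_sq ϑ
  have h2 : (Real.sin (ϑ / 2) : ℂ) ^ 2 = (1 - Real.cos ϑ : ℂ) / 2 := by
    exact_mod_cast sin_half_sq ϑ
  have h3 : (Real.sin ϑ : ℂ) = 2 * Real.sin (ϑ / 2) * Real.cos (ϑ / 2) := by
    rw [← mul_div_cancel₀ ϑ (two_ne_zero' ℝ)]
    rw [Real.sin_two_mul]; push_cast; ring_nf
  have h4 : (Real.sin φ : ℂ) ^ 2 + (Real.cos φ : ℂ) ^ 2 = 1 := by
    exact_mod_cast Real.sin_sq_add_cos_sq φ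
  have hI := Complex.I_sq
  have he : Complex.exp (Complex.I * φ) = Real.cos φ + Complex.I * Real.sin φ := by
    rw [mul_comm, Complex.exp_mul_I, ← Complex.ofReal_cos, ← Complex.ofReal_sin]; ring
  fin_cases s <;> fin_cases p <;>
    simp only [qubitKet, he, Fin.zero_eta, Fin.mk_one, Matrix.cons_val_zero, Matrix.cons_val_one,
      Matrix.of_apply, Matrix.cons_val', Matrix.cons_val_fin_one, star_mul', star_add,
      Complex.star_def, Complex.conj_ofReal, Complex.conj_I]
  · linear_combination h1
  · linear_combination (-(Real.cos φ - Complex.I * Real.sin φ) / 2) * h3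
  · linear_combination (-(Real.cos φ + Complex.I * Real.sin φ) / 2) * h3
  · linear_combination h2 + (Real.sin (ϑ / 2) : ℂ) ^ 2 * h4 -
      (Real.sin φ : ℂ) ^ 2 * (Real.sin (ϑ / 2) : ℂ) ^ 2 * hI

/-- The average over pure qubit states of a form of degree four. -/
theorem pureStateAverage_quartic (T : Fin 2 → Fin 2 → Fin 2 → Fin 2 → ℂ) :
    pureStateAverage (fun ψ => (∑ p, ∑ s, ∑ q, ∑ r,
      T p s q r * (ψ s * star (ψ p)) * (ψ q * star (ψ r))).re) =
      (∑ p, ∑ q, (T p p q q + T p q p q)).re / 6 := by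
  -- The integrand is sorted by its dependence on φ, with sin² φ eliminated, into the form required
  -- by `integral_circle_quadratic`.
  have key : ∀ ϑ φ : ℝ, (∑ p, ∑ s, ∑ q, ∑ r, T p s q r *
      (qubitKet ϑ φ s * star (qubitKet ϑ φ p)) * (qubitKet ϑ φ q * star (qubitKet ϑ φ r))).re *
        Real.sin ϑ =
      ((1 + Real.cos ϑ) ^ 2 / 4 * (T 0 0 0 0).re + (1 - Real.cos ϑ) ^ 2 / 4 * (T 1 1 1 1).re +
        (1 - Real.cos ϑ ^ 2) / 4 * (T 0 0 1 1 + T 1 1 0 0 + T 0 1 0 1 + T 1 0 1 0 - T 0 1 1 0 -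
          T 1 0 0 1).re) * Real.sin ϑ +
      (Real.sin ϑ / 4 * ((1 + Real.cos ϑ) * (T 0 1 0 0 + T 1 0 0 0 + T 0 0 1 0 + T 0 0 0 1).re +
        (1 - Real.cos ϑ) * (T 0 1 1 1 + T 1 0 1 1 + T 1 1 1 0 + T 1 1 0 1).re)) * Real.sin ϑ *
          Real.cos φ +
      (Real.sin ϑ / 4 * ((1 + Real.cos ϑ) * (-T 0 1 0 0 + T 1 0 0 0 - T 0 0 1 0 + T 0 0 0 1).im +
        (1 - Real.cos ϑ) * (-T 0 1 1 1 + T 1 0 1 1 - T 1 1 1 0 + T 1 1 0 1).im)) * Real.sin ϑ *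
          Real.sin φ +
      ((1 - Real.cos ϑ ^ 2) / 2 * (T 0 1 1 0 + T 1 0 0 1).re) * Real.sin ϑ * Real.cos φ ^ 2 +
      ((1 - Real.cos ϑ ^ 2) / 2 * (T 1 0 0 1 - T 0 1 1 0).im) * Real.sin ϑ *
        (Real.sin φ * Real.cos φ) := by
    intro ϑ φ
    have hs := Real.sin_sq_add_cos_sq ϑ
    have hφ := Real.sin_sq_add_cos_sq φ
    rw [← eq_sub_iff_add_eq] at hs hφ
    simp only [qubitKet_mul_star, Fin.sum_univ_two, Matrix.of_apply, Matrix.cons_val', Matrix.cons_val_zero, Matrix.cons_val_one,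
      Matrix.cons_val_fin_one]
    generalize T 0 0 0 0 = t1, T 0 0 0 1 = t2, T 0 0 1 0 = t3, T 0 0 1 1 = t4,
      T 0 1 0 0 = t5, T 0 1 0 1 = t6, T 0 1 1 0 = t7, T 0 1 1 1 = t8,
      T 1 0 0 0 = t9, T 1 0 0 1 = u1, T 1 0 1 0 = u2, T 1 0 1 1 = u3,
      T 1 1 0 0 = u4, T 1 1 0 1 = u5, T 1 1 1 0 = u6, T 1 1 1 1 = u7
    have e (z : ℂ) : z / 2 = ((1 / 2 : ℝ) : ℂ) * z := by push_cast; ring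
    simp only [e, Complex.add_re, Complex.mul_re, Complex.sub_re, Complex.add_im, Complex.mul_im,
      Complex.sub_im, Complex.ofReal_re, Complex.ofReal_im, Complex.I_re, Complex.I_im,
      Complex.one_re, Complex.one_im, Complex.neg_im]
    generalize Real.sin ϑ = x at *
    generalize Real.cos ϑ = y at *
    generalize Real.sin φ = a at *
    generalize Real.cos φ = b at *
    ring_nf
    simp only [hs, hφ, show x ^ 3 = x * x ^ 2 by ring]
    ring
  simp only [pureStateAverage, sphereAverage, key, integral_circle_quadratic]
  simp only [Complex.add_re, Complex.sub_re]
  have e : ∀ ϑ : ℝ, 2 * Real.pi * (((1 + Real.cos ϑ) ^ 2 / 4 * (T 0 0 0 0).re +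
      (1 - Real.cos ϑ) ^ 2 / 4 * (T 1 1 1 1).re + (1 - Real.cos ϑ ^ 2) / 4 *
        ((T 0 0 1 1).re + (T 1 1 0 0).re + (T 0 1 0 1).re + (T 1 0 1 0).re - (T 0 1 1 0).re -
          (T 1 0 0 1).re)) * Real.sin ϑ) +
      Real.pi * (((1 - Real.cos ϑ ^ 2) / 2 * ((T 0 1 1 0).re + (T 1 0 0 1).re)) * Real.sin ϑ) =
      (Real.pi / 2 * ((T 0 0 0 0).re + (T 1 1 1 1).re +
        ((T 0 0 1 1).re + (T 1 1 0 0).re + (T 0 1 0 1).re + (T 1 0 1 0).re)) +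
        Real.pi * ((T 0 0 0 0).re - (T 1 1 1 1).re) * Real.cos ϑ +
        Real.pi / 2 * ((T 0 0 0 0).re + (T 1 1 1 1).re -
          ((T 0 0 1 1).re + (T 1 1 0 0).re + (T 0 1 0 1).re + (T 1 0 1 0).re)) * Real.cos ϑ ^ 2) * Real.sin ϑ := by
    intro ϑ
    ring
  simp only [e, integral_cos_quadratic_mul_sin, Fin.sum_univ_two, Complex.add_re]
  field_simp
  ring

/-- The fidelity is a quartic form in ψ, and its average is a sum over the two pairings of the ψ's
with their conjugates. One pairing gives traces of outputs, the other an unnormalized entanglement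
fidelity. -/
theorem gateFidelity_of_expansion {ι : Type} (V : Op (Fin 2)) (C : Op (ι × Fin 2) → Op (Fin 2))
    (ρ : Op ι) (L : Fin 2 → Fin 2 → Op (Fin 2))
    (hC : ∀ ψ : Fin 2 → ℂ, C (ρ ⊗ₖ ketBra ψ) = ∑ q, ∑ r, (ψ q * star (ψ r)) • L q r) :
    gateFidelity V C ρ =
      (∑ q, (Vᴴ * L q q * V).trace + ∑ q, ∑ r, (Vᴴ * L q r * V) q r).re / 6 := by
  have h : ∀ ψ : Fin 2 → ℂ, star (V *ᵥ ψ) ⬝ᵥ (C (ρ ⊗ₖ ketBra ψ) *ᵥ (V *ᵥ ψ)) =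
      ∑ p, ∑ s, ∑ q, ∑ r, (Vᴴ * L q r * V) p s * (ψ s * star (ψ p)) * (ψ q * star (ψ r)) := by
    intro ψ
    rw [Matrix.star_mulVec, ← Matrix.dotProduct_mulVec, Matrix.mulVec_mulVec, Matrix.mulVec_mulVec, hC]
    simp only [dotProduct, Matrix.mulVec, Pi.star_apply, Finset.mul_sum, Finset.sum_mul,
      Matrix.sum_apply, Matrix.mul_smul, Matrix.smul_mul,
      Matrix.smul_apply, smul_eq_mul, Matrix.mul_assoc]
    refine Finset.sum_congr rfl fun p _ => Finset.sum_congr rfl fun s _ =>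
      Finset.sum_congr rfl fun q _ => Finset.sum_congr rfl fun r _ => ?_
    ring
  simp only [gateFidelity, h]
  rw [pureStateAverage_quartic (fun p s q r => (Vᴴ * L q r * V) p s)]
  congr 2
  simp only [Finset.sum_add_distrib, Matrix.trace, Matrix.diag_apply]
  rw [Finset.sum_comm]


/-! The spin operators. -/

theorem spinRaise_apply_succ (d k : ℕ) (hk : k + 1 < d + 1) :
    spinRaise d ⟨k, by omega⟩ ⟨k + 1, hk⟩ = ((Real.sqrt ((k + 1) * (d - k)) : ℝ) : ℂ) := by
  simp only [spinRaise, Matrix.of_apply, if_true]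
  congr 2
  push_cast
  ring

theorem spinRaise_mul_conjTranspose (d : ℕ) :
    spinRaise d * (spinRaise d)ᴴ =
      Matrix.diagonal fun k : Fin (d + 1) => ((k : ℕ) + 1 : ℂ) * ((d : ℂ) - (k : ℕ)) := by
  ext ⟨i, hi⟩ ⟨l, hl⟩
  simp only [Matrix.mul_apply, Matrix.conjTranspose_apply, spinRaise, Matrix.of_apply,
    Matrix.diagonal_apply, Fin.mk.injEq]
  rcases Nat.lt_or_ge i d with h | h
  · rw [Finset.sum_eq_single (⟨i + 1, by omega⟩ : Fin (d + 1))]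
    · simp only [if_true, add_left_inj]
      by_cases hil : i = l
      · subst hil
        simp only [if_true, Complex.star_def, Complex.conj_ofReal]
        rw [← Complex.ofReal_mul, Real.mul_self_sqrt]
        · push_cast; ring
        · have : (i : ℝ) + 1 ≤ d := by exact_mod_cast h
          push_cast
          exact mul_nonneg (by positivity) (by linarith)
      · simp [hil, Ne.symm hil]
    · rintro ⟨b, hb⟩ - hne
      have : ¬ i + 1 = b := fun h => hne (by simp [h])
      simp [this]
    · simp
  -- The lowest weight: the row of the raising operator vanishes, in agreement with the factor `d -
  -- k`.
  · have hid : i = d := by omega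
    rw [Finset.sum_eq_zero]
    · simp [hid]
    · rintro ⟨b, hb⟩ -
      have : ¬ i + 1 = b := by omega
      simp [this]

theorem conjTranspose_mul_spinRaise (d : ℕ) :
    (spinRaise d)ᴴ * spinRaise d =
      Matrix.diagonal fun k : Fin (d + 1) => ((k : ℕ) : ℂ) * ((d : ℂ) + 1 - (k : ℕ)) := by
  ext ⟨i, hi⟩ ⟨l, hl⟩
  simp only [Matrix.mul_apply, Matrix.conjTranspose_apply, spinRaise, Matrix.of_apply,
    Matrix.diagonal_apply, Fin.mk.injEq]
  rcases i with - | i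
  · rw [Finset.sum_eq_zero]
    · simp
    · rintro ⟨b, hb⟩ -
      simp
  · rw [Finset.sum_eq_single (⟨i, by omega⟩ : Fin (d + 1))]
    · by_cases hil : i + 1 = l
      · subst hil
        simp only [if_true, Complex.star_def, Complex.conj_ofReal]
        rw [← Complex.ofReal_mul, Real.mul_self_sqrt]
        · push_cast; ring
        · have : ((i + 1 : ℕ) : ℝ) ≤ d := by exact_mod_cast (by omega : i + 1 ≤ d)
          exact mul_nonneg (by positivity) (by linarith)
      · simp [hil]
    · rintro ⟨b, hb⟩ - hne
      have : ¬ b = i := fun h => hne (by simp [h])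
      simp [this]
    · simp

theorem spinZ_mul_spinRaise (d : ℕ) :
    spinZ d * spinRaise d = spinRaise d * spinZ d + spinRaise d := by
  ext ⟨i, hi⟩ ⟨l, hl⟩
  simp only [spinZ, Matrix.diagonal_mul, Matrix.add_apply, Matrix.mul_diagonal, spinRaise,
    Matrix.of_apply]
  split_ifs with h
  · subst h; push_cast; ring
  · simp

theorem spinZ_isHermitian (d : ℕ) : (spinZ d)ᴴ = spinZ d := by
  simp only [spinZ, Matrix.diagonal_conjTranspose]
  congr 1
  ext k
  simp

theorem spinX_isHermitian (d : ℕ) : (spinX d)ᴴ = spinX d := by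
  simp [spinX, add_comm]

theorem spinY_isHermitian (d : ℕ) : (spinY d)ᴴ = spinY d := by
  simp only [spinY, Matrix.conjTranspose_smul, Matrix.conjTranspose_sub,
    Matrix.conjTranspose_conjTranspose]
  rw [← neg_sub, smul_neg, ← neg_smul]
  congr 1
  simp

theorem spinRaise_eq (d : ℕ) : spinRaise d = spinX d + Complex.I • spinY d := by
  simp only [spinX, spinY, smul_smul]
  have : Complex.I * (1 / (2 * Complex.I)) = 1 / 2 := by field_simp
  rw [this]; module

theorem spinRaise_conjTranspose_eq (d : ℕ) : (spinRaise d)ᴴ = spinX d - Complex.I • spinY d := by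
  simp only [spinX, spinY, smul_smul]
  have : Complex.I * (1 / (2 * Complex.I)) = 1 / 2 := by field_simp
  rw [this]; module

theorem spinRaise_comm (d : ℕ) :
    spinRaise d * (spinRaise d)ᴴ - (spinRaise d)ᴴ * spinRaise d = (2 : ℂ) • spinZ d := by
  rw [spinRaise_mul_conjTranspose, conjTranspose_mul_spinRaise, spinZ, Matrix.diagonal_sub,
    ← Matrix.diagonal_smul]
  congr 1
  ext k
  simp
  ring

theorem spinZ_mul_conjTranspose (d : ℕ) :
    spinZ d * (spinRaise d)ᴴ = (spinRaise d)ᴴ * spinZ d - (spinRaise d)ᴴ := by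
  have h := congrArg Matrix.conjTranspose (spinZ_mul_spinRaise d)
  simp only [Matrix.conjTranspose_mul, Matrix.conjTranspose_add, spinZ_isHermitian] at h
  rw [h]; abel

theorem spin_comm_xy (d : ℕ) :
    spinX d * spinY d - spinY d * spinX d = Complex.I • spinZ d := by
  have h := spinRaise_comm d
  rw [spinRaise_conjTranspose_eq, spinRaise_eq] at h
  simp only [add_mul, mul_sub, sub_mul, mul_add, smul_mul_assoc, mul_smul_comm] at h
  have h2 : (-2 * Complex.I) • (spinX d * spinY d - spinY d * spinX d) = (2 : ℂ) • spinZ d := by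
    rw [← h]; module
  have h3 := congrArg (fun M => (Complex.I / 2) • M) h2
  simp only [smul_smul] at h3
  rw [show Complex.I / 2 * (-2 * Complex.I) = 1 by linear_combination -Complex.I_sq, one_smul] at h3
  rw [h3]; congr 1; ring

theorem spin_comm_zx (d : ℕ) :
    spinZ d * spinX d - spinX d * spinZ d = Complex.I • spinY d := by
  have e : Complex.I • spinY d = (1 / 2 : ℂ) • (spinRaise d - (spinRaise d)ᴴ) := by
    rw [spinY, smul_smul]; congr 1; field_simp
  rw [e, spinX]
  simp only [mul_smul_comm, smul_mul_assoc, mul_add, add_mul, spinZ_mul_spinRaise,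
    spinZ_mul_conjTranspose]
  module

theorem spin_comm_yz (d : ℕ) :
    spinY d * spinZ d - spinZ d * spinY d = Complex.I • spinX d := by
  have e : Complex.I • spinX d = (-(1 / (2 * Complex.I))) • (spinRaise d + (spinRaise d)ᴴ) := by
    rw [spinX, smul_smul]; congr 1; field_simp; linear_combination Complex.I_sq
  rw [e, spinY]
  simp only [mul_smul_comm, smul_mul_assoc, mul_sub, sub_mul, spinZ_mul_spinRaise,
    spinZ_mul_conjTranspose]
  module

theorem spin_casimir (d : ℕ) :
    spinX d * spinX d + spinY d * spinY d + spinZ d * spinZ d =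
      ((d : ℂ) / 2 * ((d : ℂ) / 2 + 1)) • 1 := by
  have e : spinX d * spinX d + spinY d * spinY d =
      (1 / 2 : ℂ) • (spinRaise d * (spinRaise d)ᴴ + (spinRaise d)ᴴ * spinRaise d) := by
    rw [spinRaise_conjTranspose_eq, spinRaise_eq]
    simp only [add_mul, mul_sub, sub_mul, mul_add, smul_mul_assoc, mul_smul_comm, smul_add,
      smul_sub, smul_smul, Complex.I_mul_I]
    module
  rw [e, spinRaise_mul_conjTranspose, conjTranspose_mul_spinRaise, spinZ, Matrix.diagonal_add,
    ← Matrix.diagonal_smul, Matrix.diagonal_mul_diagonal, Matrix.diagonal_add,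
    Matrix.smul_one_eq_diagonal]
  congr 1
  ext k
  simp
  ring

/-! Rotations. -/

section Exponentials

variable {ι : Type} [Fintype ι] [DecidableEq ι]

/-- The exponential depends on the topology only, so any Banach algebra norm inducing that topology
serves. -/
theorem semiconjBy_exp {P X Y : Op ι} (h : SemiconjBy P X Y) :
    SemiconjBy P (NormedSpace.exp X) (NormedSpace.exp Y) := by
  let _ : NormedRing (Op ι) := Matrix.linftyOpNormedRing
  let _ : NormedAlgebra ℂ (Op ι) := Matrix.linftyOpNormedAlgebra
  let _ : NormedAlgebra ℚ (Op ι) := .restrictScalars ℚ ℂ _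
  exact h.exp_right

theorem exp_smul_one (c : ℂ) : NormedSpace.exp (c • (1 : Op ι)) = Complex.exp c • 1 := by
  rw [Matrix.smul_one_eq_diagonal, Matrix.exp_diagonal, Matrix.smul_one_eq_diagonal]
  congr 1
  ext i
  rw [Pi.coe_exp, Complex.exp_eq_exp_ℂ]

/-- An eigenoperator of the commutator with A intertwines A with A shifted by a scalar, and the
shift factors out of the exponential. -/
theorem exp_smul_mul_of_mul_eq {A P : Op ι} {c : ℂ} (h : A * P = P * (A + c • 1)) (z : ℂ) :
    NormedSpace.exp (z • A) * P = Complex.exp (z * c) • (P * NormedSpace.exp (z • A)) := by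
  have h1 : SemiconjBy P (z • A + (z * c) • (1 : Op ι)) (z • A) := by
    simp only [SemiconjBy, mul_smul_comm, smul_mul_assoc, h, mul_add, smul_add, smul_smul]
  have h2 := semiconjBy_exp h1
  rw [Matrix.exp_add_of_commute _ _ ((Commute.one_right _).smul_right _), exp_smul_one,
    mul_smul_comm, mul_one] at h2
  rw [← h2.eq, mul_smul_comm]

theorem exp_smul_mul_of_eigen {A P : Op ι} {c : ℂ} (h : A * P = c • P) (z : ℂ) :
    NormedSpace.exp (z • A) * P = Complex.exp (z * c) • P := by
  have h1 : SemiconjBy P ((z * c) • (1 : Op ι)) (z • A) := by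
    simp only [SemiconjBy, mul_smul_comm, smul_mul_assoc, h, mul_one, smul_smul]
  have h2 := semiconjBy_exp h1
  rw [exp_smul_one] at h2
  rw [← h2.eq, mul_smul_comm, mul_one]

theorem exp_neg_I_mul (t : ℝ) :
    Complex.exp (-(Complex.I * t)) = Real.cos t - Complex.I * Real.sin t := by
  rw [show -(Complex.I * t) = ((-t : ℝ) : ℂ) * Complex.I by push_cast; ring,
    Complex.exp_mul_I, ← Complex.ofReal_cos, ← Complex.ofReal_sin, Real.cos_neg, Real.sin_neg,
    Complex.ofReal_neg]
  ring

theorem exp_I_mul (t : ℝ) :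
    Complex.exp (Complex.I * t) = Real.cos t + Complex.I * Real.sin t := by
  rw [mul_comm, Complex.exp_mul_I, ← Complex.ofReal_cos, ← Complex.ofReal_sin]
  ring

/-- Conjugation by `e^{-itA}` rotates a pair `X, Y` with `[A, X] = iY` and `[A, Y] = -iX`. -/
theorem exp_mul_of_commutators {A X Y : Op ι} (hX : A * X - X * A = Complex.I • Y)
    (hY : A * Y - Y * A = (-Complex.I) • X) (t : ℝ) :
    NormedSpace.exp ((-(Complex.I * t)) • A) * X =
      ((Real.cos t : ℂ) • X + (Real.sin t : ℂ) • Y) *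
        NormedSpace.exp ((-(Complex.I * t)) • A) := by
  rw [sub_eq_iff_eq_add] at hX hY
  have hI := Complex.I_mul_I
  -- The combinations X ± iY are eigenoperators of [A, ·] with eigenvalues ±1.
  have hP := exp_smul_mul_of_mul_eq (A := A) (P := X + Complex.I • Y) (c := 1)
    (by
      simp only [mul_add, add_mul, hX, hY, mul_smul_comm, smul_mul_assoc, one_smul, mul_one,
        smul_add, smul_smul, mul_neg, hI]
      module) (-(Complex.I * t))
  have hM := exp_smul_mul_of_mul_eq (A := A) (P := X - Complex.I • Y) (c := -1)
    (by
      simp only [mul_add, mul_sub, sub_mul, hX, hY, mul_smul_comm, smul_mul_assoc, one_smul,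
        mul_one, smul_add, smul_smul, mul_neg, neg_smul, smul_neg, hI]
      module) (-(Complex.I * t))
  rw [mul_one, exp_neg_I_mul] at hP
  rw [mul_neg_one, neg_neg, exp_I_mul] at hM
  generalize NormedSpace.exp ((-(Complex.I * t)) • A) = E at *
  have e3 : E * X = (1 / 2 : ℂ) • (E * (X + Complex.I • Y) + E * (X - Complex.I • Y)) := by
    simp only [mul_add, mul_sub]; module
  rw [e3, hP, hM]
  generalize (Real.cos t : ℂ) = a
  generalize (Real.sin t : ℂ) = b
  simp only [add_mul, sub_mul, smul_mul_assoc, smul_add, smul_sub, smul_smul]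
  match_scalars
  · ring
  · linear_combination (-b) * hI

theorem exp_mul_conjTranspose_exp {A : Op ι} (hA : Aᴴ = A) (t : ℝ) :
    NormedSpace.exp ((-(Complex.I * t)) • A) * (NormedSpace.exp ((-(Complex.I * t)) • A))ᴴ = 1 := by
  rw [← Matrix.exp_conjTranspose, Matrix.conjTranspose_smul, hA]
  have : star (-(Complex.I * (t : ℂ))) = Complex.I * t := by simp
  rw [this, neg_smul, Matrix.exp_neg, Matrix.nonsing_inv_mul]
  exact (Matrix.isUnit_iff_isUnit_det _).1 (Matrix.isUnit_exp _)

/-- Up to a factor 2, 1 ± B are the spectral projections of the involution B, on which the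
exponential is a scalar. -/
theorem exp_smul_eq_cos_sub_sin {B : Op ι} (hB : B * B = 1) (t : ℝ) :
    NormedSpace.exp ((-(Complex.I * t)) • B) =
      (Real.cos t : ℂ) • 1 - (Complex.I * Real.sin t) • B := by
  have hP := exp_smul_mul_of_eigen (A := B) (P := 1 + B) (c := 1)
    (by rw [mul_add, hB, mul_one, one_smul, add_comm]) (-(Complex.I * t))
  have hM := exp_smul_mul_of_eigen (A := B) (P := 1 - B) (c := -1)
    (by rw [mul_sub, hB, mul_one]; module) (-(Complex.I * t))
  rw [mul_one, exp_neg_I_mul] at hP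
  rw [mul_neg_one, neg_neg, exp_I_mul] at hM
  generalize NormedSpace.exp ((-(Complex.I * t)) • B) = E at *
  have e3 : E = (1 / 2 : ℂ) • (E * (1 + B) + E * (1 - B)) := by
    simp only [mul_add, mul_sub, mul_one]; module
  rw [e3, hP, hM]
  module

end Exponentials

/-- The component of the spin along the direction with spherical coordinates `(ϑ, φ)`. -/
def spinAlong (d : ℕ) (ϑ φ : ℝ) : Op (Fin (d + 1)) :=
  ((Real.sin ϑ * Real.cos φ : ℝ) : ℂ) • spinX d + ((Real.sin ϑ * Real.sin φ : ℝ) : ℂ) • spinY d +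
    ((Real.cos ϑ : ℝ) : ℂ) • spinZ d

theorem exp_spinZ_mul_spinX (d : ℕ) (t : ℝ) :
    NormedSpace.exp ((-(Complex.I * t)) • spinZ d) * spinX d =
      ((Real.cos t : ℂ) • spinX d + (Real.sin t : ℂ) • spinY d) *
        NormedSpace.exp ((-(Complex.I * t)) • spinZ d) :=
  exp_mul_of_commutators (spin_comm_zx d)
    (by rw [← neg_sub, spin_comm_yz, neg_smul]) t

theorem exp_spinZ_mul_spinY (d : ℕ) (t : ℝ) :
    NormedSpace.exp ((-(Complex.I * t)) • spinZ d) * spinY d =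
      ((Real.cos t : ℂ) • spinY d - (Real.sin t : ℂ) • spinX d) *
        NormedSpace.exp ((-(Complex.I * t)) • spinZ d) := by
  rw [exp_mul_of_commutators (Y := -spinX d)
    (by rw [← neg_sub, spin_comm_yz, smul_neg])
    (by rw [mul_neg, neg_mul, sub_neg_eq_add, neg_add_eq_sub, ← neg_sub, spin_comm_zx, neg_smul]) t,
    smul_neg, sub_eq_add_neg]

theorem exp_spinY_mul_spinZ (d : ℕ) (t : ℝ) :
    NormedSpace.exp ((-(Complex.I * t)) • spinY d) * spinZ d =
      ((Real.cos t : ℂ) • spinZ d + (Real.sin t : ℂ) • spinX d) *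
        NormedSpace.exp ((-(Complex.I * t)) • spinY d) :=
  exp_mul_of_commutators (spin_comm_yz d)
    (by rw [← neg_sub, spin_comm_xy, neg_smul]) t

/-- The factor with γ commutes with J_z; the factor with β tilts the axis in the xz-plane and the
one with α turns it about z. -/
theorem rotation_mul_spinZ (d : ℕ) (α β γ : ℝ) :
    rotation d α β γ * spinZ d = spinAlong d β α * rotation d α β γ := by
  have hc : NormedSpace.exp ((-(Complex.I * (γ : ℂ))) • spinZ d) * spinZ d =
      spinZ d * NormedSpace.exp ((-(Complex.I * (γ : ℂ))) • spinZ d) :=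
    ((semiconjBy_exp ((Commute.refl (spinZ d)).smul_right _)).eq).symm
  have hc' : NormedSpace.exp ((-(Complex.I * (α : ℂ))) • spinZ d) * spinZ d =
      spinZ d * NormedSpace.exp ((-(Complex.I * (α : ℂ))) • spinZ d) :=
    ((semiconjBy_exp ((Commute.refl (spinZ d)).smul_right _)).eq).symm
  have hx := exp_spinZ_mul_spinX d α
  have hz := exp_spinY_mul_spinZ d β
  rw [rotation, Matrix.mul_assoc, hc, ← Matrix.mul_assoc]
  generalize NormedSpace.exp ((-(Complex.I * (γ : ℂ))) • spinZ d) = C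
  generalize NormedSpace.exp ((-(Complex.I * (α : ℂ))) • spinZ d) = A at *
  generalize NormedSpace.exp ((-(Complex.I * (β : ℂ))) • spinY d) = B at *
  rw [Matrix.mul_assoc A, hz, ← Matrix.mul_assoc, mul_add, mul_smul_comm, mul_smul_comm, hx, hc',
    ← Matrix.mul_assoc, ← Matrix.mul_assoc, spinAlong]
  congr 2
  simp only [add_mul, smul_mul_assoc, smul_add, smul_smul]
  push_cast
  module

theorem rotation_mul_conjTranspose (d : ℕ) (α β γ : ℝ) :
    rotation d α β γ * (rotation d α β γ)ᴴ = 1 := by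
  rw [rotation, Matrix.conjTranspose_mul, Matrix.conjTranspose_mul]
  have h1 := exp_mul_conjTranspose_exp (spinZ_isHermitian d) α
  have h2 := exp_mul_conjTranspose_exp (spinY_isHermitian d) β
  have h3 := exp_mul_conjTranspose_exp (spinZ_isHermitian d) γ
  generalize NormedSpace.exp ((-(Complex.I * (γ : ℂ))) • spinZ d) = C at *
  generalize NormedSpace.exp ((-(Complex.I * (α : ℂ))) • spinZ d) = A at *
  generalize NormedSpace.exp ((-(Complex.I * (β : ℂ))) • spinY d) = B at *
  calc A * B * C * (Cᴴ * (Bᴴ * Aᴴ)) = A * (B * (C * Cᴴ) * Bᴴ) * Aᴴ := by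
        simp only [Matrix.mul_assoc]
    _ = 1 := by rw [h3, mul_one, h2, mul_one, h1]

theorem rotation_conjTranspose_mul (d : ℕ) (α β γ : ℝ) :
    (rotation d α β γ)ᴴ * rotation d α β γ = 1 :=
  mul_eq_one_comm.1 (rotation_mul_conjTranspose d α β γ)

theorem spinZ_one : spinZ 1 = (1 / 2 : ℂ) • pauliZ := by
  ext i k
  fin_cases i <;> fin_cases k <;> simp [spinZ, pauliZ]
  norm_num

theorem spinX_one : spinX 1 = (1 / 2 : ℂ) • pauliX := by
  ext i k
  fin_cases i <;> fin_cases k <;> simp [spinX, pauliX, spinRaise]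

theorem spinY_one : spinY 1 = (1 / 2 : ℂ) • pauliY := by
  ext i k
  fin_cases i <;> fin_cases k <;> simp [spinY, pauliY, spinRaise] <;> ring

theorem axisGate_eq_spinAlong (θ ϑ φ : ℝ) :
    axisGate θ ϑ φ = (Real.cos (θ / 2) : ℂ) • 1 -
      (2 * Complex.I * Real.sin (θ / 2)) • spinAlong 1 ϑ φ := by
  rw [axisGate, spinAlong, spinX_one, spinY_one, spinZ_one]
  module

/-- The gate is a linear function of the spin along its axis, so only the rotated axis matters. Its
independence of γ is what later lets the average over γ act on the probe alone. -/
theorem rotatedGate_eq_axisGate (θ α β γ : ℝ) : rotatedGate θ α β γ = axisGate θ β α := by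
  have h0 : spinAlong 1 0 0 = spinZ 1 := by simp [spinAlong]
  rw [rotatedGate, axisGate_eq_spinAlong, axisGate_eq_spinAlong, h0, mul_sub, sub_mul,
    mul_smul_comm, mul_smul_comm, smul_mul_assoc, smul_mul_assoc, rotation_mul_spinZ, mul_one,
    rotation_mul_conjTranspose, Matrix.mul_assoc, rotation_mul_conjTranspose, mul_one]


/-! The Heisenberg gate. -/

/-- The operator `J·σ`. -/
def spinDotPauli (d : ℕ) : Op (Fin (d + 1) × Fin 2) :=
  spinX d ⊗ₖ pauliX + spinY d ⊗ₖ pauliY + spinZ d ⊗ₖ pauliZ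

theorem pauli_mul :
    pauliX * pauliX = 1 ∧ pauliY * pauliY = 1 ∧ pauliZ * pauliZ = 1 ∧
      pauliX * pauliY = Complex.I • pauliZ ∧ pauliY * pauliX = (-Complex.I) • pauliZ ∧
      pauliY * pauliZ = Complex.I • pauliX ∧ pauliZ * pauliY = (-Complex.I) • pauliX ∧
      pauliZ * pauliX = Complex.I • pauliY ∧ pauliX * pauliZ = (-Complex.I) • pauliY := by
  refine ⟨?_, ?_, ?_, ?_, ?_, ?_, ?_, ?_, ?_⟩ <;>
  · ext i k
    fin_cases i <;> fin_cases k <;> simp [pauliX, pauliY, pauliZ, Matrix.mul_apply]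

/-- In the products σ_aσ_b the symmetric part produces the Casimir operator, and the antisymmetric
part produces commutators of the spin components, which reassemble to -J·σ. -/
theorem spinDotPauli_sq (d : ℕ) :
    spinDotPauli d * spinDotPauli d =
      ((d : ℂ) / 2 * ((d : ℂ) / 2 + 1)) • 1 - spinDotPauli d := by
  obtain ⟨h1, h2, h3, h4, h5, h6, h7, h8, h9⟩ := pauli_mul
  have e : spinDotPauli d * spinDotPauli d =
      (spinX d * spinX d + spinY d * spinY d + spinZ d * spinZ d) ⊗ₖ (1 : Op (Fin 2)) +
      Complex.I • ((spinX d * spinY d - spinY d * spinX d) ⊗ₖ pauliZ +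
        (spinY d * spinZ d - spinZ d * spinY d) ⊗ₖ pauliX +
        (spinZ d * spinX d - spinX d * spinZ d) ⊗ₖ pauliY) := by
    simp only [spinDotPauli, add_mul, mul_add, ← Matrix.mul_kronecker_mul, h1, h2, h3, h4, h5, h6,
      h7, h8, h9, Matrix.add_kronecker, Matrix.kronecker_smul, sub_eq_add_neg, smul_add,
      ← neg_one_smul ℂ (spinY d * spinX d), ← neg_one_smul ℂ (spinZ d * spinY d),
      ← neg_one_smul ℂ (spinX d * spinZ d), Matrix.smul_kronecker]
    module
  rw [e, spin_casimir, spin_comm_xy, spin_comm_yz, spin_comm_zx]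
  simp only [Matrix.smul_kronecker, Matrix.one_kronecker_one, spinDotPauli]
  simp only [smul_add, smul_smul, Complex.I_mul_I]
  module

/-- The phase of the Heisenberg gate. -/
def gatePhase (d : ℕ) (θ : ℝ) : ℂ :=
  Complex.exp (Complex.I * ((interactionAngle d θ / (2 * ((d : ℝ) + 1)) : ℝ) : ℂ))

/-- The coefficient of the identity in the Heisenberg gate, up to the phase. -/
def gateDiag (d : ℕ) (θ : ℝ) : ℂ :=
  Real.cos (interactionAngle d θ / 2) -
    Complex.I * ((Real.sin (interactionAngle d θ / 2) / ((d : ℝ) + 1) : ℝ) : ℂ)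

/-- The strength of the spin-spin coupling in the Heisenberg gate. -/
def gateCoupling (d : ℕ) (θ : ℝ) : ℝ :=
  2 * Real.sin (interactionAngle d θ / 2) / ((d : ℝ) + 1)

/-- By `spinDotPauli_sq`, (2S + 1)² = 4j(j+1) + 1 = (2j + 1)² for S = J·σ. Thus S is half of (2j +
1) times an involution minus 1; the scalar part yields the phase and the involution yields cosine
and sine of f/2. -/
theorem heisenbergGate_eq (d : ℕ) (θ : ℝ) :
    heisenbergGate d θ = gatePhase d θ •
      (gateDiag d θ • 1 - (Complex.I * gateCoupling d θ) • spinDotPauli d) := by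
  have hN : ((d : ℂ) + 1) ≠ 0 := by exact_mod_cast Nat.succ_ne_zero d
  have hB : ((1 / ((d : ℂ) + 1)) • ((2 : ℂ) • spinDotPauli d + 1)) *
      ((1 / ((d : ℂ) + 1)) • ((2 : ℂ) • spinDotPauli d + 1)) = 1 := by
    simp only [smul_mul_assoc, mul_smul_comm, smul_smul, add_mul, mul_add, spinDotPauli_sq,
      mul_one, one_mul]
    match_scalars
    · field_simp; ring
    · ring
  have he := exp_smul_eq_cos_sub_sin hB (interactionAngle d θ / 2)
  rw [heisenbergGate, ← spinDotPauli]
  have hs : (-(Complex.I * ((interactionAngle d θ / ((d : ℝ) + 1) : ℝ) : ℂ))) • spinDotPauli d =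
      (Complex.I * ((interactionAngle d θ / (2 * ((d : ℝ) + 1)) : ℝ) : ℂ)) • 1 +
        (-(Complex.I * ((interactionAngle d θ / 2 : ℝ) : ℂ))) •
          ((1 / ((d : ℂ) + 1)) • ((2 : ℂ) • spinDotPauli d + 1)) := by
    push_cast
    match_scalars <;> field_simp
    ring
  rw [hs, Matrix.exp_add_of_commute _ _ ((Commute.one_left _).smul_left _), exp_smul_one, he,
    smul_mul_assoc, one_mul, gatePhase]
  congr 1
  simp only [gateDiag, gateCoupling]
  push_cast
  match_scalars <;> field_simp

theorem gatePhase_mul_star (d : ℕ) (θ : ℝ) : gatePhase d θ * star (gatePhase d θ) = 1 := by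
  rw [gatePhase, Complex.star_def, ← Complex.exp_conj, ← Complex.exp_add, map_mul, Complex.conj_I,
    Complex.conj_ofReal, neg_mul, add_neg_cancel, Complex.exp_zero]

theorem pauli_isHermitian : pauliXᴴ = pauliX ∧ pauliYᴴ = pauliY ∧ pauliZᴴ = pauliZ := by
  refine ⟨?_, ?_, ?_⟩ <;>
  · ext i k
    fin_cases i <;> fin_cases k <;> simp [pauliX, pauliY, pauliZ]

theorem heisenbergGate_mul_conjTranspose (d : ℕ) (θ : ℝ) :
    heisenbergGate d θ * (heisenbergGate d θ)ᴴ = 1 := by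
  apply exp_mul_conjTranspose_exp
  simp only [Matrix.conjTranspose_add, Matrix.conjTranspose_kronecker, spinX_isHermitian,
    spinY_isHermitian, spinZ_isHermitian]
  rw [pauli_isHermitian.1, pauli_isHermitian.2.1, pauli_isHermitian.2.2]

theorem heisenbergGate_conjTranspose_mul (d : ℕ) (θ : ℝ) :
    (heisenbergGate d θ)ᴴ * heisenbergGate d θ = 1 :=
  mul_eq_one_comm.1 (heisenbergGate_mul_conjTranspose d θ)

/-- The identity and the Pauli matrices. -/
def pauliBasis : Fin 4 → Op (Fin 2) := ![1, pauliX, pauliY, pauliZ]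

/-- The coefficients of the Heisenberg gate with respect to the Pauli matrices. -/
def gateComponent (d : ℕ) (θ : ℝ) : Fin 4 → Op (Fin (d + 1)) :=
  ![(gatePhase d θ * gateDiag d θ) • 1,
    (-(gatePhase d θ * (Complex.I * gateCoupling d θ))) • spinX d,
    (-(gatePhase d θ * (Complex.I * gateCoupling d θ))) • spinY d,
    (-(gatePhase d θ * (Complex.I * gateCoupling d θ))) • spinZ d]

theorem heisenbergGate_eq_sum (d : ℕ) (θ : ℝ) :
    heisenbergGate d θ = ∑ a, gateComponent d θ a ⊗ₖ pauliBasis a := by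
  rw [heisenbergGate_eq, Fin.sum_univ_four, spinDotPauli]
  simp only [gateComponent, pauliBasis, Matrix.cons_val, Matrix.smul_kronecker,
    Matrix.one_kronecker_one]
  module

theorem trace_pauliBasis (a b : Fin 4) :
    (pauliBasis a * (pauliBasis b)ᴴ).trace = if a = b then 2 else 0 := by
  fin_cases a <;> fin_cases b <;>
    simp only [pauliBasis, pauliX, pauliY, pauliZ, Matrix.trace_fin_two, Matrix.mul_apply,
      Fin.sum_univ_two, Matrix.conjTranspose_apply] <;> simp <;> norm_num

theorem traceSnd_kronecker {ι κ : Type} [Fintype κ] (X : Op ι) (Y : Op κ) :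
    traceSnd (X ⊗ₖ Y) = Y.trace • X := by
  ext a b
  simp [traceSnd, Matrix.trace, mul_comm, Finset.mul_sum]

theorem traceFst_kronecker {ι κ : Type} [Fintype ι] (X : Op ι) (Y : Op κ) :
    traceFst (X ⊗ₖ Y) = X.trace • Y := by
  ext a b
  simp [traceFst, Matrix.trace, Finset.sum_mul]

theorem traceSnd_sum {ι κ η : Type} [Fintype κ] (s : Finset η) (X : η → Op (ι × κ)) :
    traceSnd (∑ i ∈ s, X i) = ∑ i ∈ s, traceSnd (X i) := by
  ext a b
  simp only [traceSnd, Matrix.of_apply, Matrix.sum_apply]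
  exact Finset.sum_comm

theorem traceFst_sum {ι κ η : Type} [Fintype ι] (s : Finset η) (X : η → Op (ι × κ)) :
    traceFst (∑ i ∈ s, X i) = ∑ i ∈ s, traceFst (X i) := by
  ext a b
  simp only [traceFst, Matrix.of_apply, Matrix.sum_apply]
  exact Finset.sum_comm

theorem traceFst_smul {ι κ : Type} [Fintype ι] (c : ℂ) (X : Op (ι × κ)) :
    traceFst (c • X) = c • traceFst X := by
  ext a b
  simp [traceFst, Finset.mul_sum]

theorem trace_traceFst {ι κ : Type} [Fintype ι] [Fintype κ] (X : Op (ι × κ)) :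
    (traceFst X).trace = X.trace := by
  simp only [traceFst, Matrix.trace, Matrix.diag_apply, Matrix.of_apply, Fintype.sum_prod_type]
  exact Finset.sum_comm

theorem heisenberg_conj_kronecker (d : ℕ) (θ : ℝ) (ρ : Op (Fin (d + 1))) (X : Op (Fin 2)) :
    heisenbergGate d θ * (ρ ⊗ₖ X) * (heisenbergGate d θ)ᴴ =
      ∑ a, ∑ b, (gateComponent d θ a * ρ * (gateComponent d θ b)ᴴ) ⊗ₖ
        (pauliBasis a * X * (pauliBasis b)ᴴ) := by
  rw [heisenbergGate_eq_sum, Matrix.conjTranspose_sum, Finset.sum_mul, Finset.sum_mul]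
  refine Finset.sum_congr rfl fun a _ => ?_
  rw [Finset.mul_sum]
  refine Finset.sum_congr rfl fun b _ => ?_
  rw [Matrix.conjTranspose_kronecker, ← Matrix.mul_kronecker_mul, ← Matrix.mul_kronecker_mul]

/-- Against a maximally mixed target the Pauli matrices are orthogonal, so their coefficients in the
gate act as Kraus operators on the memory and the phase cancels. -/
theorem memoryUpdate_eq (d : ℕ) (θ : ℝ) (ρ : Op (Fin (d + 1))) :
    memoryUpdate d θ ρ = (gateDiag d θ * star (gateDiag d θ)) • ρ +
      ((gateCoupling d θ : ℂ) ^ 2) •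
        (spinX d * ρ * spinX d + spinY d * ρ * spinY d + spinZ d * ρ * spinZ d) := by
  have h1 : memoryUpdate d θ ρ = ∑ a, gateComponent d θ a * ρ * (gateComponent d θ a)ᴴ := by
    rw [memoryUpdate, heisenberg_conj_kronecker, traceSnd_sum]
    refine Finset.sum_congr rfl fun a _ => ?_
    rw [traceSnd_sum]
    simp only [traceSnd_kronecker, mul_smul_comm, smul_mul_assoc, mul_one, Matrix.trace_smul,
      trace_pauliBasis]
    simp [Finset.sum_ite_eq]
  have hw := gatePhase_mul_star d θ
  rw [h1, Fin.sum_univ_four]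
  simp only [gateComponent, Matrix.cons_val, Matrix.conjTranspose_smul, Matrix.conjTranspose_one,
    spinX_isHermitian, spinY_isHermitian, spinZ_isHermitian, smul_mul_assoc, mul_smul_comm,
    smul_smul, one_mul, mul_one, star_mul', star_neg, Complex.star_def, Complex.conj_I,
    Complex.conj_ofReal] at hw ⊢
  generalize gatePhase d θ = w at *
  match_scalars
  · linear_combination (gateDiag d θ * (starRingEnd ℂ) (gateDiag d θ)) * hw
  all_goals
    linear_combination ((gateCoupling d θ : ℂ) ^ 2) * hw -
      (w * (starRingEnd ℂ) w * (gateCoupling d θ : ℂ) ^ 2) * Complex.I_sq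

theorem kronecker_ketBra {ι : Type} (ρ : Op ι) (ψ : Fin 2 → ℂ) :
    ρ ⊗ₖ ketBra ψ = ∑ q, ∑ r, (ψ q * star (ψ r)) • (ρ ⊗ₖ Matrix.single q r (1 : ℂ)) := by
  have : ketBra ψ = ∑ q, ∑ r, (ψ q * star (ψ r)) • Matrix.single q r (1 : ℂ) := by
    ext a b
    fin_cases a <;> fin_cases b <;> simp [ketBra, Matrix.vecMulVec_apply, Fin.sum_univ_two]
  rw [this]
  ext ⟨i, a⟩ ⟨k, b⟩
  simp only [Matrix.kroneckerMap_apply, Matrix.sum_apply, Matrix.smul_apply, smul_eq_mul,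
    Finset.mul_sum]
  refine Finset.sum_congr rfl fun q _ => Finset.sum_congr rfl fun r _ => ?_
  ring

theorem sum_mul_single_mul_apply (A B : Op (Fin 2)) :
    ∑ q, ∑ r, (A * Matrix.single q r (1 : ℂ) * B : Op (Fin 2)) q r = A.trace * B.trace := by
  simp [Matrix.trace, Matrix.mul_apply, Fin.sum_univ_two, Matrix.single_apply]
  ring

theorem sum_trace_mul_single_mul (A B : Op (Fin 2)) :
    ∑ q, (A * Matrix.single q q (1 : ℂ) * B).trace = (A * B).trace := by
  have : ∑ q, Matrix.single q q (1 : ℂ) = (1 : Op (Fin 2)) := by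
    ext a b
    fin_cases a <;> fin_cases b <;> simp [Fin.sum_univ_two]
  rw [← Matrix.trace_sum, ← Finset.sum_mul, ← Finset.mul_sum, this, mul_one]

/-- Trace preservation gives the first term. In the entanglement fidelity, contracting the target
with V turns the gate into a single operator on the memory. -/
theorem gateFidelity_heisenberg (d : ℕ) (θ : ℝ) (V : Op (Fin 2)) (hV : V * Vᴴ = 1)
    (ρ : Op (Fin (d + 1))) :
    gateFidelity V (heisenbergChannel d θ) ρ =
      (2 * ρ.trace + ((∑ a, (Vᴴ * pauliBasis a).trace • gateComponent d θ a) * ρ *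
        (∑ a, (Vᴴ * pauliBasis a).trace • gateComponent d θ a)ᴴ).trace).re / 6 := by
  rw [gateFidelity_of_expansion V (heisenbergChannel d θ) ρ
    (fun q r => traceFst (heisenbergGate d θ * (ρ ⊗ₖ Matrix.single q r (1 : ℂ)) *
      (heisenbergGate d θ)ᴴ))
    (by
      intro ψ
      rw [heisenbergChannel, kronecker_ketBra]
      simp only [Finset.mul_sum, Finset.sum_mul, traceFst_sum, mul_smul_comm, smul_mul_assoc,
        traceFst_smul])]
  congr 3
  · have h : ∀ q : Fin 2, (Vᴴ * traceFst (heisenbergGate d θ * (ρ ⊗ₖ Matrix.single q q (1 : ℂ)) *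
        (heisenbergGate d θ)ᴴ) * V).trace = ρ.trace := by
      intro q
      rw [Matrix.mul_assoc, Matrix.trace_mul_comm, Matrix.mul_assoc, hV, mul_one, trace_traceFst,
        Matrix.trace_mul_comm, ← Matrix.mul_assoc, heisenbergGate_conjTranspose_mul, one_mul,
        Matrix.trace_kronecker]
      simp
    simp [h]
  · simp only [heisenberg_conj_kronecker, traceFst_sum, traceFst_kronecker, Finset.mul_sum,
      Finset.sum_mul, Matrix.sum_apply, mul_smul_comm, smul_mul_assoc, Matrix.smul_apply,
      Matrix.trace_sum, Matrix.conjTranspose_sum, Matrix.conjTranspose_smul, Matrix.trace_smul,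
      smul_eq_mul]
    have h : ∀ a b : Fin 4, ∑ q, ∑ r, (Vᴴ * (pauliBasis a * Matrix.single q r (1 : ℂ) *
        (pauliBasis b)ᴴ) * V : Op (Fin 2)) q r =
        (Vᴴ * pauliBasis a).trace * star (Vᴴ * pauliBasis b).trace := by
      intro a b
      rw [← Matrix.trace_conjTranspose, Matrix.conjTranspose_mul, Matrix.conjTranspose_conjTranspose,
        ← sum_mul_single_mul_apply]
      simp only [Matrix.mul_assoc]
    calc _ = ∑ b, ∑ a, ∑ q, ∑ r, (gateComponent d θ a * ρ * (gateComponent d θ b)ᴴ).trace *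
          (Vᴴ * (pauliBasis a * Matrix.single q r (1 : ℂ) * (pauliBasis b)ᴴ) * V : Op (Fin 2)) q r := by
          simp only [Fin.sum_univ_two, Fin.sum_univ_four]
          ring
      _ = _ := by
          refine Finset.sum_congr rfl fun b _ => Finset.sum_congr rfl fun a _ => ?_
          simp only [← Finset.mul_sum, h]
          ring

theorem axisGate_mul_conjTranspose (θ ϑ φ : ℝ) :
    axisGate θ ϑ φ * (axisGate θ ϑ φ)ᴴ = 1 := by
  obtain ⟨h1, h2, h3, h4, h5, h6, h7, h8, h9⟩ := pauli_mul
  have e1 : (Real.sin ϑ : ℂ) ^ 2 + (Real.cos ϑ : ℂ) ^ 2 = 1 := by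
    exact_mod_cast Real.sin_sq_add_cos_sq ϑ
  have e2 : (Real.sin φ : ℂ) ^ 2 + (Real.cos φ : ℂ) ^ 2 = 1 := by
    exact_mod_cast Real.sin_sq_add_cos_sq φ
  have e3 : (Real.sin (θ / 2) : ℂ) ^ 2 + (Real.cos (θ / 2) : ℂ) ^ 2 = 1 := by
    exact_mod_cast Real.sin_sq_add_cos_sq (θ / 2)
  simp only [axisGate, Matrix.conjTranspose_sub, Matrix.conjTranspose_smul,
    Matrix.conjTranspose_add, Matrix.conjTranspose_one, pauli_isHermitian.1,
    pauli_isHermitian.2.1, pauli_isHermitian.2.2, star_mul', Complex.star_def, Complex.conj_I,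
    Complex.conj_ofReal, mul_sub, sub_mul, mul_add, add_mul, mul_smul_comm, smul_mul_assoc, h1, h2,
    h3, h4, h5, h6, h7, h8, h9, mul_one, one_mul, smul_sub, smul_add, smul_smul]
  simp only [Complex.ofReal_mul]
  generalize (Real.sin (θ / 2) : ℂ) = s at *
  generalize (Real.cos (θ / 2) : ℂ) = c at *
  generalize (Real.sin ϑ : ℂ) = s₁ at *
  generalize (Real.cos ϑ : ℂ) = c₁ at *
  generalize (Real.sin φ : ℂ) = s₂ at *
  generalize (Real.cos φ : ℂ) = c₂ at *
  match_scalars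
  · linear_combination e3 - s ^ 2 * Complex.I_sq - s ^ 2 * e1 * Complex.I ^ 2 -
      s ^ 2 * s₁ ^ 2 * e2 * Complex.I ^ 2
  all_goals ring

theorem axisGate_conjTranspose_mul (θ ϑ φ : ℝ) :
    (axisGate θ ϑ φ)ᴴ * axisGate θ ϑ φ = 1 :=
  mul_eq_one_comm.1 (axisGate_mul_conjTranspose θ ϑ φ)

theorem trace_axisGate_mul (θ ϑ φ : ℝ) (X : Op (Fin 2)) :
    ((axisGate θ ϑ φ)ᴴ * X).trace = Real.cos (θ / 2) * X.trace +
      Complex.I * Real.sin (θ / 2) * (Real.sin ϑ * Real.cos φ * (pauliX * X).trace +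
        Real.sin ϑ * Real.sin φ * (pauliY * X).trace + Real.cos ϑ * (pauliZ * X).trace) := by
  simp only [axisGate, Matrix.conjTranspose_sub, Matrix.conjTranspose_smul,
    Matrix.conjTranspose_add, Matrix.conjTranspose_one, pauli_isHermitian.1,
    pauli_isHermitian.2.1, pauli_isHermitian.2.2, star_mul', Complex.star_def, Complex.conj_I,
    Complex.conj_ofReal, sub_mul, add_mul, smul_mul_assoc, one_mul, Matrix.trace_sub,
    Matrix.trace_add, Matrix.trace_smul, smul_eq_mul]
  push_cast
  ring

theorem trace_pauli : pauliX.trace = 0 ∧ pauliY.trace = 0 ∧ pauliZ.trace = 0 := by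
  simp [pauliX, pauliY, pauliZ, Matrix.trace_fin_two]

/-- The contracted operator is 2w(cos(θ/2) p + sin(θ/2) q J_n) with a phase w. Its modulus squared
is a quadratic polynomial in J_n, whose linear term contains p + p̄ = 2 cos(f/2). -/
theorem gateFidelity_heisenberg_axisGate (d : ℕ) (θ ϑ φ : ℝ) (ρ : Op (Fin (d + 1))) :
    gateFidelity (axisGate θ ϑ φ) (heisenbergChannel d θ) ρ =
      ((2 + 4 * Real.cos (θ / 2) ^ 2 * (gateDiag d θ * star (gateDiag d θ))) * ρ.trace +
        8 * Real.cos (θ / 2) * Real.sin (θ / 2) * gateCoupling d θ *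
          Real.cos (interactionAngle d θ / 2) * (ρ * spinAlong d ϑ φ).trace +
        4 * Real.sin (θ / 2) ^ 2 * gateCoupling d θ ^ 2 *
          (ρ * (spinAlong d ϑ φ * spinAlong d ϑ φ)).trace).re / 6 := by
  obtain ⟨h1, h2, h3, h4, h5, h6, h7, h8, h9⟩ := pauli_mul
  obtain ⟨t1, t2, t3⟩ := trace_pauli
  have hN : ∑ a, ((axisGate θ ϑ φ)ᴴ * pauliBasis a).trace • gateComponent d θ a =
      (2 * gatePhase d θ) • ((Real.cos (θ / 2) * gateDiag d θ) • 1 +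
        ((Real.sin (θ / 2) : ℂ) * gateCoupling d θ) • spinAlong d ϑ φ) := by
    rw [Fin.sum_univ_four]
    simp only [trace_axisGate_mul]
    simp only [pauliBasis, gateComponent, Matrix.cons_val, h1, h2, h3, h4, h5,
      h6, h7, h8, h9, Matrix.trace_smul, t1, t2, t3, mul_one, Matrix.trace_one, Fintype.card_fin,
      smul_zero, mul_zero, add_zero, zero_add, spinAlong, Complex.ofReal_mul]
    generalize (Real.sin (θ / 2) : ℂ) = s at *
    generalize (Real.cos (θ / 2) : ℂ) = c at *
    generalize (Real.sin ϑ : ℂ) = s₁ at *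
    generalize (Real.cos ϑ : ℂ) = c₁ at *
    generalize (Real.sin φ : ℂ) = s₂ at *
    generalize (Real.cos φ : ℂ) = c₂ at *
    match_scalars
    · ring
    · linear_combination (-2 * gatePhase d θ * s * gateCoupling d θ * (s₁ * c₂)) * Complex.I_sq
    · linear_combination (-2 * gatePhase d θ * s * gateCoupling d θ * (s₁ * s₂)) * Complex.I_sq
    · linear_combination (-2 * gatePhase d θ * s * gateCoupling d θ * c₁) * Complex.I_sq
  have hw := gatePhase_mul_star d θ
  have hJ : (spinAlong d ϑ φ)ᴴ = spinAlong d ϑ φ := by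
    simp only [spinAlong, Matrix.conjTranspose_add, Matrix.conjTranspose_smul, spinX_isHermitian,
      spinY_isHermitian, spinZ_isHermitian, Complex.star_def, Complex.conj_ofReal]
  have hp : gateDiag d θ + star (gateDiag d θ) = 2 * Real.cos (interactionAngle d θ / 2) := by
    simp only [gateDiag, star_sub, star_mul', Complex.star_def, Complex.conj_I,
      Complex.conj_ofReal]
    ring
  rw [gateFidelity_heisenberg d θ _ (axisGate_mul_conjTranspose θ ϑ φ), hN]
  congr 2
  rw [Matrix.trace_mul_comm, ← Matrix.mul_assoc, Matrix.trace_mul_comm]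
  simp only [Matrix.conjTranspose_smul, Matrix.conjTranspose_add, Matrix.conjTranspose_one, hJ,
    star_mul', Complex.star_def, Complex.conj_ofReal, mul_add, add_mul, mul_smul_comm, smul_mul_assoc, one_mul,
    mul_one, smul_add, smul_smul, Matrix.trace_add, Matrix.trace_smul, smul_eq_mul,
    map_ofNat] at hw hp ⊢
  linear_combination (4 * (Real.cos (θ / 2) : ℂ) ^ 2 * (gateDiag d θ *
    (starRingEnd ℂ) (gateDiag d θ)) * ρ.trace + 4 * (Real.sin (θ / 2) : ℂ) ^ 2 *
      (gateCoupling d θ : ℂ) ^ 2 * (ρ * (spinAlong d ϑ φ * spinAlong d ϑ φ)).trace +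
      4 * (Real.cos (θ / 2) : ℂ) * Real.sin (θ / 2) * gateCoupling d θ *
        (gateDiag d θ + (starRingEnd ℂ) (gateDiag d θ)) * (ρ * spinAlong d ϑ φ).trace) * hw +
    4 * (Real.cos (θ / 2) : ℂ) * Real.sin (θ / 2) * gateCoupling d θ *
      (ρ * spinAlong d ϑ φ).trace * hp


/-! The reuse of the memory. -/

section Sandwich

variable {A : Type} [Ring A] [Algebra ℂ A] {x y z : A} {κ : ℂ}

/-- The map X ↦ Σ_a J_aXJ_a equals κ minus half of the double commutator Σ_a [J_a, [J_a, ·]], so on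
tensors of rank l it is the scalar κ - l(l+1)/2; here l = 1. -/
theorem sandwich_linear (hxy : x * y - y * x = Complex.I • z) (hyz : y * z - z * y = Complex.I • x)
    (hzx : z * x - x * z = Complex.I • y) (hκ : x * x + y * y + z * z = κ • 1) :
    x * z * x + y * z * y + z * z * z = (κ - 1) • z := by
  have h1 : x * z * x + y * z * y + z * z * z = (x * x + y * y + z * z) * z +
      x * (z * x - x * z) - y * (y * z - z * y) := by noncomm_ring
  have h2 : x * (Complex.I • y) - y * (Complex.I • x) = Complex.I • (x * y - y * x) := by
    simp only [mul_smul_comm, smul_sub]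
  rw [h1, hκ, hzx, hyz, add_sub_assoc, h2, hxy, smul_smul, Complex.I_mul_I, smul_mul_assoc, one_mul]
  module

/-- N² is κ/3 plus a tensor of rank 2. The sandwich multiplies the first part by κ and the second by
κ - 3, whence the additional scalar κ. -/
theorem sandwich_sq (hxy : x * y - y * x = Complex.I • z) (hyz : y * z - z * y = Complex.I • x)
    (hzx : z * x - x * z = Complex.I • y) (hκ : x * x + y * y + z * z = κ • 1) {a b c : ℂ}
    (h : a ^ 2 + b ^ 2 + c ^ 2 = 1) {N : A} (hN : N = a • x + b • y + c • z) :
    x * (N * N) * x + y * (N * N) * y + z * (N * N) * z = (κ - 3) • (N * N) + κ • 1 := by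
  -- The vector (u, v, w) is the cross product of the direction (a, b, c) with the spin; it
  -- describes the commutators of the spin with N.
  obtain ⟨u, hu⟩ : ∃ u, u = b • z - c • y := ⟨_, rfl⟩
  obtain ⟨v, hv⟩ : ∃ v, v = c • x - a • z := ⟨_, rfl⟩
  obtain ⟨w, hw⟩ : ∃ w, w = a • y - b • x := ⟨_, rfl⟩
  have hx : x * N - N * x = Complex.I • u := by
    have : x * N - N * x = b • (x * y - y * x) - c • (z * x - x * z) := by
      rw [hN]; simp only [mul_add, add_mul, mul_smul_comm, smul_mul_assoc]; module
    rw [this, hxy, hzx, hu]; module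
  have hy : y * N - N * y = Complex.I • v := by
    have : y * N - N * y = c • (y * z - z * y) - a • (x * y - y * x) := by
      rw [hN]; simp only [mul_add, add_mul, mul_smul_comm, smul_mul_assoc]; module
    rw [this, hyz, hxy, hv]; module
  have hz : z * N - N * z = Complex.I • w := by
    have : z * N - N * z = a • (z * x - x * z) - b • (y * z - z * y) := by
      rw [hN]; simp only [mul_add, add_mul, mul_smul_comm, smul_mul_assoc]; module
    rw [this, hzx, hyz, hw]; module
  have h1 : x * u + y * v + z * w = (-Complex.I) • N := by
    have : x * u + y * v + z * w = -(c • (x * y - y * x) + b • (z * x - x * z) +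
        a • (y * z - z * y)) := by
      rw [hu, hv, hw]; simp only [mul_sub, mul_smul_comm]; module
    rw [this, hxy, hyz, hzx, hN]; module
  have h2 : u * x + v * y + w * z = Complex.I • N := by
    have : u * x + v * y + w * z = c • (x * y - y * x) + b • (z * x - x * z) +
        a • (y * z - z * y) := by
      rw [hu, hv, hw]; simp only [sub_mul, smul_mul_assoc]; module
    rw [this, hxy, hyz, hzx, hN]; module
  have h3 : u * u + v * v + w * w = κ • 1 - N * N := by
    rw [← hκ, hu, hv, hw, hN]
    simp only [sub_mul, mul_sub, smul_mul_assoc, mul_smul_comm, add_mul, mul_add]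
    match_scalars <;> first | linear_combination h | ring
  -- Both factors N are moved outwards: J_aN = NJ_a + C_a and NJ_a = J_aN - C_a, where C_a = [J_a,
  -- N].
  have h4 : x * (N * N) * x + y * (N * N) * y + z * (N * N) * z =
      N * (x * x + y * y + z * z) * N - N * (x * (x * N - N * x) + y * (y * N - N * y) +
        z * (z * N - N * z)) + ((x * N - N * x) * x + (y * N - N * y) * y + (z * N - N * z) * z) * N
        - ((x * N - N * x) * (x * N - N * x) + (y * N - N * y) * (y * N - N * y) +
          (z * N - N * z) * (z * N - N * z)) := by
    noncomm_ring
  rw [h4, hκ, hx, hy, hz]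
  have h5 : x * Complex.I • u + y * Complex.I • v + z * Complex.I • w = N := by
    simp only [mul_smul_comm, ← smul_add, h1, smul_smul, mul_neg, Complex.I_mul_I, neg_neg, one_smul]
  have h6 : Complex.I • u * x + Complex.I • v * y + Complex.I • w * z = -N := by
    simp only [smul_mul_assoc, ← smul_add, h2, smul_smul, Complex.I_mul_I, neg_one_smul]
  have h7 : Complex.I • u * Complex.I • u + Complex.I • v * Complex.I • v +
      Complex.I • w * Complex.I • w = N * N - κ • 1 := by
    simp only [smul_mul_assoc, mul_smul_comm, ← smul_add, h3, smul_smul, Complex.I_mul_I]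
    module
  rw [h5, h6, h7]
  simp only [mul_smul_comm, smul_mul_assoc, mul_one, neg_mul]
  module

end Sandwich

theorem spherical_sq_sum (ϑ φ : ℝ) :
    ((Real.sin ϑ * Real.cos φ : ℝ) : ℂ) ^ 2 + ((Real.sin ϑ * Real.sin φ : ℝ) : ℂ) ^ 2 +
      ((Real.cos ϑ : ℝ) : ℂ) ^ 2 = 1 := by
  have h : (Real.sin ϑ * Real.cos φ) ^ 2 + (Real.sin ϑ * Real.sin φ) ^ 2 + Real.cos ϑ ^ 2 = 1 := by
    have h1 := Real.sin_sq_add_cos_sq ϑ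
    have h2 := Real.sin_sq_add_cos_sq φ
    linear_combination h1 + Real.sin ϑ ^ 2 * h2
  exact_mod_cast h

/-- `J² = j (j + 1)` for `d = 2j`. -/
def casimir (d : ℕ) : ℝ := (d : ℝ) / 2 * ((d : ℝ) / 2 + 1)

theorem spin_casimir' (d : ℕ) :
    spinX d * spinX d + spinY d * spinY d + spinZ d * spinZ d = (casimir d : ℂ) • 1 := by
  rw [spin_casimir, casimir]; push_cast; rfl

/-- The normalization |p|² + q² j(j+1) = 1, a consequence of (2j+1)² = 4j(j+1) + 1. -/
theorem gateDiag_mul_star (d : ℕ) (θ : ℝ) :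
    gateDiag d θ * star (gateDiag d θ) = 1 - (gateCoupling d θ : ℂ) ^ 2 * casimir d := by
  have hN : ((d : ℂ) + 1) ≠ 0 := by exact_mod_cast Nat.succ_ne_zero d
  have h : (Real.sin (interactionAngle d θ / 2) : ℂ) ^ 2 +
      (Real.cos (interactionAngle d θ / 2) : ℂ) ^ 2 = 1 := by
    exact_mod_cast Real.sin_sq_add_cos_sq (interactionAngle d θ / 2)
  simp only [gateDiag, gateCoupling, casimir, star_sub, star_mul', Complex.star_def, Complex.conj_I,
    Complex.conj_ofReal]
  simp only [Complex.ofReal_mul, Complex.ofReal_div, Complex.ofReal_add,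
    Complex.ofReal_natCast, Complex.ofReal_one, Complex.ofReal_ofNat]
  generalize (Real.sin (interactionAngle d θ / 2) : ℂ) = s at *
  generalize (Real.cos (interactionAngle d θ / 2) : ℂ) = c at *
  field_simp
  linear_combination ((d : ℂ) + 1) ^ 2 * h - s ^ 2 * Complex.I_sq

theorem memoryUpdate_trace (d : ℕ) (θ : ℝ) (ρ : Op (Fin (d + 1))) :
    (memoryUpdate d θ ρ).trace = ρ.trace := by
  rw [memoryUpdate_eq, gateDiag_mul_star]
  have h : (spinX d * ρ * spinX d + spinY d * ρ * spinY d + spinZ d * ρ * spinZ d).trace =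
      casimir d * ρ.trace := by
    rw [Matrix.trace_add, Matrix.trace_add, Matrix.trace_mul_comm _ (spinX d),
      Matrix.trace_mul_comm _ (spinY d), Matrix.trace_mul_comm _ (spinZ d), ← Matrix.mul_assoc,
      ← Matrix.mul_assoc, ← Matrix.mul_assoc, ← Matrix.trace_add, ← Matrix.trace_add, ← add_mul,
      ← add_mul, spin_casimir', smul_mul_assoc, one_mul, Matrix.trace_smul, smul_eq_mul]
  rw [Matrix.trace_add, Matrix.trace_smul, Matrix.trace_smul, h, smul_eq_mul, smul_eq_mul]
  ring

/-- The Heisenberg picture: cyclicity of the trace moves the update from the state to the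
observable, where the sandwich identities apply. -/
theorem memoryUpdate_trace_mul (d : ℕ) (θ : ℝ) (ρ N : Op (Fin (d + 1))) :
    (memoryUpdate d θ ρ * N).trace = (1 - (gateCoupling d θ : ℂ) ^ 2 * casimir d) * (ρ * N).trace +
      (gateCoupling d θ : ℂ) ^ 2 *
        (ρ * (spinX d * N * spinX d + spinY d * N * spinY d + spinZ d * N * spinZ d)).trace := by
  have h : ∀ J : Op (Fin (d + 1)), (J * ρ * J * N).trace = (ρ * (J * N * J)).trace := by
    intro J
    rw [Matrix.mul_assoc, Matrix.mul_assoc, Matrix.trace_mul_comm]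
    simp only [Matrix.mul_assoc]
  rw [memoryUpdate_eq, gateDiag_mul_star, add_mul, smul_mul_assoc, smul_mul_assoc, add_mul, add_mul]
  simp only [mul_add, Matrix.trace_add, Matrix.trace_smul, smul_eq_mul, h]

theorem sandwich_spinAlong (d : ℕ) (ϑ φ : ℝ) :
    spinX d * spinAlong d ϑ φ * spinX d + spinY d * spinAlong d ϑ φ * spinY d +
      spinZ d * spinAlong d ϑ φ * spinZ d = ((casimir d : ℂ) - 1) • spinAlong d ϑ φ := by
  have hz := sandwich_linear (spin_comm_xy d) (spin_comm_yz d) (spin_comm_zx d) (spin_casimir' d)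
  have hx := sandwich_linear (spin_comm_yz d) (spin_comm_zx d) (spin_comm_xy d)
    (κ := (casimir d : ℂ)) (by rw [← spin_casimir']; abel)
  have hy := sandwich_linear (spin_comm_zx d) (spin_comm_xy d) (spin_comm_yz d)
    (κ := (casimir d : ℂ)) (by rw [← spin_casimir']; abel)
  simp only [spinAlong, mul_add, add_mul, mul_smul_comm, smul_mul_assoc, smul_add]
  rw [smul_comm _ _ (spinX d), smul_comm _ _ (spinY d), smul_comm _ _ (spinZ d), ← hx, ← hy, ← hz]
  module

theorem sandwich_spinAlong_sq (d : ℕ) (ϑ φ : ℝ) :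
    spinX d * (spinAlong d ϑ φ * spinAlong d ϑ φ) * spinX d +
      spinY d * (spinAlong d ϑ φ * spinAlong d ϑ φ) * spinY d +
      spinZ d * (spinAlong d ϑ φ * spinAlong d ϑ φ) * spinZ d =
      ((casimir d : ℂ) - 3) • (spinAlong d ϑ φ * spinAlong d ϑ φ) + (casimir d : ℂ) • 1 :=
  sandwich_sq (spin_comm_xy d) (spin_comm_yz d) (spin_comm_zx d) (spin_casimir' d)
    (spherical_sq_sum ϑ φ) rfl

/-- The span of 1, J_n and J_n² is invariant under the dual update. The update is diagonal in 1,
J_n, J_n² - j(j+1)/3, with eigenvalues 1, 1 - q², 1 - 3q². -/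
theorem memoryUpdate_iterate_trace (d : ℕ) (θ ϑ φ : ℝ) (ρ : Op (Fin (d + 1))) (k : ℕ) :
    ((memoryUpdate d θ)^[k] ρ).trace = ρ.trace ∧
      ((memoryUpdate d θ)^[k] ρ * spinAlong d ϑ φ).trace =
        (1 - (gateCoupling d θ : ℂ) ^ 2) ^ k * (ρ * spinAlong d ϑ φ).trace ∧
      ((memoryUpdate d θ)^[k] ρ * (spinAlong d ϑ φ * spinAlong d ϑ φ)).trace =
        casimir d / 3 * ρ.trace + (1 - 3 * (gateCoupling d θ : ℂ) ^ 2) ^ k *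
          ((ρ * (spinAlong d ϑ φ * spinAlong d ϑ φ)).trace - casimir d / 3 * ρ.trace) := by
  induction k with
  | zero => simp
  | succ k ih =>
    obtain ⟨h0, h1, h2⟩ := ih
    rw [Function.iterate_succ_apply', memoryUpdate_trace, memoryUpdate_trace_mul,
      memoryUpdate_trace_mul, sandwich_spinAlong, sandwich_spinAlong_sq]
    simp only [mul_add, mul_smul_comm, Matrix.trace_add, Matrix.trace_smul, smul_eq_mul, mul_one,
      h0, h1, h2]
    refine ⟨trivial, ?_, ?_⟩
    · rw [pow_succ]; ring
    · rw [pow_succ]; ring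

theorem ketBra_mulVec {ι : Type} [Fintype ι] (R : Op ι) (v : ι → ℂ) :
    ketBra (R *ᵥ v) = R * ketBra v * Rᴴ := by
  rw [ketBra, ketBra, Matrix.star_mulVec, Matrix.mul_vecMulVec, Matrix.vecMulVec_mul]

theorem trace_ketBra_topKet_mul (d : ℕ) (X : Op (Fin (d + 1))) :
    (ketBra (topKet d) * X).trace = X 0 0 := by
  rw [ketBra, Matrix.vecMulVec_mul, Matrix.trace_vecMulVec, topKet]
  simp [Matrix.vecMul, dotProduct, Pi.single_apply]

theorem trace_rotated_mul (d : ℕ) (α β γ : ℝ) (ρ X Y : Op (Fin (d + 1)))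
    (h : X * rotation d α β γ = rotation d α β γ * Y) :
    (rotation d α β γ * ρ * (rotation d α β γ)ᴴ * X).trace = (ρ * Y).trace := by
  rw [Matrix.mul_assoc, Matrix.mul_assoc, Matrix.trace_mul_comm, Matrix.mul_assoc, Matrix.mul_assoc, h,
    ← Matrix.mul_assoc (rotation d α β γ)ᴴ, rotation_conjTranspose_mul, one_mul]

/-- The fidelity of the `n`-th access, for `k = n - 1`. -/
def accessFidelity (d : ℕ) (θ : ℝ) (k : ℕ) : ℝ :=
  (2 + 4 * Real.cos (θ / 2) ^ 2 * (1 - gateCoupling d θ ^ 2 * casimir d) +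
    8 * Real.cos (θ / 2) * Real.sin (θ / 2) * gateCoupling d θ *
      Real.cos (interactionAngle d θ / 2) * ((1 - gateCoupling d θ ^ 2) ^ k * ((d : ℝ) / 2)) +
    4 * Real.sin (θ / 2) ^ 2 * gateCoupling d θ ^ 2 *
      (casimir d / 3 + (1 - 3 * gateCoupling d θ ^ 2) ^ k *
        (((d : ℝ) / 2) ^ 2 - casimir d / 3))) / 6

theorem haarAverage_const (c : ℝ) : haarAverage (fun _ _ _ => c) = c := by
  simp only [haarAverage]
  simp
  field_simp
  ring

/-- The rotated memory has J_n = j and J_n² = j² along the axis of the rotated gate, so the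
integrand does not depend on g and the Haar average is trivial. -/
theorem reuseFidelity_eq (d : ℕ) (θ : ℝ) (n : ℕ) :
    reuseFidelity d θ n = accessFidelity d θ (n - 1) := by
  have key : ∀ α β γ : ℝ, gateFidelity (rotatedGate θ α β γ) (heisenbergChannel d θ)
      ((memoryUpdate d θ)^[n - 1] (ketBra (rotation d α β γ *ᵥ topKet d))) =
        accessFidelity d θ (n - 1) := by
    intro α β γ
    have hJ := (rotation_mul_spinZ d α β γ).symm
    have hJ2 : spinAlong d β α * spinAlong d β α * rotation d α β γ =
        rotation d α β γ * (spinZ d * spinZ d) := by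
      rw [Matrix.mul_assoc, hJ, ← Matrix.mul_assoc, hJ, Matrix.mul_assoc]
    obtain ⟨h0, h1, h2⟩ := memoryUpdate_iterate_trace d θ β α
      (ketBra (rotation d α β γ *ᵥ topKet d)) (n - 1)
    have t0 : (ketBra (rotation d α β γ *ᵥ topKet d)).trace = 1 := by
      have := trace_rotated_mul d α β γ (ketBra (topKet d)) 1 1 (by rw [one_mul, mul_one])
      rw [mul_one, ← ketBra_mulVec, trace_ketBra_topKet_mul] at this
      rw [this, Matrix.one_apply_eq]
    rw [rotatedGate_eq_axisGate, gateFidelity_heisenberg_axisGate, h0, h1, h2, t0, ketBra_mulVec,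
      trace_rotated_mul d α β γ _ _ _ hJ, trace_rotated_mul d α β γ _ _ _ hJ2,
      trace_ketBra_topKet_mul, trace_ketBra_topKet_mul, gateDiag_mul_star, accessFidelity]
    congr 1
    rw [← Complex.ofReal_re (2 + _ + _ + _)]
    congr 1
    simp only [spinZ, Matrix.diagonal_mul_diagonal, Matrix.diagonal_apply_eq, Fin.val_zero, Nat.cast_zero]
    push_cast
    ring
  simp only [reuseFidelity, key, haarAverage_const]


/-! The asymptotic behaviour of the fidelity. -/

/-- With ε = 1/(2j + 1) the argument of arccot is (cos θ + ε)/sin θ, so f is the argument of e^{iθ}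
+ ε and r is the reciprocal of the modulus. The bound ε ≤ 1/4 keeps this number away from zero at θ
= π. -/
theorem interactionAngle_trig {d : ℕ} (hd : 3 ≤ d) {θ : ℝ} (hθ : θ ∈ Set.Ico (0 : ℝ) (2 * Real.pi)) :
    ∃ r : ℝ, 0 < r ∧
      r ^ 2 * (1 + 2 * Real.cos θ * (1 / ((d : ℝ) + 1)) + (1 / ((d : ℝ) + 1)) ^ 2) = 1 ∧
      Real.cos (interactionAngle d θ) = (Real.cos θ + 1 / ((d : ℝ) + 1)) * r ∧
      Real.sin (interactionAngle d θ) = Real.sin θ * r := by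
  have hN : (0 : ℝ) < (d : ℝ) + 1 := by positivity
  have hε1 : 1 / ((d : ℝ) + 1) ≤ 1 / 4 := by
    have : (3 : ℝ) ≤ d := by exact_mod_cast hd
    gcongr
    linarith
  have hε0 : 0 < 1 / ((d : ℝ) + 1) := by positivity
  have hst := Real.sin_sq_add_cos_sq θ
  by_cases hs : Real.sin θ = 0
  · have hf : interactionAngle d θ = θ := by rw [interactionAngle, if_pos hs]
    rw [hf, hs]
    generalize 1 / ((d : ℝ) + 1) = ε at *
    have hc : Real.cos θ = 1 ∨ Real.cos θ = -1 := by
      rw [← mul_self_eq_one_iff]; nlinarith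
    rcases hc with hc | hc
    · have : (1 + ε) ≠ 0 := by positivity
      refine ⟨1 / (1 + ε), by positivity, ?_, ?_, by ring⟩
      · rw [hc]; field_simp; ring
      · rw [hc]; field_simp
    · have h1 : 0 < 1 - ε := by linarith
      refine ⟨1 / (1 - ε), by positivity, ?_, ?_, by ring⟩
      · rw [hc]; field_simp; ring
      · rw [hc]; field_simp; ring
  · set ε := 1 / ((d : ℝ) + 1) with hε
    set y := Real.cos θ / Real.sin θ + 1 / (((d : ℝ) + 1) * Real.sin θ) with hy
    have hy' : y * Real.sin θ = Real.cos θ + ε := by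
      rw [hy, hε]; field_simp
    have hC := Real.cos_arctan_pos y
    have hC2 : Real.cos (Real.arctan y) ^ 2 * (1 + y ^ 2) = 1 := by
      rw [Real.cos_sq_arctan]; field_simp
    have hS : Real.sin (Real.arctan y) = y * Real.cos (Real.arctan y) := by
      conv_lhs => rw [← Real.tan_mul_cos hC.ne', Real.tan_arctan]
    have hD : Real.sin θ ^ 2 * (1 + y ^ 2) = 1 + 2 * Real.cos θ * ε + ε ^ 2 := by
      have : y ^ 2 * Real.sin θ ^ 2 = (Real.cos θ + ε) ^ 2 := by rw [← hy']; ring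
      linear_combination hst + this
    have hr2 : (Real.cos (Real.arctan y) / Real.sin θ) ^ 2 *
        (1 + 2 * Real.cos θ * ε + ε ^ 2) = 1 := by
      rw [← hD, div_pow]; field_simp; exact hC2
    rw [interactionAngle, if_neg hs, ← hy]
    by_cases hle : θ ≤ Real.pi
    · have hpos : 0 < Real.sin θ :=
        lt_of_le_of_ne (Real.sin_nonneg_of_nonneg_of_le_pi hθ.1 hle) (Ne.symm hs)
      refine ⟨Real.cos (Real.arctan y) / Real.sin θ, by positivity, hr2, ?_, ?_⟩
      · rw [if_pos hle, add_zero, Real.cos_pi_div_two_sub, hS, ← hy']; field_simp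
      · rw [if_pos hle, add_zero, Real.sin_pi_div_two_sub]; field_simp
    -- On the branch θ > π the negative sign of sin θ and the added π compensate each other.
    · have hneg : Real.sin θ < 0 := by
        have := Real.sin_neg_of_neg_of_neg_pi_lt (x := θ - 2 * Real.pi) (by linarith [hθ.2])
          (by linarith [not_le.1 hle])
        rwa [Real.sin_sub_two_pi] at this
      refine ⟨-(Real.cos (Real.arctan y) / Real.sin θ), ?_, by rw [neg_sq]; exact hr2, ?_, ?_⟩
      · rw [← div_neg]; exact div_pos hC (by linarith)
      · rw [if_neg hle, Real.cos_add_pi, Real.cos_pi_div_two_sub, hS, ← hy']; field_simp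
      · rw [if_neg hle, Real.sin_add_pi, Real.sin_pi_div_two_sub]; field_simp

theorem gateCoupling_sq (d : ℕ) (θ : ℝ) :
    gateCoupling d θ ^ 2 =
      2 * (1 - Real.cos (interactionAngle d θ)) * (1 / ((d : ℝ) + 1)) ^ 2 := by
  have := sin_half_sq (interactionAngle d θ)
  rw [gateCoupling, div_pow, mul_pow, this]
  field_simp

/-- Half angles occur only in squares and in the product sin θ sin f = (1 - cos² θ) r. What remains
is a polynomial in ε, cos θ, cos f, r and the two powers. -/
theorem accessFidelity_eq {d : ℕ} {θ r : ℝ} (k : ℕ)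
    (hsin : Real.sin (interactionAngle d θ) = Real.sin θ * r) :
    accessFidelity d θ k = (2 + 2 * (1 + Real.cos θ) * (1 - (1 - Real.cos (interactionAngle d θ)) *
        (1 - (1 / ((d : ℝ) + 1)) ^ 2) / 2) +
      2 * (1 - Real.cos θ ^ 2) * r * (1 - 1 / ((d : ℝ) + 1)) * (1 - gateCoupling d θ ^ 2) ^ k +
      (1 - Real.cos θ) * (1 - Real.cos (interactionAngle d θ)) / 3 *
        ((1 - (1 / ((d : ℝ) + 1)) ^ 2) + 2 * (1 - 3 * (1 / ((d : ℝ) + 1)) +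
          2 * (1 / ((d : ℝ) + 1)) ^ 2) * (1 - 3 * gateCoupling d θ ^ 2) ^ k)) / 6 := by
  have hN : (0 : ℝ) < (d : ℝ) + 1 := by positivity
  have h1 : Real.cos (θ / 2) * Real.sin (θ / 2) = Real.sin θ / 2 := by
    conv_rhs => rw [← mul_div_cancel₀ θ (two_ne_zero' ℝ), Real.sin_two_mul]
    ring_nf
  have h2 : gateCoupling d θ * Real.cos (interactionAngle d θ / 2) =
      Real.sin θ * r * (1 / ((d : ℝ) + 1)) := by
    rw [← hsin]
    conv_rhs => rw [← mul_div_cancel₀ (interactionAngle d θ) (two_ne_zero' ℝ), Real.sin_two_mul]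
    rw [gateCoupling]
    ring_nf
  have h3 : Real.sin θ ^ 2 = 1 - Real.cos θ ^ 2 := Real.sin_sq θ
  have h4 : 8 * Real.cos (θ / 2) * Real.sin (θ / 2) * gateCoupling d θ *
      Real.cos (interactionAngle d θ / 2) =
        4 * (1 - Real.cos θ ^ 2) * r * (1 / ((d : ℝ) + 1)) := by
    calc _ = 8 * (Real.cos (θ / 2) * Real.sin (θ / 2)) * (gateCoupling d θ *
          Real.cos (interactionAngle d θ / 2)) := by ring
      _ = _ := by rw [h1, h2, ← h3]; ring
  rw [accessFidelity, h4, cos_half_sq, sin_half_sq]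
  generalize (1 - gateCoupling d θ ^ 2) ^ k = P₁
  generalize (1 - 3 * gateCoupling d θ ^ 2) ^ k = P₃
  rw [gateCoupling_sq, casimir]
  field_simp
  ring

/-- This keeps both decay factors 1 - q² and 1 - 3q² in [0, 1], as monotonicity and the bounds on
their powers require. -/
theorem gateCoupling_sq_le {d : ℕ} (hd : 3 ≤ d) (θ : ℝ) : 3 * gateCoupling d θ ^ 2 ≤ 1 := by
  have hε1 : 1 / ((d : ℝ) + 1) ≤ 1 / 4 := by
    have : (3 : ℝ) ≤ d := by exact_mod_cast hd
    gcongr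
    linarith
  have hε0 : 0 < 1 / ((d : ℝ) + 1) := by positivity
  have := Real.neg_one_le_cos (interactionAngle d θ)
  rw [gateCoupling_sq]
  have h2 : (1 / ((d : ℝ) + 1)) ^ 2 ≤ 1 / 16 := by nlinarith
  nlinarith [sq_nonneg (1 / ((d : ℝ) + 1))]

/-- Both powers decrease in k and have nonnegative coefficients; the second one contains 1 - 3ε +
2ε² = (1 - ε)(1 - 2ε). -/
theorem accessFidelity_antitone {d : ℕ} (hd : 3 ≤ d) {θ : ℝ}
    (hθ : θ ∈ Set.Ico (0 : ℝ) (2 * Real.pi)) : Antitone (accessFidelity d θ) := by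
  obtain ⟨r, hr, -, -, hsin⟩ := interactionAngle_trig hd hθ
  have hd' : (3 : ℝ) ≤ d := by exact_mod_cast hd
  have hε1 : 1 / ((d : ℝ) + 1) ≤ 1 / 4 := by
    gcongr
    linarith
  have hε0 : 0 < 1 / ((d : ℝ) + 1) := by positivity
  have hq := gateCoupling_sq_le hd θ
  have hq0 := sq_nonneg (gateCoupling d θ)
  have hc := Real.cos_le_one (interactionAngle d θ)
  have hx := Real.cos_le_one θ
  have hx2 := Real.cos_sq_le_one θ
  intro k l hkl
  have h1 : (1 - gateCoupling d θ ^ 2) ^ l ≤ (1 - gateCoupling d θ ^ 2) ^ k :=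
    pow_le_pow_of_le_one (by linarith) (by linarith) hkl
  have h3 : (1 - 3 * gateCoupling d θ ^ 2) ^ l ≤ (1 - 3 * gateCoupling d θ ^ 2) ^ k :=
    pow_le_pow_of_le_one (by linarith) (by linarith) hkl
  rw [accessFidelity_eq l hsin, accessFidelity_eq k hsin]
  have e1 : 0 ≤ 2 * (1 - Real.cos θ ^ 2) * r * (1 - 1 / ((d : ℝ) + 1)) :=
    mul_nonneg (mul_nonneg (by linarith) hr.le) (by linarith)
  have e2 : 0 ≤ (1 - Real.cos θ) * (1 - Real.cos (interactionAngle d θ)) / 3 :=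
    div_nonneg (mul_nonneg (by linarith) (by linarith)) (by norm_num)
  have e3 : 0 ≤ 2 * (1 - 3 * (1 / ((d : ℝ) + 1)) + 2 * (1 / ((d : ℝ) + 1)) ^ 2) := by
    nlinarith [sq_nonneg (1 / ((d : ℝ) + 1))]
  gcongr

/-- Bernoulli's inequality from below, and by induction the quadratic bound from above. With q of
order ε² and k of order 1/ε the error is of order ε². -/
theorem one_sub_pow_bounds {q : ℝ} (h0 : 0 ≤ q) (h1 : q ≤ 1) (k : ℕ) :
    |(1 - q) ^ k - (1 - k * q)| ≤ (k * q) ^ 2 := by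
  have hl : 1 - k * q ≤ (1 - q) ^ k := by
    have := one_add_mul_le_pow (a := -q) (by linarith) k
    simpa [sub_eq_add_neg] using this
  have hu : (1 - q) ^ k ≤ 1 - k * q + (k * q) ^ 2 := by
    induction k with
    | zero => simp
    | succ k ih =>
      have ih' := ih (by
        have := one_add_mul_le_pow (a := -q) (by linarith) k
        simpa [sub_eq_add_neg] using this)
      have := mul_le_mul_of_nonneg_right ih' (show 0 ≤ 1 - q by linarith)
      rw [pow_succ]
      push_cast
      have hk : (0 : ℝ) ≤ k := Nat.cast_nonneg k
      nlinarith [mul_nonneg hk (sq_nonneg q), mul_nonneg (mul_nonneg (sq_nonneg (k : ℝ)) h0) (sq_nonneg q)]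
  rw [abs_le]
  constructor <;> nlinarith [sq_nonneg ((k : ℝ) * q)]

/-- The first-order expansion of (1 + 2xε + ε²)^(-1/2). The difference is multiplied by r + (1 - xε)
≥ 3/4, and (16/9)·4/(3/4) < 10. -/
theorem inv_sqrt_bound {x ε r : ℝ} (hx : |x| ≤ 1) (h0 : 0 < ε) (h1 : ε ≤ 1 / 4) (hr : 0 < r)
    (h : r ^ 2 * (1 + 2 * x * ε + ε ^ 2) = 1) : |r - (1 - x * ε)| ≤ 10 * ε ^ 2 := by
  obtain ⟨hx1, hx2⟩ := abs_le.1 hx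
  have hxx : x ^ 2 ≤ 1 := by nlinarith
  have ha : 0 < 1 - x * ε := by nlinarith
  have hD : 9 / 16 ≤ 1 + 2 * x * ε + ε ^ 2 := by nlinarith [sq_nonneg (1 - ε)]
  have hr2 : r ^ 2 ≤ 16 / 9 := by nlinarith [sq_nonneg r]
  have e : (r - (1 - x * ε)) * (r + (1 - x * ε)) =
      ε ^ 2 * (r ^ 2 * (-(1 - 3 * x ^ 2) - ε * (2 * x ^ 3 - 2 * x) - x ^ 2 * ε ^ 2)) := by
    linear_combination (1 - x * ε) ^ 2 * h
  have hb : |r ^ 2 * (-(1 - 3 * x ^ 2) - ε * (2 * x ^ 3 - 2 * x) - x ^ 2 * ε ^ 2)| ≤ 16 / 9 * 4 := by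
    rw [abs_mul, abs_of_nonneg (sq_nonneg r)]
    refine mul_le_mul hr2 ?_ (abs_nonneg _) (by norm_num)
    have h3 : |2 * x ^ 3 - 2 * x| ≤ 2 := by
      rw [show 2 * x ^ 3 - 2 * x = -(2 * x * (1 - x ^ 2)) by ring, abs_neg, abs_le]
      constructor <;> nlinarith
    obtain ⟨h4, h5⟩ := abs_le.1 h3
    have h6 : x ^ 2 * ε ^ 2 ≤ 1 := by nlinarith [sq_nonneg x, sq_nonneg ε]
    rw [abs_le]
    constructor <;> nlinarith [sq_nonneg x, sq_nonneg (x * ε)]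
  have hs : 3 / 4 ≤ r + (1 - x * ε) := by nlinarith
  have h7 := congrArg abs e
  rw [abs_mul, abs_mul, abs_of_pos (show 0 < r + (1 - x * ε) by linarith),
    abs_of_nonneg (sq_nonneg ε)] at h7
  have h8 := mul_le_mul_of_nonneg_left hb (sq_nonneg ε)
  have h9 := mul_le_mul_of_nonneg_left hs (abs_nonneg (r - (1 - x * ε)))
  nlinarith [sq_nonneg ε]

/-- The coefficient of `ε²`, for `ε = 1 / (2j + 1)`, in six times the difference between the
fidelity of an access and its approximation. -/
def accessRemainder (x ε m ρ a b u : ℝ) : ℝ :=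
  let t₂ := x - x * ρ - ε * ρ
  let τ := -(1 - x ^ 2) + ε * t₂
  let t := 1 - x + ε * τ
  let r₁ := -x + ε * ρ
  let p₁ := -2 * m * t + ε * a
  let b' := b - 6 * m * τ
  let w := 2 * b' - 6 * (-6 * m * (1 - x) + ε * b') + 4 * (1 - 6 * m * ε * t + ε ^ 2 * b) - 1
  let q₁ := -6 - 12 * m * (1 - x)
  (1 + x) * (t - t₂) +
    2 * (1 - x ^ 2) * (ρ + a - 2 * m * τ - r₁ + r₁ * p₁ - p₁ - ε * (r₁ * p₁)) +
    (1 - x) / 3 * (3 * t₂ - (1 - x ^ 2) * q₁ + t * w + ε * t₂ * q₁) +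
    4 * (1 - x) * (u + 2 * (1 - x) * (u * (u + 1) * m + u ^ 2))

/-- Here x = cos θ, t = 1 - cos f, m = kε, and ρ, a, b are the second-order errors of r and of the
two powers divided by ε². The variable u stands for 1/(1 - ε), so that 1/j = 2εu. The terms of order
0 and 1 in ε cancel, with m counted as of order 0. -/
theorem accessRemainder_spec {x ε m ρ a b u r t : ℝ} (hr : r = 1 - x * ε + ε ^ 2 * ρ)
    (ht : t = 1 - (x + ε) * r) (hu : u = 1 + ε * u) :
    2 + 2 * (1 + x) * (1 - t * (1 - ε ^ 2) / 2) +
      2 * (1 - x ^ 2) * r * (1 - ε) * (1 - 2 * m * ε * t + ε ^ 2 * a) +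
      (1 - x) * t / 3 * ((1 - ε ^ 2) + 2 * (1 - 3 * ε + 2 * ε ^ 2) *
        (1 - 6 * m * ε * t + ε ^ 2 * b)) -
      6 * (1 - 2 / 3 * (1 - x) * ε * u * (1 + 2 * (1 - x) * u * (m + ε))) =
    ε ^ 2 * accessRemainder x ε m ρ a b u := by
  have h1 : 2 / 3 * (1 - x) * ε * u * (1 + 2 * (1 - x) * u * (m + ε)) =
      2 / 3 * (1 - x) * ε * (1 + 2 * m * (1 - x)) +
        ε ^ 2 * (2 / 3 * (1 - x) * (u + 2 * (1 - x) * (u * (u + 1) * m + u ^ 2))) := by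
    have h2 : u ^ 2 = 1 + ε * u * (u + 1) := by linear_combination (u + 1) * hu
    linear_combination (2 / 3 * (1 - x) * ε) * hu + 4 / 3 * (1 - x) ^ 2 * ε * m * h2
  rw [h1]
  simp only [accessRemainder, hr, ht]
  ring

/-- A polynomial is bounded on a compact box, which yields one constant for all θ, j and n. The box
for a and b has size 144 M² = 36·M²·2², from the error (3kq²)² = 36 m²t²ε² and t ≤ 2. -/
theorem accessRemainder_bounded (M : ℝ) : ∃ c : ℝ, ∀ x ∈ Set.Icc (-1 : ℝ) 1,
    ∀ ε ∈ Set.Icc (0 : ℝ) 1, ∀ m ∈ Set.Icc (0 : ℝ) M, ∀ ρ ∈ Set.Icc (-10 : ℝ) 10,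
    ∀ a ∈ Set.Icc (-(144 * M ^ 2)) (144 * M ^ 2), ∀ b ∈ Set.Icc (-(144 * M ^ 2)) (144 * M ^ 2),
    ∀ u ∈ Set.Icc (0 : ℝ) 2, |accessRemainder x ε m ρ a b u| ≤ c := by
  have hK : IsCompact (Set.Icc (-1 : ℝ) 1 ×ˢ Set.Icc (0 : ℝ) 1 ×ˢ Set.Icc (0 : ℝ) M ×ˢ
      Set.Icc (-10 : ℝ) 10 ×ˢ Set.Icc (-(144 * M ^ 2)) (144 * M ^ 2) ×ˢ
      Set.Icc (-(144 * M ^ 2)) (144 * M ^ 2) ×ˢ Set.Icc (0 : ℝ) 2) :=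
    isCompact_Icc.prod (isCompact_Icc.prod (isCompact_Icc.prod (isCompact_Icc.prod
      (isCompact_Icc.prod (isCompact_Icc.prod isCompact_Icc)))))
  obtain ⟨c, hc⟩ := hK.exists_bound_of_continuousOn (f := fun p : ℝ × ℝ × ℝ × ℝ × ℝ × ℝ × ℝ =>
    accessRemainder p.1 p.2.1 p.2.2.1 p.2.2.2.1 p.2.2.2.2.1 p.2.2.2.2.2.1 p.2.2.2.2.2.2)
    (by
      apply Continuous.continuousOn
      unfold accessRemainder
      fun_prop)
  exact ⟨c, fun x hx ε hε m hm ρ hρ a ha b hb u hu =>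
    hc (x, ε, m, ρ, a, b, u) ⟨hx, hε, hm, hρ, ha, hb, hu⟩⟩

theorem abs_access_sub_le {K c x ε r t j : ℝ} (k : ℕ)
    (hc : ∀ x ∈ Set.Icc (-1 : ℝ) 1, ∀ ε ∈ Set.Icc (0 : ℝ) 1, ∀ m ∈ Set.Icc (0 : ℝ) K,
      ∀ ρ ∈ Set.Icc (-10 : ℝ) 10, ∀ a ∈ Set.Icc (-(144 * K ^ 2)) (144 * K ^ 2),
      ∀ b ∈ Set.Icc (-(144 * K ^ 2)) (144 * K ^ 2), ∀ u ∈ Set.Icc (0 : ℝ) 2,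
        |accessRemainder x ε m ρ a b u| ≤ c)
    (hx : |x| ≤ 1) (hε0 : 0 < ε) (hε1 : ε ≤ 1 / 4) (hr : 0 < r)
    (hrD : r ^ 2 * (1 + 2 * x * ε + ε ^ 2) = 1) (ht : t = 1 - (x + ε) * r) (ht0 : 0 ≤ t)
    (ht2 : t ≤ 2) (hjpos : 0 < j) (hje : 2 * ε * j = 1 - ε) (hk : ((k + 1 : ℕ) : ℝ) ≤ K * j)
    (hq : 3 * (2 * t * ε ^ 2) ≤ 1) :
    |(2 + 2 * (1 + x) * (1 - t * (1 - ε ^ 2) / 2) +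
      2 * (1 - x ^ 2) * r * (1 - ε) * (1 - 2 * t * ε ^ 2) ^ k +
      (1 - x) * t / 3 * ((1 - ε ^ 2) + 2 * (1 - 3 * ε + 2 * ε ^ 2) *
        (1 - 3 * (2 * t * ε ^ 2)) ^ k)) / 6 -
      (1 - (1 - x) / (3 * j) * ((((k + 1 : ℕ) : ℝ) * (1 - x) + j) / j))| ≤ |c| / j ^ 2 := by
  have hq0 : 0 ≤ 2 * t * ε ^ 2 := by positivity
  have b1 := one_sub_pow_bounds hq0 (by linarith) k
  have b3 := one_sub_pow_bounds (show 0 ≤ 3 * (2 * t * ε ^ 2) by linarith) hq k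
  have hr1 := inv_sqrt_bound hx hε0 hε1 hr hrD
  obtain ⟨hx1, hx2⟩ := abs_le.1 hx
  -- The rescaled variables of `accessRemainder_spec`; the following steps place each of them in the
  -- compact box. The bound on m uses εj < 1/2.
  obtain ⟨m, hm⟩ : ∃ z : ℝ, z = (k : ℝ) * ε := ⟨_, rfl⟩
  obtain ⟨ρ, hρ⟩ : ∃ z : ℝ, z = (r - (1 - x * ε)) / ε ^ 2 := ⟨_, rfl⟩
  obtain ⟨a, ha⟩ : ∃ z : ℝ, z = ((1 - 2 * t * ε ^ 2) ^ k - (1 - 2 * m * ε * t)) / ε ^ 2 := ⟨_, rfl⟩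
  obtain ⟨b, hb⟩ : ∃ z : ℝ, z = ((1 - 3 * (2 * t * ε ^ 2)) ^ k - (1 - 6 * m * ε * t)) / ε ^ 2 := ⟨_, rfl⟩
  obtain ⟨u, hu⟩ : ∃ z : ℝ, z = 1 / (1 - ε) := ⟨_, rfl⟩
  have hε2 : 0 < ε ^ 2 := by positivity
  have hk0 : (0 : ℝ) ≤ k := Nat.cast_nonneg k
  have hm0 : 0 ≤ m := by rw [hm]; positivity
  have hK0 : 0 < K := by
    by_contra hneg
    have := mul_nonpos_of_nonpos_of_nonneg (not_lt.1 hneg) hjpos.le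
    push_cast at hk
    linarith
  have hmK : m ≤ K := by
    have h1 : (k : ℝ) ≤ K * j := by push_cast at hk; linarith
    have h2 := mul_le_mul_of_nonneg_right h1 hε0.le
    have h3 : K * j * ε = K * (1 - ε) / 2 := by rw [← hje]; ring
    have h4 := mul_pos hK0 hε0
    linarith
  have hρ10 : |ρ| ≤ 10 := by
    rw [hρ, abs_div, abs_of_pos hε2, div_le_iff₀ hε2]
    exact hr1
  have hmt : m ^ 2 * t ^ 2 ≤ K ^ 2 * 4 := by
    have h1 : m ^ 2 ≤ K ^ 2 := by gcongr
    have h2 : t ^ 2 ≤ 2 ^ 2 := by gcongr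
    calc m ^ 2 * t ^ 2 ≤ K ^ 2 * 2 ^ 2 := mul_le_mul h1 h2 (sq_nonneg t) (sq_nonneg K)
      _ = K ^ 2 * 4 := by norm_num
  have ha144 : |a| ≤ 144 * K ^ 2 := by
    rw [ha, abs_div, abs_of_pos hε2, div_le_iff₀ hε2]
    have e2 : (k * (2 * t * ε ^ 2)) ^ 2 = 4 * (m ^ 2 * t ^ 2) * ε ^ 2 := by rw [hm]; ring
    rw [e2, show 1 - (k : ℝ) * (2 * t * ε ^ 2) = 1 - 2 * m * ε * t by rw [hm]; ring] at b1
    refine b1.trans (mul_le_mul_of_nonneg_right ?_ hε2.le)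
    linarith [sq_nonneg K]
  have hb144 : |b| ≤ 144 * K ^ 2 := by
    rw [hb, abs_div, abs_of_pos hε2, div_le_iff₀ hε2]
    have e2 : (k * (3 * (2 * t * ε ^ 2))) ^ 2 = 36 * (m ^ 2 * t ^ 2) * ε ^ 2 := by rw [hm]; ring
    rw [e2, show 1 - (k : ℝ) * (3 * (2 * t * ε ^ 2)) = 1 - 6 * m * ε * t by rw [hm]; ring] at b3
    refine b3.trans (mul_le_mul_of_nonneg_right ?_ hε2.le)
    linarith [sq_nonneg K]
  have h1ε : 0 < 1 - ε := by linarith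
  have hu0 : 0 ≤ u := by rw [hu]; positivity
  have hu2 : u ≤ 2 := by rw [hu, div_le_iff₀ h1ε]; linarith
  have hu1 : u = 1 + ε * u := by rw [hu]; field_simp; ring
  have hinv : 1 / j = 2 * ε * u := by
    rw [hu, ← hje]
    field_simp
  have hT : (1 - x) / (3 * j) * ((((k + 1 : ℕ) : ℝ) * (1 - x) + j) / j) =
      2 / 3 * (1 - x) * ε * u * (1 + 2 * (1 - x) * u * (m + ε)) := by
    have : (1 - x) / (3 * j) * ((((k + 1 : ℕ) : ℝ) * (1 - x) + j) / j) =
        (1 - x) / 3 * (1 / j) * (((k + 1 : ℕ) : ℝ) * (1 - x) * (1 / j) + 1) := by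
      field_simp
    rw [this, hinv, hm]
    push_cast
    ring
  have hspec := accessRemainder_spec (x := x) (ε := ε) (m := m) (ρ := ρ) (a := a) (b := b) (u := u)
    (r := r) (t := t) (by rw [hρ]; field_simp; ring) ht hu1
  have hP1 : (1 - 2 * t * ε ^ 2) ^ k = 1 - 2 * m * ε * t + ε ^ 2 * a := by
    rw [ha]; field_simp; ring
  have hP3 : (1 - 3 * (2 * t * ε ^ 2)) ^ k = 1 - 6 * m * ε * t + ε ^ 2 * b := by
    rw [hb]; field_simp; ring
  have hbound := hc x ⟨hx1, hx2⟩ ε ⟨hε0.le, by linarith⟩ m ⟨hm0, hmK⟩ ρ (abs_le.1 hρ10) a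
    (abs_le.1 ha144) b (abs_le.1 hb144) u ⟨hu0, hu2⟩
  rw [hT, hP1, hP3, le_div_iff₀ (by positivity), ← abs_of_pos (show 0 < j ^ 2 by positivity), ← abs_mul]
  rw [show ∀ F T : ℝ, (F / 6 - (1 - T)) * j ^ 2 = (F - 6 * (1 - T)) * (j ^ 2 / 6) by
    intro F T; ring, hspec]
  have hεj : ε * j ≤ 1 := by linarith
  have hεj2 : (ε * j) ^ 2 ≤ 1 := by
    exact pow_le_one₀ (by positivity) hεj
  rw [show ε ^ 2 * accessRemainder x ε m ρ a b u * (j ^ 2 / 6) =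
    (ε * j) ^ 2 * (accessRemainder x ε m ρ a b u / 6) by ring, abs_mul, abs_of_nonneg (sq_nonneg _)]
  have h6 : |accessRemainder x ε m ρ a b u / 6| ≤ |c| := by
    rw [abs_div, abs_of_pos (show (0 : ℝ) < 6 by norm_num)]
    have := le_abs_self c
    have := abs_nonneg (accessRemainder x ε m ρ a b u)
    linarith
  calc _ ≤ 1 * |c| := mul_le_mul hεj2 h6 (abs_nonneg _) zero_le_one
    _ = |c| := one_mul _

theorem accessFidelity_asymptotics (K : ℝ) : ∃ c : ℝ, ∀ θ ∈ Set.Ico (0 : ℝ) (2 * Real.pi),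
    ∀ d : ℕ, 3 ≤ d → ∀ j : ℝ, j = (d : ℝ) / 2 → ∀ k : ℕ, ((k + 1 : ℕ) : ℝ) ≤ K * j →
      |accessFidelity d θ k - (1 - (1 - Real.cos θ) / (3 * j) *
        ((((k + 1 : ℕ) : ℝ) * (1 - Real.cos θ) + j) / j))| ≤ c / j ^ 2 := by
  obtain ⟨c, hc⟩ := accessRemainder_bounded K
  refine ⟨|c|, fun θ hθ d hd j hj k hk => ?_⟩
  obtain ⟨r, hr, hrD, hcos, hsin⟩ := interactionAngle_trig hd hθ
  have hd' : (3 : ℝ) ≤ d := by exact_mod_cast hd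
  have hN : (0 : ℝ) < (d : ℝ) + 1 := by positivity
  rw [accessFidelity_eq k hsin]
  have hq := gateCoupling_sq_le hd θ
  rw [gateCoupling_sq] at hq ⊢
  obtain ⟨ε, hε⟩ : ∃ ε, ε = 1 / ((d : ℝ) + 1) := ⟨_, rfl⟩
  have hε1 : ε ≤ 1 / 4 := by
    rw [hε]
    gcongr
    linarith
  have hε0 : 0 < ε := by rw [hε]; positivity
  have hεd : ε * (d + 1) = 1 := by rw [hε]; field_simp
  have hjpos : 0 < j := by rw [hj]; linarith
  have hje : 2 * ε * j = 1 - ε := by rw [hj]; linear_combination hεd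
  rw [← hε] at hcos hrD hq ⊢
  have hcf1 := Real.neg_one_le_cos (interactionAngle d θ)
  have hcf2 := Real.cos_le_one (interactionAngle d θ)
  generalize Real.cos (interactionAngle d θ) = cf at *
  have hx := Real.abs_cos_le_one θ
  generalize Real.cos θ = x at *
  obtain ⟨t, ht⟩ : ∃ t, t = 1 - cf := ⟨_, rfl⟩
  rw [← ht] at hq ⊢
  exact abs_access_sub_le k hc hx hε0 hε1 hr hrD (by rw [ht, hcos]) (by linarith) (by linarith)
    hjpos hje hk hq


/-! Averages over the sphere of complex functions. -/

/-- The average over the sphere of a complex function. -/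
def sphereMean (f : ℝ → ℝ → ℂ) : ℂ :=
  (1 / (4 * Real.pi) : ℝ) *
    ∫ ϑ in (0 : ℝ)..Real.pi, ∫ φ in (0 : ℝ)..(2 * Real.pi), f ϑ φ * (Real.sin ϑ : ℂ)

theorem continuous_inner_integral {E : Type} [NormedAddCommGroup E] [NormedSpace ℝ E]
    {f : ℝ → ℝ → E} (hf : Continuous fun p : ℝ × ℝ => f p.1 p.2) (a b : ℝ) :
    Continuous fun ϑ => ∫ φ in a..b, f ϑ φ :=
  intervalIntegral.continuous_parametric_intervalIntegral_of_continuous' hf a b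

theorem sphereMean_add {f g : ℝ → ℝ → ℂ} (hf : Continuous fun p : ℝ × ℝ => f p.1 p.2)
    (hg : Continuous fun p : ℝ × ℝ => g p.1 p.2) :
    sphereMean (fun ϑ φ => f ϑ φ + g ϑ φ) = sphereMean f + sphereMean g := by
  have hf' : Continuous fun p : ℝ × ℝ => f p.1 p.2 * (Real.sin p.1 : ℂ) := by fun_prop
  have hg' : Continuous fun p : ℝ × ℝ => g p.1 p.2 * (Real.sin p.1 : ℂ) := by fun_prop
  rw [sphereMean, sphereMean, sphereMean, ← mul_add, ← intervalIntegral.integral_add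
    ((continuous_inner_integral (f := fun ϑ φ => f ϑ φ * (Real.sin ϑ : ℂ)) hf' _ _).intervalIntegrable
      _ _) ((continuous_inner_integral (f := fun ϑ φ => g ϑ φ * (Real.sin ϑ : ℂ)) hg' _ _).intervalIntegrable
      _ _)]
  congr 2
  ext ϑ
  rw [← intervalIntegral.integral_add]
  · simp only [add_mul]
  · exact Continuous.intervalIntegrable (hf'.comp (Continuous.prodMk_right ϑ)) _ _
  · exact Continuous.intervalIntegrable (hg'.comp (Continuous.prodMk_right ϑ)) _ _

theorem sphereMean_const_mul (c : ℂ) (f : ℝ → ℝ → ℂ) :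
    sphereMean (fun ϑ φ => c * f ϑ φ) = c * sphereMean f := by
  simp only [sphereMean, mul_assoc, intervalIntegral.integral_const_mul]
  ring

theorem sphereMean_zero : sphereMean (fun _ _ => 0) = 0 := by
  simp [sphereMean]

theorem sphereMean_one : sphereMean (fun _ _ => 1) = 1 := by
  have h : ∫ ϑ in (0 : ℝ)..Real.pi, (Real.sin ϑ : ℂ) = 2 := by
    rw [intervalIntegral.integral_ofReal, integral_sin]; simp; norm_num
  simp only [sphereMean, one_mul, intervalIntegral.integral_const, sub_zero,
    Complex.real_smul, intervalIntegral.integral_const_mul]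
  rw [h]
  have : (Real.pi : ℂ) ≠ 0 := by exact_mod_cast Real.pi_ne_zero
  push_cast
  field_simp
  norm_num

theorem sphereMean_sum {η : Type} (s : Finset η) {f : η → ℝ → ℝ → ℂ}
    (hf : ∀ i ∈ s, Continuous fun p : ℝ × ℝ => f i p.1 p.2) :
    sphereMean (fun ϑ φ => ∑ i ∈ s, f i ϑ φ) = ∑ i ∈ s, sphereMean (f i) := by
  classical
  induction s using Finset.induction_on with
  | empty => simp [sphereMean_zero]
  | insert a s ha ih =>
    simp only [Finset.sum_insert ha]
    rw [sphereMean_add (hf a (Finset.mem_insert_self a s))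
      (continuous_finsetSum _ fun i hi => hf i (Finset.mem_insert_of_mem hi)),
      ih fun i hi => hf i (Finset.mem_insert_of_mem hi)]

theorem sphereMean_re {f : ℝ → ℝ → ℂ} (hf : Continuous fun p : ℝ × ℝ => f p.1 p.2) :
    (sphereMean f).re = sphereAverage fun ϑ φ => (f ϑ φ).re := by
  have hf' : Continuous fun p : ℝ × ℝ => f p.1 p.2 * (Real.sin p.1 : ℂ) := by fun_prop
  rw [sphereMean, Complex.re_ofReal_mul, sphereAverage]
  congr 1
  have h1 := (Complex.reCLM.intervalIntegral_comp_comm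
    ((continuous_inner_integral (f := fun ϑ φ => f ϑ φ * (Real.sin ϑ : ℂ)) hf' 0
      (2 * Real.pi)).intervalIntegrable (μ := MeasureTheory.volume) 0 Real.pi)).symm
  rw [Complex.reCLM_apply] at h1
  rw [h1]
  congr 1
  ext ϑ
  have h2 := (Complex.reCLM.intervalIntegral_comp_comm
    (Continuous.intervalIntegrable (μ := MeasureTheory.volume)
      (hf'.comp (Continuous.prodMk_right ϑ)) 0 (2 * Real.pi))).symm
  simp only [Function.comp_apply] at h2
  rw [h2]
  simp only [Complex.reCLM_apply, Complex.re_mul_ofReal]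

/-- The integral of a divergence vanishes. -/
theorem integral_divergence_eq_zero {H K H' K' : ℝ → ℝ → ℂ}
    (hH : ∀ ϑ φ, HasDerivAt (fun φ => H ϑ φ) (H' ϑ φ) φ)
    (hK : ∀ ϑ φ, HasDerivAt (fun ϑ => K ϑ φ) (K' ϑ φ) ϑ)
    (hH' : Continuous fun p : ℝ × ℝ => H' p.1 p.2) (hK' : Continuous fun p : ℝ × ℝ => K' p.1 p.2)
    (hper : ∀ ϑ, H ϑ (2 * Real.pi) = H ϑ 0) (h0 : ∀ φ, K 0 φ = 0) (hπ : ∀ φ, K Real.pi φ = 0) :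
    ∫ ϑ in (0 : ℝ)..Real.pi, ∫ φ in (0 : ℝ)..(2 * Real.pi), (H' ϑ φ + K' ϑ φ) = 0 := by
  have e1 : ∀ ϑ, ∫ φ in (0 : ℝ)..(2 * Real.pi), (H' ϑ φ + K' ϑ φ) =
      ∫ φ in (0 : ℝ)..(2 * Real.pi), K' ϑ φ := by
    intro ϑ
    have hc : Continuous fun φ => H' ϑ φ := hH'.comp (Continuous.prodMk_right ϑ)
    have hc' : Continuous fun φ => K' ϑ φ := hK'.comp (Continuous.prodMk_right ϑ)
    rw [intervalIntegral.integral_add (Continuous.intervalIntegrable hc _ _)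
      (Continuous.intervalIntegrable hc' _ _),
      intervalIntegral.integral_eq_sub_of_hasDerivAt (fun φ _ => hH ϑ φ)
        (Continuous.intervalIntegrable hc _ _), hper, sub_self, zero_add]
  simp only [e1]
  -- The azimuthal part has vanished by periodicity; after exchanging the integrals the polar part
  -- vanishes through its values at the poles.
  rw [MeasureTheory.intervalIntegral_intervalIntegral_swap]
  · have e2 : ∀ φ, ∫ ϑ in (0 : ℝ)..Real.pi, K' ϑ φ = 0 := by
      intro φ
      rw [intervalIntegral.integral_eq_sub_of_hasDerivAt (fun ϑ _ => hK ϑ φ)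
        (Continuous.intervalIntegrable (hK'.comp (Continuous.prodMk_left φ)) _ _), hπ, h0, sub_self]
    simp [e2]
  · exact (hK'.continuousOn.integrableOn_compact
      (isCompact_uIcc.prod isCompact_uIcc)).mono_set
        (Set.prod_mono Set.uIoc_subset_uIcc Set.uIoc_subset_uIcc)

/-! The rotated states. -/

section Exponentials

variable {ι : Type} [Fintype ι] [DecidableEq ι]

theorem continuous_exp_smul (A : Op ι) :
    Continuous fun t : ℝ => NormedSpace.exp ((-(Complex.I * (t : ℂ))) • A) := by
  let _ : NormedRing (Op ι) := Matrix.linftyOpNormedRing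
  let _ : NormedAlgebra ℂ (Op ι) := Matrix.linftyOpNormedAlgebra
  let _ : NormedAlgebra ℚ (Op ι) := .restrictScalars ℚ ℂ _
  have h : Continuous (NormedSpace.exp : Op ι → Op ι) := NormedSpace.exp_continuous
  have h2 : Continuous fun t : ℝ => (-(Complex.I * (t : ℂ))) • A := by fun_prop
  exact h.comp h2

/-- The constant outer factors let one statement serve both angles: they are 1 for the azimuth and
the rotation about z with its adjoint for the polar angle. -/
theorem hasDerivAt_exp_conj {A : Op ι} (hA : Aᴴ = A) (X Y Z : Op ι) (i l : ι) (t : ℝ) :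
    HasDerivAt (fun t : ℝ => (Y * (NormedSpace.exp ((-(Complex.I * (t : ℂ))) • A) * X *
        (NormedSpace.exp ((-(Complex.I * (t : ℂ))) • A))ᴴ) * Z) i l)
      ((Y * ((-Complex.I) • (A * (NormedSpace.exp ((-(Complex.I * (t : ℂ))) • A) * X *
        (NormedSpace.exp ((-(Complex.I * (t : ℂ))) • A))ᴴ) -
        (NormedSpace.exp ((-(Complex.I * (t : ℂ))) • A) * X *
        (NormedSpace.exp ((-(Complex.I * (t : ℂ))) • A))ᴴ) * A)) * Z) i l) t := by
  let _ : NormedRing (Op ι) := Matrix.linftyOpNormedRing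
  let _ : NormedAlgebra ℂ (Op ι) := Matrix.linftyOpNormedAlgebra
  let _ : NormedAlgebra ℝ (Op ι) := .restrictScalars ℝ ℂ _
  have e1 : ∀ t : ℝ, (-(Complex.I * (t : ℂ))) • A = t • ((-Complex.I) • A) := by
    intro t
    rw [← Complex.coe_smul, smul_smul]; congr 1; ring
  have e2 : ∀ t : ℝ, (NormedSpace.exp (t • ((-Complex.I) • A)))ᴴ =
      NormedSpace.exp (t • (Complex.I • A)) := by
    intro t
    rw [← Matrix.exp_conjTranspose, Matrix.conjTranspose_smul, Matrix.conjTranspose_smul, hA]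
    simp
  simp only [e1, e2]
  have h1 := hasDerivAt_exp_smul_const' (𝕂 := ℝ) ((-Complex.I) • A) t
  have h2 := hasDerivAt_exp_smul_const (𝕂 := ℝ) (Complex.I • A) t
  have h3 := (((h1.mul_const X).mul h2).const_mul Y).mul_const Z
  have h4 := ((Matrix.entryLinearMap ℝ ℂ i l).toContinuousLinearMap.hasFDerivAt.comp_hasDerivAt t h3)
  convert! h4 using 1
  simp only [Matrix.mul_assoc, smul_mul_assoc, mul_smul_comm, smul_sub]
  simp only [neg_smul, sub_neg_eq_add]
  rfl

end Exponentials


/-- The eigenstate `|m⟩⟨m|` of the spin along the `z`-axis, rotated so that the `z`-axis goes to the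
direction with spherical coordinates `(ϑ, φ)`. -/
def rotatedState (d : ℕ) (m : Fin (d + 1)) (ϑ φ : ℝ) : Op (Fin (d + 1)) :=
  rotation d φ ϑ 0 * Matrix.single m m 1 * (rotation d φ ϑ 0)ᴴ

theorem rotation_eq_mul (d : ℕ) (α β γ : ℝ) :
    rotation d α β γ = rotation d α β 0 * NormedSpace.exp ((-(Complex.I * (γ : ℂ))) • spinZ d) := by
  simp [rotation]

theorem rotation_zero_eq (d : ℕ) (α β : ℝ) :
    rotation d α β 0 = NormedSpace.exp ((-(Complex.I * (α : ℂ))) • spinZ d) *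
      NormedSpace.exp ((-(Complex.I * (β : ℂ))) • spinY d) := by
  simp [rotation]

theorem exp_smul_spinZ (d : ℕ) (z : ℂ) :
    NormedSpace.exp (z • spinZ d) =
      Matrix.diagonal fun k : Fin (d + 1) => Complex.exp (z * ((d : ℂ) / 2 - (k : ℕ))) := by
  rw [spinZ, ← Matrix.diagonal_smul, Matrix.exp_diagonal]
  congr 1
  ext k
  rw [Pi.coe_exp, Complex.exp_eq_exp_ℂ]
  simp

theorem continuous_rotation (d : ℕ) :
    Continuous fun p : ℝ × ℝ => rotation d p.2 p.1 0 := by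
  simp only [rotation_zero_eq]
  exact ((continuous_exp_smul (spinZ d)).comp continuous_snd).matrix_mul
    ((continuous_exp_smul (spinY d)).comp continuous_fst)

theorem continuous_rotatedState (d : ℕ) (m : Fin (d + 1)) :
    Continuous fun p : ℝ × ℝ => rotatedState d m p.1 p.2 :=
  ((continuous_rotation d).matrix_mul continuous_const).matrix_mul
    (continuous_rotation d).matrix_conjTranspose

theorem continuous_rotatedState_apply (d : ℕ) (m i l : Fin (d + 1)) :
    Continuous fun p : ℝ × ℝ => rotatedState d m p.1 p.2 i l :=
  (continuous_rotatedState d m).matrix_elem i l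

theorem spinZ_mul_single (d : ℕ) (m : Fin (d + 1)) :
    spinZ d * Matrix.single m m 1 = ((d : ℂ) / 2 - (m : ℕ)) • Matrix.single m m (1 : ℂ) := by
  ext i l
  simp only [spinZ, Matrix.diagonal_mul, Matrix.single_apply, Matrix.smul_apply, smul_eq_mul]
  split_ifs with h
  · rw [h.1]
  · simp

theorem spinAlong_isHermitian (d : ℕ) (ϑ φ : ℝ) : (spinAlong d ϑ φ)ᴴ = spinAlong d ϑ φ := by
  simp only [spinAlong, Matrix.conjTranspose_add, Matrix.conjTranspose_smul, spinX_isHermitian,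
    spinY_isHermitian, spinZ_isHermitian, Complex.star_def, Complex.conj_ofReal]

theorem spinAlong_mul_rotatedState (d : ℕ) (m : Fin (d + 1)) (ϑ φ : ℝ) :
    spinAlong d ϑ φ * rotatedState d m ϑ φ =
      ((d : ℂ) / 2 - (m : ℕ)) • rotatedState d m ϑ φ := by
  rw [rotatedState, ← Matrix.mul_assoc, ← Matrix.mul_assoc, ← rotation_mul_spinZ,
    Matrix.mul_assoc (rotation d φ ϑ 0), spinZ_mul_single, mul_smul_comm, smul_mul_assoc]

theorem rotatedState_isHermitian (d : ℕ) (m : Fin (d + 1)) (ϑ φ : ℝ) :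
    (rotatedState d m ϑ φ)ᴴ = rotatedState d m ϑ φ := by
  simp [rotatedState, Matrix.conjTranspose_mul, Matrix.mul_assoc]

theorem rotatedState_mul_spinAlong (d : ℕ) (m : Fin (d + 1)) (ϑ φ : ℝ) :
    rotatedState d m ϑ φ * spinAlong d ϑ φ =
      ((d : ℂ) / 2 - (m : ℕ)) • rotatedState d m ϑ φ := by
  have h := congrArg Matrix.conjTranspose (spinAlong_mul_rotatedState d m ϑ φ)
  rw [Matrix.conjTranspose_mul, Matrix.conjTranspose_smul, rotatedState_isHermitian,
    spinAlong_isHermitian] at h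
  rw [h]
  congr 1
  simp

theorem trace_rotatedState (d : ℕ) (m : Fin (d + 1)) (ϑ φ : ℝ) :
    (rotatedState d m ϑ φ).trace = 1 := by
  have := trace_rotated_mul d φ ϑ 0 (Matrix.single m m 1) 1 1 (by rw [one_mul, mul_one])
  rw [mul_one, mul_one, Matrix.trace_single_eq_same] at this
  exact this

/-- A full turn is the scalar e^{-iπd}, a phase that cancels under conjugation; this covers
half-integer spin. -/
theorem rotatedState_periodic (d : ℕ) (m : Fin (d + 1)) (ϑ : ℝ) :
    rotatedState d m ϑ (2 * Real.pi) = rotatedState d m ϑ 0 := by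
  have hI : ∀ k : ℕ, Complex.exp (-(Complex.I * ((2 * Real.pi : ℝ) : ℂ)) * ((d : ℂ) / 2 - k)) =
      Complex.exp (-(Complex.I * Real.pi * d)) := by
    intro k
    rw [Complex.exp_eq_exp_iff_exists_int]
    exact ⟨k, by push_cast; ring⟩
  have h : NormedSpace.exp ((-(Complex.I * ((2 * Real.pi : ℝ) : ℂ))) • spinZ d) =
      Complex.exp (-(Complex.I * Real.pi * d)) • 1 := by
    rw [exp_smul_spinZ, Matrix.smul_one_eq_diagonal]
    simp only [hI]
  have h1 : Complex.exp (-(Complex.I * Real.pi * d)) *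
      star (Complex.exp (-(Complex.I * Real.pi * d))) = 1 := by
    rw [Complex.star_def, ← Complex.exp_conj, ← Complex.exp_add]
    simp
  rw [rotatedState, rotatedState, rotation_zero_eq, rotation_zero_eq, h]
  simp only [Complex.ofReal_zero, mul_zero, neg_zero, zero_smul, NormedSpace.exp_zero, one_mul,
    smul_mul_assoc, Matrix.conjTranspose_smul, mul_smul_comm, smul_smul]
  rw [mul_comm, h1, one_smul]

theorem hasDerivAt_rotatedState_azimuth (d : ℕ) (m i l : Fin (d + 1)) (ϑ φ : ℝ) :
    HasDerivAt (fun φ => rotatedState d m ϑ φ i l)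
      (((-Complex.I) • (spinZ d * rotatedState d m ϑ φ - rotatedState d m ϑ φ * spinZ d) :
        Op (Fin (d + 1))) i l) φ := by
  have e : ∀ φ : ℝ, rotatedState d m ϑ φ = NormedSpace.exp ((-(Complex.I * (φ : ℂ))) • spinZ d) *
      (NormedSpace.exp ((-(Complex.I * (ϑ : ℂ))) • spinY d) * Matrix.single m m 1 *
        (NormedSpace.exp ((-(Complex.I * (ϑ : ℂ))) • spinY d))ᴴ) *
      (NormedSpace.exp ((-(Complex.I * (φ : ℂ))) • spinZ d))ᴴ := by
    intro φ
    simp only [rotatedState, rotation_zero_eq, Matrix.conjTranspose_mul, Matrix.mul_assoc]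
  have h := hasDerivAt_exp_conj (spinZ_isHermitian d)
    (NormedSpace.exp ((-(Complex.I * (ϑ : ℂ))) • spinY d) * Matrix.single m m 1 *
        (NormedSpace.exp ((-(Complex.I * (ϑ : ℂ))) • spinY d))ᴴ) 1 1 i l φ
  simp only [one_mul, mul_one, ← e] at h
  exact h

/-- The generator of the polar motion is J_y turned about the z-axis by the azimuth. -/
theorem hasDerivAt_rotatedState_polar (d : ℕ) (m i l : Fin (d + 1)) (ϑ φ : ℝ) :
    HasDerivAt (fun ϑ => rotatedState d m ϑ φ i l)
      (((-Complex.I) • (((Real.cos φ : ℂ) • spinY d - (Real.sin φ : ℂ) • spinX d) *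
        rotatedState d m ϑ φ - rotatedState d m ϑ φ *
          ((Real.cos φ : ℂ) • spinY d - (Real.sin φ : ℂ) • spinX d)) :
        Op (Fin (d + 1))) i l) ϑ := by
  have hW := exp_spinZ_mul_spinY d φ
  have hW' := congrArg Matrix.conjTranspose hW
  simp only [Matrix.conjTranspose_mul, Matrix.conjTranspose_sub, Matrix.conjTranspose_smul,
    spinX_isHermitian, spinY_isHermitian, Complex.star_def, Complex.conj_ofReal] at hW'
  have e : ∀ ϑ : ℝ, rotatedState d m ϑ φ = NormedSpace.exp ((-(Complex.I * (φ : ℂ))) • spinZ d) *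
      (NormedSpace.exp ((-(Complex.I * (ϑ : ℂ))) • spinY d) * Matrix.single m m 1 *
        (NormedSpace.exp ((-(Complex.I * (ϑ : ℂ))) • spinY d))ᴴ) *
      (NormedSpace.exp ((-(Complex.I * (φ : ℂ))) • spinZ d))ᴴ := by
    intro ϑ
    simp only [rotatedState, rotation_zero_eq, Matrix.conjTranspose_mul, Matrix.mul_assoc]
  have h := hasDerivAt_exp_conj (spinY_isHermitian d) (Matrix.single m m 1)
    (NormedSpace.exp ((-(Complex.I * (φ : ℂ))) • spinZ d))
    (NormedSpace.exp ((-(Complex.I * (φ : ℂ))) • spinZ d))ᴴ i l ϑ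
  simp only [← e] at h
  convert! h using 1
  rw [e]
  generalize NormedSpace.exp ((-(Complex.I * (ϑ : ℂ))) • spinY d) * Matrix.single m m 1 *
        (NormedSpace.exp ((-(Complex.I * (ϑ : ℂ))) • spinY d))ᴴ = N
  generalize NormedSpace.exp ((-(Complex.I * (φ : ℂ))) • spinZ d) = A at *
  generalize (Real.cos φ : ℂ) • spinY d - (Real.sin φ : ℂ) • spinX d = W at *
  rw [mul_smul_comm, smul_mul_assoc, mul_sub, sub_mul]
  have h1 : A * N * Aᴴ * W = A * (N * spinY d) * Aᴴ := by simp only [Matrix.mul_assoc, hW']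
  rw [← h1]
  simp only [← Matrix.mul_assoc, hW]

/-! Moments of the direction. -/

/-- The components of the spin. -/
def spinVec (d : ℕ) : Fin 3 → Op (Fin (d + 1)) := ![spinX d, spinY d, spinZ d]

/-- The cartesian components of a direction. -/
def dir (a : Fin 3) (ϑ φ : ℝ) : ℝ :=
  (![Real.sin ϑ * Real.cos φ, Real.sin ϑ * Real.sin φ, Real.cos ϑ] : Fin 3 → ℝ) a

/-- The Levi-Civita symbol. -/
def leviCivita (a b c : Fin 3) : ℝ :=
  (((b : ℕ) : ℝ) - ((a : ℕ) : ℝ)) * (((c : ℕ) : ℝ) - ((a : ℕ) : ℝ)) *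
    (((c : ℕ) : ℝ) - ((b : ℕ) : ℝ)) / 2

theorem spinAlong_eq_sum (d : ℕ) (ϑ φ : ℝ) :
    spinAlong d ϑ φ = ∑ a, (dir a ϑ φ : ℂ) • spinVec d a := by
  simp only [spinAlong, Fin.sum_univ_three, dir, spinVec, Matrix.cons_val]

theorem sum_dir_mul_dir (ϑ φ : ℝ) : ∑ a, dir a ϑ φ * dir a ϑ φ = 1 := by
  simp only [Fin.sum_univ_three, dir, Matrix.cons_val]
  have h1 := Real.sin_sq_add_cos_sq ϑ
  have h2 := Real.sin_sq_add_cos_sq φ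
  linear_combination h1 + Real.sin ϑ ^ 2 * h2

theorem continuous_dir (a : Fin 3) : Continuous fun p : ℝ × ℝ => dir a p.1 p.2 := by
  fin_cases a <;> simp only [dir, Fin.zero_eta, Fin.mk_one, Fin.reduceFinMk, Matrix.cons_val] <;>
    fun_prop

/-- The average of the rotated states, weighted with a function of the direction. -/
def momentOp (d : ℕ) (m : Fin (d + 1)) (p : ℝ → ℝ → ℝ) : Op (Fin (d + 1)) :=
  Matrix.of fun i l => sphereMean fun ϑ φ => (p ϑ φ : ℂ) * rotatedState d m ϑ φ i l

theorem continuous_mul_rotatedState {d : ℕ} (m i l : Fin (d + 1)) {p : ℝ → ℝ → ℝ}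
    (hp : Continuous fun q : ℝ × ℝ => p q.1 q.2) :
    Continuous fun q : ℝ × ℝ => (p q.1 q.2 : ℂ) * rotatedState d m q.1 q.2 i l :=
  (Complex.continuous_ofReal.comp hp).mul (continuous_rotatedState_apply d m i l)

theorem momentOp_sum {d : ℕ} (m : Fin (d + 1)) {η : Type} (s : Finset η) (c : η → ℝ)
    {p : η → ℝ → ℝ → ℝ} (hp : ∀ i, Continuous fun q : ℝ × ℝ => p i q.1 q.2) :
    momentOp d m (fun ϑ φ => ∑ i ∈ s, c i * p i ϑ φ) = ∑ i ∈ s, (c i : ℂ) • momentOp d m (p i) := by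
  ext i l
  simp only [momentOp, Matrix.of_apply, Matrix.sum_apply, Matrix.smul_apply, smul_eq_mul,
    ← sphereMean_const_mul]
  rw [← sphereMean_sum]
  · congr 1
    ext ϑ φ
    push_cast
    rw [Finset.sum_mul]
    exact Finset.sum_congr rfl fun _ _ => by ring
  · intro a _
    exact continuous_const.mul (continuous_mul_rotatedState m i l (hp a))

theorem mul_momentOp_apply {d : ℕ} (m i l : Fin (d + 1)) (X : Op (Fin (d + 1))) {p : ℝ → ℝ → ℝ}
    (hp : Continuous fun q : ℝ × ℝ => p q.1 q.2) :
    (X * momentOp d m p) i l =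
      sphereMean fun ϑ φ => (p ϑ φ : ℂ) * (X * rotatedState d m ϑ φ) i l := by
  simp only [Matrix.mul_apply, momentOp, Matrix.of_apply, ← sphereMean_const_mul]
  rw [← sphereMean_sum]
  · congr 1
    ext ϑ φ
    rw [Finset.mul_sum]
    exact Finset.sum_congr rfl fun _ _ => by ring
  · intro a _
    exact continuous_const.mul (continuous_mul_rotatedState m a l hp)

theorem momentOp_mul_apply {d : ℕ} (m i l : Fin (d + 1)) (X : Op (Fin (d + 1))) {p : ℝ → ℝ → ℝ}
    (hp : Continuous fun q : ℝ × ℝ => p q.1 q.2) :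
    (momentOp d m p * X) i l =
      sphereMean fun ϑ φ => (p ϑ φ : ℂ) * (rotatedState d m ϑ φ * X) i l := by
  simp only [Matrix.mul_apply, momentOp, Matrix.of_apply, mul_comm _ (X _ l),
    ← sphereMean_const_mul]
  rw [← sphereMean_sum]
  · congr 1
    ext ϑ φ
    rw [Finset.mul_sum]
    exact Finset.sum_congr rfl fun _ _ => by ring
  · intro a _
    exact continuous_const.mul (continuous_mul_rotatedState m i a hp)


/-- The azimuthal component of the field of the infinitesimal rotations about the axis `a`. -/
def rotationAzimuth (a : Fin 3) (ϑ φ : ℝ) : ℝ :=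
  (![-(Real.cos φ * Real.cos ϑ), -(Real.sin φ * Real.cos ϑ), Real.sin ϑ] : Fin 3 → ℝ) a

/-- The polar component of the field of the infinitesimal rotations about the axis `a`. -/
def rotationPolar (a : Fin 3) (ϑ φ : ℝ) : ℝ :=
  (![-(Real.sin φ * Real.sin ϑ), Real.cos φ * Real.sin ϑ, 0] : Fin 3 → ℝ) a

/-- The azimuthal derivative of the direction. -/
def dirAzimuth (a : Fin 3) (ϑ φ : ℝ) : ℝ :=
  (![-(Real.sin ϑ * Real.sin φ), Real.sin ϑ * Real.cos φ, 0] : Fin 3 → ℝ) a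

/-- The polar derivative of the direction. -/
def dirPolar (a : Fin 3) (ϑ φ : ℝ) : ℝ :=
  (![Real.cos ϑ * Real.cos φ, Real.cos ϑ * Real.sin φ, -Real.sin ϑ] : Fin 3 → ℝ) a

theorem hasDerivAt_dir_azimuth (a : Fin 3) (ϑ φ : ℝ) :
    HasDerivAt (fun φ => dir a ϑ φ) (dirAzimuth a ϑ φ) φ := by
  fin_cases a <;> simp only [dir, dirAzimuth, Fin.zero_eta, Fin.mk_one, Fin.reduceFinMk,
    Matrix.cons_val]
  · simpa using (Real.hasDerivAt_cos φ).const_mul (Real.sin ϑ)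
  · exact (Real.hasDerivAt_sin φ).const_mul (Real.sin ϑ)
  · exact hasDerivAt_const φ _

theorem hasDerivAt_dir_polar (a : Fin 3) (ϑ φ : ℝ) :
    HasDerivAt (fun ϑ => dir a ϑ φ) (dirPolar a ϑ φ) ϑ := by
  fin_cases a <;> simp only [dir, dirPolar, Fin.zero_eta, Fin.mk_one, Fin.reduceFinMk,
    Matrix.cons_val]
  · exact (Real.hasDerivAt_sin ϑ).mul_const (Real.cos φ)
  · exact (Real.hasDerivAt_sin ϑ).mul_const (Real.sin φ)
  · exact Real.hasDerivAt_cos ϑ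

theorem continuous_dirAzimuth (a : Fin 3) : Continuous fun p : ℝ × ℝ => dirAzimuth a p.1 p.2 := by
  fin_cases a <;> simp only [dirAzimuth, Fin.zero_eta, Fin.mk_one, Fin.reduceFinMk,
    Matrix.cons_val] <;> fun_prop

theorem continuous_dirPolar (a : Fin 3) : Continuous fun p : ℝ × ℝ => dirPolar a p.1 p.2 := by
  fin_cases a <;> simp only [dirPolar, Fin.zero_eta, Fin.mk_one, Fin.reduceFinMk,
    Matrix.cons_val] <;> fun_prop

theorem continuous_rotationAzimuth (a : Fin 3) :
    Continuous fun p : ℝ × ℝ => rotationAzimuth a p.1 p.2 := by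
  fin_cases a <;> simp only [rotationAzimuth, Fin.zero_eta, Fin.mk_one, Fin.reduceFinMk,
    Matrix.cons_val] <;> fun_prop

theorem continuous_rotationPolar (a : Fin 3) :
    Continuous fun p : ℝ × ℝ => rotationPolar a p.1 p.2 := by
  fin_cases a <;> simp only [rotationPolar, Fin.zero_eta, Fin.mk_one, Fin.reduceFinMk,
    Matrix.cons_val] <;> fun_prop

theorem dir_periodic (a : Fin 3) (ϑ : ℝ) : dir a ϑ (2 * Real.pi) = dir a ϑ 0 := by
  fin_cases a <;> simp [dir]

theorem rotationAzimuth_periodic (a : Fin 3) (ϑ : ℝ) :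
    rotationAzimuth a ϑ (2 * Real.pi) = rotationAzimuth a ϑ 0 := by
  fin_cases a <;> simp [rotationAzimuth]

/-- The field of an infinitesimal rotation has no divergence. -/
theorem exists_hasDerivAt_rotation (a : Fin 3) (ϑ φ : ℝ) :
    HasDerivAt (fun φ => rotationAzimuth a ϑ φ)
      ((![Real.sin φ * Real.cos ϑ, -(Real.cos φ * Real.cos ϑ), 0] : Fin 3 → ℝ) a) φ ∧
    HasDerivAt (fun ϑ => rotationPolar a ϑ φ)
      (-(![Real.sin φ * Real.cos ϑ, -(Real.cos φ * Real.cos ϑ), 0] : Fin 3 → ℝ) a) ϑ := by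
  fin_cases a <;> simp only [rotationAzimuth, rotationPolar, Fin.zero_eta, Fin.mk_one,
    Fin.reduceFinMk, Matrix.cons_val]
  · refine ⟨?_, ?_⟩
    · simpa using ((Real.hasDerivAt_cos φ).mul_const (Real.cos ϑ)).fun_neg
    · simpa using ((Real.hasDerivAt_sin ϑ).const_mul (Real.sin φ)).fun_neg
  · refine ⟨?_, ?_⟩
    · simpa using ((Real.hasDerivAt_sin φ).mul_const (Real.cos ϑ)).fun_neg
    · simpa using ((Real.hasDerivAt_sin ϑ).const_mul (Real.cos φ))
  · simpa using ⟨hasDerivAt_const φ (Real.sin ϑ), hasDerivAt_const ϑ (0 : ℝ)⟩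

/-- The direction transforms as a vector under infinitesimal rotations. The fields already contain
the surface density sin ϑ, hence that factor. -/
theorem rotation_field_dir (a b : Fin 3) (ϑ φ : ℝ) :
    rotationAzimuth a ϑ φ * dirAzimuth b ϑ φ + rotationPolar a ϑ φ * dirPolar b ϑ φ =
      -(Real.sin ϑ * ∑ e, leviCivita a b e * dir e ϑ φ) := by
  have h1 := Real.sin_sq_add_cos_sq φ
  fin_cases a <;> fin_cases b <;>
    simp only [rotationAzimuth, rotationPolar, dirAzimuth, dirPolar, leviCivita, dir,
      Fin.sum_univ_three, Fin.zero_eta, Fin.mk_one, Fin.reduceFinMk, Matrix.cons_val,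
      Fin.val_zero, Fin.val_one, Fin.val_two, Nat.cast_zero, Nat.cast_one, Nat.cast_ofNat]
  · ring
  · linear_combination (-Real.sin ϑ * Real.cos ϑ) * h1
  · ring
  · linear_combination (Real.sin ϑ * Real.cos ϑ) * h1
  all_goals ring

/-- Each spin component splits into the generators of the two angular motions and a multiple of J_n.
The last part commutes with the rotated state, so its coefficient w need not be known. -/
theorem sin_smul_spinVec (d : ℕ) (a : Fin 3) (ϑ φ : ℝ) :
    ∃ w : ℂ, (Real.sin ϑ : ℂ) • spinVec d a = (rotationAzimuth a ϑ φ : ℂ) • spinZ d +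
      (rotationPolar a ϑ φ : ℂ) • ((Real.cos φ : ℂ) • spinY d - (Real.sin φ : ℂ) • spinX d) +
      w • spinAlong d ϑ φ := by
  have h1 : (Real.sin φ : ℂ) ^ 2 + (Real.cos φ : ℂ) ^ 2 = 1 := by
    exact_mod_cast Real.sin_sq_add_cos_sq φ
  refine ⟨((![Real.cos φ, Real.sin φ, 0] : Fin 3 → ℝ) a : ℂ), ?_⟩
  fin_cases a <;> simp only [spinVec, spinAlong, rotationAzimuth, rotationPolar, Fin.zero_eta,
    Fin.mk_one, Fin.reduceFinMk, Matrix.cons_val, Complex.ofReal_neg, Complex.ofReal_mul,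
    Complex.ofReal_zero]
  · have h2 : (Real.sin ϑ : ℂ) = Real.sin ϑ * ((Real.sin φ : ℂ) ^ 2 + (Real.cos φ : ℂ) ^ 2) := by
      rw [h1, mul_one]
    conv_lhs => rw [h2]
    module
  · have h2 : (Real.sin ϑ : ℂ) = Real.sin ϑ * ((Real.sin φ : ℂ) ^ 2 + (Real.cos φ : ℂ) ^ 2) := by
      rw [h1, mul_one]
    conv_lhs => rw [h2]
    module
  · module

/-- The moments of the direction transform like functions on the sphere under rotations. -/
theorem commutator_momentOp (d : ℕ) (m : Fin (d + 1)) (a : Fin 3) {p pφ pϑ q : ℝ → ℝ → ℝ}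
    (hφ : ∀ ϑ φ, HasDerivAt (fun φ => p ϑ φ) (pφ ϑ φ) φ)
    (hϑ : ∀ ϑ φ, HasDerivAt (fun ϑ => p ϑ φ) (pϑ ϑ φ) ϑ)
    (hp : Continuous fun x : ℝ × ℝ => p x.1 x.2) (hpφ : Continuous fun x : ℝ × ℝ => pφ x.1 x.2)
    (hpϑ : Continuous fun x : ℝ × ℝ => pϑ x.1 x.2)
    (hper : ∀ ϑ, p ϑ (2 * Real.pi) = p ϑ 0)
    (hq : ∀ ϑ φ, rotationAzimuth a ϑ φ * pφ ϑ φ + rotationPolar a ϑ φ * pϑ ϑ φ =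
      -(Real.sin ϑ * q ϑ φ)) (hqc : Continuous fun x : ℝ × ℝ => q x.1 x.2) :
    spinVec d a * momentOp d m p - momentOp d m p * spinVec d a =
      Complex.I • momentOp d m q := by
  ext i l
  let D : ℝ → ℝ → ℝ := fun ϑ φ => (![Real.sin φ * Real.cos ϑ, -(Real.cos φ * Real.cos ϑ), 0] : Fin 3 → ℝ) a
  have hD : Continuous fun x : ℝ × ℝ => D x.1 x.2 := by
    fin_cases a <;> simp only [D, Fin.zero_eta, Fin.mk_one, Fin.reduceFinMk, Matrix.cons_val] <;>
      fun_prop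
  let M := rotatedState d m
  let W : ℝ → Op (Fin (d + 1)) := fun φ =>
    (Real.cos φ : ℂ) • spinY d - (Real.sin φ : ℂ) • spinX d
  let Mφ : ℝ → ℝ → ℂ := fun ϑ φ => ((-Complex.I) • (spinZ d * M ϑ φ - M ϑ φ * spinZ d) :
    Op (Fin (d + 1))) i l
  let Mϑ : ℝ → ℝ → ℂ := fun ϑ φ => ((-Complex.I) • (W φ * M ϑ φ - M ϑ φ * W φ) :
    Op (Fin (d + 1))) i l
  have hM : Continuous fun x : ℝ × ℝ => M x.1 x.2 := continuous_rotatedState d m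
  have hMil : Continuous fun x : ℝ × ℝ => M x.1 x.2 i l := hM.matrix_elem i l
  have hW : Continuous fun x : ℝ × ℝ => W x.2 := by fun_prop
  have hMφ : Continuous fun x : ℝ × ℝ => Mφ x.1 x.2 :=
    (((continuous_const.matrix_mul hM).sub (hM.matrix_mul continuous_const)).const_smul
      (-Complex.I)).matrix_elem i l
  have hMϑ : Continuous fun x : ℝ × ℝ => Mϑ x.1 x.2 :=
    (((hW.matrix_mul hM).sub (hM.matrix_mul hW)).const_smul (-Complex.I)).matrix_elem i l
  have hu := continuous_rotationAzimuth a
  have hv := continuous_rotationPolar a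
  -- Integration by parts on the sphere: the field of the rotation about axis `a`, times p and a
  -- matrix entry of the state, has a divergence of integral zero. Derivatives of the state give the
  -- commutator with J_a, derivatives of p give q.
  have key := integral_divergence_eq_zero
    (H := fun ϑ φ => ((rotationAzimuth a ϑ φ * p ϑ φ : ℝ) : ℂ) * M ϑ φ i l)
    (K := fun ϑ φ => ((rotationPolar a ϑ φ * p ϑ φ : ℝ) : ℂ) * M ϑ φ i l)
    (H' := fun ϑ φ => ((D ϑ φ * p ϑ φ + rotationAzimuth a ϑ φ * pφ ϑ φ : ℝ) : ℂ) * M ϑ φ i l +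
      ((rotationAzimuth a ϑ φ * p ϑ φ : ℝ) : ℂ) * Mφ ϑ φ)
    (K' := fun ϑ φ => ((-D ϑ φ * p ϑ φ + rotationPolar a ϑ φ * pϑ ϑ φ : ℝ) : ℂ) * M ϑ φ i l +
      ((rotationPolar a ϑ φ * p ϑ φ : ℝ) : ℂ) * Mϑ ϑ φ)
    (fun ϑ φ => (((exists_hasDerivAt_rotation a ϑ φ).1.mul (hφ ϑ φ)).ofReal_comp).mul
      (hasDerivAt_rotatedState_azimuth d m i l ϑ φ))
    (fun ϑ φ => (((exists_hasDerivAt_rotation a ϑ φ).2.mul (hϑ ϑ φ)).ofReal_comp).mul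
      (hasDerivAt_rotatedState_polar d m i l ϑ φ))
    (by fun_prop) (by fun_prop)
    (fun ϑ => by simp only [rotationAzimuth_periodic, hper, M, rotatedState_periodic])
    (fun φ => by fin_cases a <;> simp [rotationPolar])
    (fun φ => by fin_cases a <;> simp [rotationPolar])
  have hX : Continuous fun x : ℝ × ℝ => (spinVec d a * M x.1 x.2) i l :=
    (continuous_const.matrix_mul hM).matrix_elem i l
  have hY : Continuous fun x : ℝ × ℝ => (M x.1 x.2 * spinVec d a) i l :=
    (hM.matrix_mul continuous_const).matrix_elem i l
  have hlin : sphereMean (fun ϑ φ => (p ϑ φ : ℂ) * (spinVec d a * M ϑ φ) i l +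
      (-1) * ((p ϑ φ : ℂ) * (M ϑ φ * spinVec d a) i l) +
      (-Complex.I) * ((q ϑ φ : ℂ) * M ϑ φ i l)) =
      sphereMean (fun ϑ φ => (p ϑ φ : ℂ) * (spinVec d a * M ϑ φ) i l) +
      (-1) * sphereMean (fun ϑ φ => (p ϑ φ : ℂ) * (M ϑ φ * spinVec d a) i l) +
      (-Complex.I) * sphereMean (fun ϑ φ => (q ϑ φ : ℂ) * M ϑ φ i l) := by
    rw [sphereMean_add (by fun_prop) (by fun_prop), sphereMean_add (by fun_prop) (by fun_prop),
      sphereMean_const_mul, sphereMean_const_mul]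
  have key2 : ∀ ϑ φ, ((p ϑ φ : ℂ) * (spinVec d a * M ϑ φ) i l +
      (-1) * ((p ϑ φ : ℂ) * (M ϑ φ * spinVec d a) i l) +
      (-Complex.I) * ((q ϑ φ : ℂ) * M ϑ φ i l)) * (Real.sin ϑ : ℂ) =
      Complex.I * (((D ϑ φ * p ϑ φ + rotationAzimuth a ϑ φ * pφ ϑ φ : ℝ) : ℂ) * M ϑ φ i l +
      ((rotationAzimuth a ϑ φ * p ϑ φ : ℝ) : ℂ) * Mφ ϑ φ +
      (((-D ϑ φ * p ϑ φ + rotationPolar a ϑ φ * pϑ ϑ φ : ℝ) : ℂ) * M ϑ φ i l +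
      ((rotationPolar a ϑ φ * p ϑ φ : ℝ) : ℂ) * Mϑ ϑ φ)) := by
    intro ϑ φ
    obtain ⟨w, hw⟩ := sin_smul_spinVec d a ϑ φ
    have h2 : (Real.sin ϑ : ℂ) • (spinVec d a * M ϑ φ - M ϑ φ * spinVec d a) =
        (rotationAzimuth a ϑ φ : ℂ) • (spinZ d * M ϑ φ - M ϑ φ * spinZ d) +
        (rotationPolar a ϑ φ : ℂ) • (W φ * M ϑ φ - M ϑ φ * W φ) := by
      rw [smul_sub, ← smul_mul_assoc, ← mul_smul_comm, hw]
      change (_ + (rotationPolar a ϑ φ : ℂ) • W φ + _) * _ -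
        _ * (_ + (rotationPolar a ϑ φ : ℂ) • W φ + _) = _
      generalize W φ = W'
      simp only [add_mul, mul_add, smul_mul_assoc, mul_smul_comm, M,
        spinAlong_mul_rotatedState, rotatedState_mul_spinAlong, smul_sub]
      abel
    have h3 := congrFun (congrFun h2 i) l
    simp only [Matrix.smul_apply, Matrix.add_apply, Matrix.sub_apply, smul_eq_mul] at h3
    have h4 : (rotationAzimuth a ϑ φ : ℂ) * pφ ϑ φ + rotationPolar a ϑ φ * pϑ ϑ φ =
      -(Real.sin ϑ * q ϑ φ) := by exact_mod_cast hq ϑ φ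
    simp only [Mφ, Mϑ, Matrix.smul_apply, Matrix.sub_apply, smul_eq_mul]
    push_cast at h3 h4 ⊢
    linear_combination (p ϑ φ : ℂ) * h3 - Complex.I * M ϑ φ i l * h4 +
      (p ϑ φ : ℂ) * ((rotationAzimuth a ϑ φ : ℂ) * ((spinZ d * M ϑ φ) i l - (M ϑ φ * spinZ d) i l) +
      rotationPolar a ϑ φ * ((W φ * M ϑ φ) i l - (M ϑ φ * W φ) i l)) * Complex.I_sq
  rw [Matrix.sub_apply, mul_momentOp_apply m i l _ hp, momentOp_mul_apply m i l _ hp,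
    Matrix.smul_apply, momentOp, Matrix.of_apply, smul_eq_mul]
  rw [sphereMean] at hlin
  simp only [key2, intervalIntegral.integral_const_mul] at hlin
  rw [key] at hlin
  linear_combination -hlin


/-! ### Classification of symmetric tensor operators of rank two -/

theorem momentOp_add {d : ℕ} (m : Fin (d + 1)) {p q : ℝ → ℝ → ℝ}
    (hp : Continuous fun x : ℝ × ℝ => p x.1 x.2) (hq : Continuous fun x : ℝ × ℝ => q x.1 x.2) :
    momentOp d m (fun ϑ φ => p ϑ φ + q ϑ φ) = momentOp d m p + momentOp d m q := by
  ext i l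
  simp only [momentOp, Matrix.of_apply, Matrix.add_apply]
  rw [← sphereMean_add (continuous_mul_rotatedState m i l hp)
    (continuous_mul_rotatedState m i l hq)]
  simp only [Complex.ofReal_add, add_mul]

/-- The average of the rotated states, weighted with a product of components of the direction. -/
def secondMoment (d : ℕ) (m : Fin (d + 1)) (a b : Fin 3) : Op (Fin (d + 1)) :=
  momentOp d m fun ϑ φ => dir a ϑ φ * dir b ϑ φ

/-- A symmetric tensor operator of second rank. -/
def IsTensorOp (d : ℕ) (G : Fin 3 → Fin 3 → Op (Fin (d + 1))) : Prop :=
  (∀ a b, G a b = G b a) ∧ ∀ a b c, spinVec d a * G b c - G b c * spinVec d a =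
    Complex.I • (∑ e, (leviCivita a b e : ℂ) • G e c + ∑ e, (leviCivita a c e : ℂ) • G b e)

theorem isTensorOp_secondMoment (d : ℕ) (m : Fin (d + 1)) : IsTensorOp d (secondMoment d m) := by
  refine ⟨fun a b => by simp only [secondMoment, mul_comm], fun a b c => ?_⟩
  have hc := continuous_dir
  have hca := continuous_dirAzimuth
  have hcp := continuous_dirPolar
  have h2 : ∀ b c, Continuous fun x : ℝ × ℝ => dir b x.1 x.2 * dir c x.1 x.2 :=
    fun b c => (hc b).mul (hc c)
  have h := commutator_momentOp d m a (p := fun ϑ φ => dir b ϑ φ * dir c ϑ φ)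
    (q := fun ϑ φ => ∑ e, leviCivita a b e * (dir e ϑ φ * dir c ϑ φ) +
      ∑ e, leviCivita a c e * (dir b ϑ φ * dir e ϑ φ))
    (fun ϑ φ => (hasDerivAt_dir_azimuth b ϑ φ).mul (hasDerivAt_dir_azimuth c ϑ φ))
    (fun ϑ φ => (hasDerivAt_dir_polar b ϑ φ).mul (hasDerivAt_dir_polar c ϑ φ))
    (h2 b c) (((hca b).mul (hc c)).add ((hc b).mul (hca c)))
    (((hcp b).mul (hc c)).add ((hc b).mul (hcp c)))
    (fun ϑ => by simp only [dir_periodic])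
    (fun ϑ φ => by
      have e1 := rotation_field_dir a b ϑ φ
      have e2 := rotation_field_dir a c ϑ φ
      simp only [← mul_assoc, ← Finset.sum_mul]
      simp only [mul_comm _ (dir b ϑ φ), mul_assoc, ← Finset.mul_sum]
      linear_combination dir c ϑ φ * e1 + dir b ϑ φ * e2)
    ((continuous_finsetSum _ fun e _ => continuous_const.mul (h2 e c)).add
      (continuous_finsetSum _ fun e _ => continuous_const.mul (h2 b e)))
  rw [secondMoment, h, momentOp_add m
      (continuous_finsetSum _ fun e _ => continuous_const.mul (h2 e c))
      (continuous_finsetSum _ fun e _ => continuous_const.mul (h2 b e)),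
    momentOp_sum m _ (fun e => leviCivita a b e) (fun e => h2 e c),
    momentOp_sum m _ (fun e => leviCivita a c e) (fun e => h2 b e)]
  rfl

theorem spinVec_commutator (d : ℕ) (a b : Fin 3) :
    spinVec d a * spinVec d b - spinVec d b * spinVec d a =
      Complex.I • ∑ e, (leviCivita a b e : ℂ) • spinVec d e := by
  have hxy := spin_comm_xy d
  have hyz := spin_comm_yz d
  have hzx := spin_comm_zx d
  fin_cases a <;> fin_cases b <;>
    simp only [spinVec, leviCivita, Fin.sum_univ_three, Fin.zero_eta, Fin.mk_one, Fin.reduceFinMk,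
      Matrix.cons_val, Fin.val_zero, Fin.val_one, Fin.val_two, Nat.cast_zero, Nat.cast_one,
      Nat.cast_ofNat, sub_self] <;> norm_num
  · exact hxy
  · rw [← hzx]; abel
  · rw [← hxy]; abel
  · exact hyz
  · exact hzx
  · rw [← hyz]; abel

/-- The tensor `J_a J_b + J_b J_a`. -/
def spinTensor (d : ℕ) (a b : Fin 3) : Op (Fin (d + 1)) :=
  (1 / 2 : ℂ) • (spinVec d a * spinVec d b + spinVec d b * spinVec d a)

theorem isTensorOp_spinTensor (d : ℕ) : IsTensorOp d (spinTensor d) := by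
  refine ⟨fun a b => by simp only [spinTensor, add_comm], fun a b c => ?_⟩
  have h : spinVec d a * spinTensor d b c - spinTensor d b c * spinVec d a = (1 / 2 : ℂ) •
      ((spinVec d a * spinVec d b - spinVec d b * spinVec d a) * spinVec d c +
      spinVec d b * (spinVec d a * spinVec d c - spinVec d c * spinVec d a) +
      ((spinVec d a * spinVec d c - spinVec d c * spinVec d a) * spinVec d b +
      spinVec d c * (spinVec d a * spinVec d b - spinVec d b * spinVec d a))) := by
    rw [spinTensor, mul_smul_comm, smul_mul_assoc, ← smul_sub]
    congr 1
    noncomm_ring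
  rw [h, spinVec_commutator, spinVec_commutator]
  simp only [spinTensor, Fin.sum_univ_three, mul_smul_comm, smul_mul_assoc, mul_add, add_mul,
    smul_add]
  module

/-- The commutators vanish, and the two Levi-Civita terms cancel by antisymmetry. -/
theorem isTensorOp_one (d : ℕ) : IsTensorOp d fun a b => if a = b then 1 else 0 := by
  refine ⟨fun a b => by simp only [eq_comm], fun a b c => ?_⟩
  have h : (leviCivita a b c : ℂ) + leviCivita a c b = 0 := by
    rw [leviCivita, leviCivita]; push_cast; ring
  simp only [mul_ite, mul_one, mul_zero, ite_mul, one_mul, zero_mul, sub_self, smul_ite, smul_zero,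
    Finset.sum_ite_eq, Finset.sum_ite_eq', Finset.mem_univ, if_true, ← add_smul, h, zero_smul]

theorem IsTensorOp.add {d : ℕ} {G H : Fin 3 → Fin 3 → Op (Fin (d + 1))} (hG : IsTensorOp d G)
    (hH : IsTensorOp d H) : IsTensorOp d fun a b => G a b + H a b := by
  refine ⟨fun a b => by simp only [hG.1 a b, hH.1 a b], fun a b c => ?_⟩
  have h1 := hG.2 a b c
  have h2 := hH.2 a b c
  calc _ = (spinVec d a * G b c - G b c * spinVec d a) +
      (spinVec d a * H b c - H b c * spinVec d a) := by noncomm_ring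
    _ = _ := by
      rw [h1, h2]
      simp only [smul_add, Finset.sum_add_distrib]
      abel

theorem IsTensorOp.smul {d : ℕ} {G : Fin 3 → Fin 3 → Op (Fin (d + 1))} (hG : IsTensorOp d G)
    (c : ℂ) : IsTensorOp d fun a b => c • G a b := by
  refine ⟨fun a b => by simp only [hG.1 a b], fun a b e => ?_⟩
  rw [mul_smul_comm, smul_mul_assoc, ← smul_sub, hG.2]
  simp only [Fin.sum_univ_three]
  module

/-- The components of a tensor operator, obtained from a component by commutation. -/
theorem IsTensorOp.commutators {d : ℕ} {G : Fin 3 → Fin 3 → Op (Fin (d + 1))}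
    (hG : IsTensorOp d G) :
    (spinX d * G 2 2 - G 2 2 * spinX d = (-2 * Complex.I) • G 1 2 ∧
     spinY d * G 2 2 - G 2 2 * spinY d = (2 * Complex.I) • G 0 2 ∧
     spinZ d * G 2 2 - G 2 2 * spinZ d = 0) ∧
    (spinX d * G 0 2 - G 0 2 * spinX d = (-Complex.I) • G 0 1 ∧
     spinX d * G 1 2 - G 1 2 * spinX d = Complex.I • (G 2 2 - G 1 1) ∧
     spinY d * G 0 2 - G 0 2 * spinY d = Complex.I • (G 0 0 - G 2 2) ∧
     spinY d * G 1 2 - G 1 2 * spinY d = Complex.I • G 0 1) ∧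
    (spinX d * G 0 0 - G 0 0 * spinX d = 0 ∧
     spinX d * G 1 1 - G 1 1 * spinX d = (2 * Complex.I) • G 1 2 ∧
     spinX d * G 0 1 - G 0 1 * spinX d = Complex.I • G 0 2 ∧
     spinY d * G 0 0 - G 0 0 * spinY d = (-2 * Complex.I) • G 0 2 ∧
     spinY d * G 1 1 - G 1 1 * spinY d = 0 ∧
     spinY d * G 0 1 - G 0 1 * spinY d = (-Complex.I) • G 1 2) := by
  obtain ⟨hs, h⟩ := hG
  have h10 := hs 1 0
  have h20 := hs 2 0
  have h21 := hs 2 1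
  have k : ∀ a b c, spinVec d a * G b c - G b c * spinVec d a = _ := h
  have e0 : spinVec d 0 = spinX d := rfl
  have e1 : spinVec d 1 = spinY d := rfl
  have e2 : spinVec d 2 = spinZ d := rfl
  have l : ∀ a b c : Fin 3, ((leviCivita a b c : ℝ) : ℂ) = (((b : ℕ) : ℂ) - ((a : ℕ) : ℂ)) *
    (((c : ℕ) : ℂ) - ((a : ℕ) : ℂ)) * (((c : ℕ) : ℂ) - ((b : ℕ) : ℂ)) / 2 := by
    intro a b c; rw [leviCivita]; push_cast; rfl
  simp only [← e0, ← e1, ← e2, k, l, Fin.sum_univ_three, h10, h20, h21, Fin.val_zero, Fin.val_one,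
    Fin.val_two, Nat.cast_zero, Nat.cast_one, Nat.cast_ofNat]
  refine ⟨⟨?_, ?_, ?_⟩, ⟨?_, ?_, ?_, ?_⟩, ⟨?_, ?_, ?_, ?_, ?_, ?_⟩⟩ <;> module

theorem spinRaise_mul_apply (d : ℕ) (X : Op (Fin (d + 1))) (k : ℕ) (hk : k + 1 < d + 1)
    (l : Fin (d + 1)) :
    (spinRaise d * X) ⟨k, by omega⟩ l =
      spinRaise d ⟨k, by omega⟩ ⟨k + 1, hk⟩ * X ⟨k + 1, hk⟩ l := by
  rw [Matrix.mul_apply]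
  refine Finset.sum_eq_single _ (fun b _ hb => ?_) (by simp)
  rw [spinRaise, Matrix.of_apply, if_neg, zero_mul]
  intro h
  exact hb (Fin.ext h.symm)

theorem spinRaise_apply_succ_ne_zero (d k : ℕ) (hk : k + 1 < d + 1) :
    spinRaise d ⟨k, by omega⟩ ⟨k + 1, hk⟩ ≠ 0 := by
  rw [spinRaise_apply_succ, Complex.ofReal_ne_zero, Real.sqrt_ne_zero']
  have : ((k + 1 : ℕ) : ℝ) ≤ d := by exact_mod_cast Nat.lt_succ_iff.mp hk
  push_cast at this
  have h0 : (0 : ℝ) ≤ k := k.cast_nonneg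
  exact mul_pos (by linarith) (by linarith)

/-- The eigenvalues of J_z are distinct. -/
theorem eq_diagonal_of_commute_spinZ {d : ℕ} {X : Op (Fin (d + 1))}
    (h : spinZ d * X - X * spinZ d = 0) : X = Matrix.diagonal fun k => X k k := by
  ext i l
  rw [Matrix.diagonal_apply]
  split_ifs with hil
  · rw [hil]
  · have h2 := congrFun (congrFun h i) l
    simp only [spinZ, Matrix.sub_apply, Matrix.diagonal_mul, Matrix.mul_diagonal,
      Matrix.zero_apply] at h2
    have h3 : (((l : ℕ) : ℂ) - ((i : ℕ) : ℂ)) * X i l = 0 := by linear_combination h2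
    refine (mul_eq_zero.mp h3).resolve_left fun h4 => hil ?_
    exact Fin.ext (by exact_mod_cast (sub_eq_zero.mp h4).symm)

/-- Newton interpolation through the first three values, propagated by the recursion. -/
theorem exists_quadratic_of_third_difference (g : ℕ → ℂ) (d : ℕ)
    (h : ∀ k, k + 3 ≤ d → g (k + 3) - 3 * g (k + 2) + 3 * g (k + 1) - g k = 0) :
    ∃ a b c : ℂ, ∀ k ≤ d, g k = a * (k : ℂ) ^ 2 + b * k + c := by
  refine ⟨(g 2 - 2 * g 1 + g 0) / 2, g 1 - g 0 - (g 2 - 2 * g 1 + g 0) / 2, g 0, fun k => ?_⟩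
  induction k using Nat.strong_induction_on with
  | _ k ih =>
    intro hk
    match k, ih, hk with
    | 0, _, _ => simp
    | 1, _, _ => simp
    | 2, _, _ => push_cast; ring
    | k + 3, ih, hk =>
      have h0 := ih k (by omega) (by omega)
      have h1 := ih (k + 1) (by omega) (by omega)
      have h2 := ih (k + 2) (by omega) (by omega)
      have h3 := h k hk
      push_cast at h0 h1 h2 ⊢
      linear_combination h3 + 3 * h2 - 3 * h1 + h0

/-- G_zz commutes with J_z, so it is diagonal. For a tensor of rank at most 2, three commutators
with J₊ annihilate it; the entries of the triple commutator are third differences of the diagonal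
times nonzero entries of J₊. Hence the diagonal is quadratic in the weight. -/
theorem IsTensorOp.exists_quadratic {d : ℕ} {G : Fin 3 → Fin 3 → Op (Fin (d + 1))}
    (hG : IsTensorOp d G) :
    ∃ A B C : ℂ, G 2 2 = A • (spinZ d * spinZ d) + B • spinZ d + C • 1 := by
  obtain ⟨⟨x22, y22, z22⟩, ⟨x02, x12, y02, y12⟩, ⟨x00, x11, x01, y00, y11, y01⟩⟩ := hG.commutators
  have c1 : spinRaise d * G 2 2 - G 2 2 * spinRaise d =
      (-2 : ℂ) • (G 0 2 + Complex.I • G 1 2) := by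
    have : spinRaise d * G 2 2 - G 2 2 * spinRaise d = (spinX d * G 2 2 - G 2 2 * spinX d) +
        Complex.I • (spinY d * G 2 2 - G 2 2 * spinY d) := by
      rw [spinRaise_eq, add_mul, mul_add, smul_mul_assoc, mul_smul_comm, smul_sub]; abel
    rw [this, x22, y22, smul_smul]
    match_scalars <;> first | ring1 | linear_combination 2 * Complex.I_sq
  have c2 : spinRaise d * (G 0 2 + Complex.I • G 1 2) - (G 0 2 + Complex.I • G 1 2) * spinRaise d =
      (-1 : ℂ) • (G 0 0 - G 1 1 + (2 * Complex.I) • G 0 1) := by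
    have : spinRaise d * (G 0 2 + Complex.I • G 1 2) -
        (G 0 2 + Complex.I • G 1 2) * spinRaise d =
        (spinX d * G 0 2 - G 0 2 * spinX d) + Complex.I • (spinX d * G 1 2 - G 1 2 * spinX d) +
        Complex.I • (spinY d * G 0 2 - G 0 2 * spinY d) +
        (Complex.I * Complex.I) • (spinY d * G 1 2 - G 1 2 * spinY d) := by
      simp only [spinRaise_eq, add_mul, mul_add, smul_mul_assoc, mul_smul_comm]
      module
    rw [this, x02, x12, y02, y12, Complex.I_mul_I]
    simp only [smul_smul, Complex.I_mul_I]
    module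
  have c3 : spinRaise d * (G 0 0 - G 1 1 + (2 * Complex.I) • G 0 1) -
      (G 0 0 - G 1 1 + (2 * Complex.I) • G 0 1) * spinRaise d = 0 := by
    have : spinRaise d * (G 0 0 - G 1 1 + (2 * Complex.I) • G 0 1) -
        (G 0 0 - G 1 1 + (2 * Complex.I) • G 0 1) * spinRaise d =
        (spinX d * G 0 0 - G 0 0 * spinX d) - (spinX d * G 1 1 - G 1 1 * spinX d) +
        (2 * Complex.I) • (spinX d * G 0 1 - G 0 1 * spinX d) +
        Complex.I • (spinY d * G 0 0 - G 0 0 * spinY d) -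
        Complex.I • (spinY d * G 1 1 - G 1 1 * spinY d) +
        (2 * (Complex.I * Complex.I)) • (spinY d * G 0 1 - G 0 1 * spinY d) := by
      simp only [spinRaise_eq, add_mul, mul_add, sub_mul, mul_sub, smul_mul_assoc, mul_smul_comm]
      module
    rw [this, x00, x11, x01, y00, y11, y01, Complex.I_mul_I]
    match_scalars <;> ring
  have c4 : spinRaise d * (spinRaise d * (spinRaise d * G 2 2)) -
      (3 : ℂ) • (spinRaise d * (spinRaise d * (G 2 2 * spinRaise d))) +
      (3 : ℂ) • (spinRaise d * (G 2 2 * (spinRaise d * spinRaise d))) -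
      G 2 2 * (spinRaise d * (spinRaise d * spinRaise d)) = 0 := by
    have e1 : G 0 0 - G 1 1 + (2 * Complex.I) • G 0 1 = (-1 : ℂ) •
        (spinRaise d * (G 0 2 + Complex.I • G 1 2) -
        (G 0 2 + Complex.I • G 1 2) * spinRaise d) := by rw [c2]; module
    have e2 : G 0 2 + Complex.I • G 1 2 = (-1 / 2 : ℂ) •
      (spinRaise d * G 2 2 - G 2 2 * spinRaise d) := by rw [c1]; module
    rw [e1, e2] at c3
    rw [← smul_zero (2 : ℂ), ← c3]
    simp only [mul_sub, sub_mul, mul_smul_comm, smul_mul_assoc, Matrix.mul_assoc]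
    module
  have hdiag := eq_diagonal_of_commute_spinZ z22
  -- The value 0 outside the range is never used.
  let g : ℕ → ℂ := fun k => if h : k < d + 1 then G 2 2 ⟨k, h⟩ ⟨k, h⟩ else 0
  obtain ⟨a, b, c, habc⟩ := exists_quadratic_of_third_difference g d (by
    intro k hk
    have h1 : k + 3 < d + 1 := by omega
    have h2 : k + 2 < d + 1 := by omega
    have h3 : k + 1 < d + 1 := by omega
    have h4 : k < d + 1 := by omega
    have h5 := congrFun (congrFun c4 ⟨k, h4⟩) ⟨k + 3, h1⟩
    rw [hdiag] at h5
    simp only [Matrix.sub_apply, Matrix.add_apply, Matrix.smul_apply, smul_eq_mul,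
      Matrix.diagonal_mul, spinRaise_mul_apply d _ k h3, spinRaise_mul_apply d _ (k + 1) h2,
      spinRaise_mul_apply d _ (k + 1 + 1) h1, Matrix.diagonal_apply_eq, Matrix.zero_apply,
      show k + 3 = k + 1 + 1 + 1 from rfl] at h5
    simp only [g, h1, h2, h3, h4, dif_pos]
    have n1 := spinRaise_apply_succ_ne_zero d k h3
    have n2 := spinRaise_apply_succ_ne_zero d (k + 1) h2
    have n3 := spinRaise_apply_succ_ne_zero d (k + 1 + 1) h1
    refine (mul_eq_zero.mp ?_).resolve_left (mul_ne_zero n1 (mul_ne_zero n2 n3))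
    linear_combination h5)
  -- The quadratic in the index k is rewritten in the eigenvalue d/2 - k of J_z.
  refine ⟨a, -2 * a * ((d : ℂ) / 2) - b, a * ((d : ℂ) / 2) ^ 2 + b * ((d : ℂ) / 2) + c, ?_⟩
  rw [hdiag]
  ext i l
  simp only [spinZ, Matrix.diagonal_mul_diagonal, Matrix.add_apply, Matrix.smul_apply,
    smul_eq_mul, Matrix.diagonal_apply, Matrix.one_apply]
  split_ifs with hil
  · have h := habc i (by omega)
    simp only [g, i.isLt, dif_pos] at h
    rw [h]
    ring
  · simp

/-- A symmetric tensor operator is a combination of the spin tensor and the unit tensor. -/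
theorem IsTensorOp.exists_eq {d : ℕ} {G : Fin 3 → Fin 3 → Op (Fin (d + 1))}
    (hG : IsTensorOp d G) :
    ∃ A C : ℂ, ∀ a b, G a b = A • spinTensor d a b + C • (if a = b then 1 else 0) := by
  obtain ⟨A, B, C, h⟩ := hG.exists_quadratic
  refine ⟨A, C, ?_⟩
  let H : Fin 3 → Fin 3 → Op (Fin (d + 1)) := fun a b =>
    G a b + ((-A) • spinTensor d a b + (-C) • (if a = b then 1 else 0))
  have hH : IsTensorOp d H :=
    hG.add (((isTensorOp_spinTensor d).smul (-A)).add ((isTensorOp_one d).smul (-C)))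
  -- Only a linear term is left. The commutators then make the other components proportional to spin
  -- components, which is incompatible with the behaviour of a symmetric tensor unless everything
  -- vanishes.
  have hzz : H 2 2 = B • spinZ d := by
    simp only [H, h, spinTensor, if_true, spinVec, Matrix.cons_val]
    module
  obtain ⟨⟨x22, y22, z22⟩, ⟨x02, x12, y02, y12⟩, ⟨x00, x11, x01, y00, y11, y01⟩⟩ := hH.commutators
  have cancel : ∀ {z : ℂ} {X : Op (Fin (d + 1))}, z • X = 0 → z ≠ 0 → X = 0 :=
    fun h hz => (smul_eq_zero.mp h).resolve_left hz
  have hI := Complex.I_ne_zero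
  have hzx := spin_comm_zx d
  have hyz := spin_comm_yz d
  have hxy := spin_comm_xy d
  have h12 : H 1 2 = (B / 2) • spinY d := by
    have e : spinX d * H 2 2 - H 2 2 * spinX d = (-B * Complex.I) • spinY d := by
      rw [hzz, mul_smul_comm, smul_mul_assoc, ← smul_sub, ← neg_sub (spinZ d * spinX d), hzx]
      module
    rw [e] at x22
    refine sub_eq_zero.mp (cancel (z := -2 * Complex.I) ?_ (by simp))
    rw [smul_sub, ← x22]
    module
  have h02 : H 0 2 = (B / 2) • spinX d := by
    have e : spinY d * H 2 2 - H 2 2 * spinY d = (B * Complex.I) • spinX d := by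
      rw [hzz, mul_smul_comm, smul_mul_assoc, ← smul_sub, hyz]
      module
    rw [e] at y22
    refine sub_eq_zero.mp (cancel (z := 2 * Complex.I) ?_ (by simp))
    rw [smul_sub, ← y22]
    module
  have h01 : H 0 1 = 0 := by
    rw [h12, mul_smul_comm, smul_mul_assoc, sub_self] at y12
    exact cancel y12.symm hI
  have h02' : H 0 2 = 0 := by
    rw [h01, mul_zero, zero_mul, sub_zero] at x01
    exact cancel x01.symm hI
  have h12' : H 1 2 = 0 := by
    rw [h01, mul_zero, zero_mul, sub_zero] at y01
    exact cancel y01.symm (neg_ne_zero.mpr hI)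
  -- From BJ_x = 0 the commutator with J_y gives BJ_z = 0, without deciding whether B or the spin
  -- itself is zero.
  have h22 : H 2 2 = 0 := by
    have hX : B • spinX d = 0 := by
      rw [h02'] at h02
      calc B • spinX d = (2 : ℂ) • (B / 2) • spinX d := by module
        _ = 0 := by rw [← h02, smul_zero]
    have hZ : Complex.I • B • spinZ d = 0 := by
      rw [smul_comm, ← hxy, smul_sub, ← smul_mul_assoc, ← mul_smul_comm, hX]
      simp
    rw [hzz]
    exact cancel hZ hI
  have h11 : H 1 1 = 0 := by
    rw [h12', mul_zero, zero_mul, sub_zero, h22, zero_sub] at x12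
    exact neg_eq_zero.mp (cancel x12.symm hI)
  have h00 : H 0 0 = 0 := by
    rw [h02', mul_zero, zero_mul, sub_zero, h22, sub_zero] at y02
    exact cancel y02.symm hI
  have hall : ∀ a b, H a b = 0 := by
    intro a b
    have h10 : H 1 0 = 0 := by rw [hH.1]; exact h01
    have h20 : H 2 0 = 0 := by rw [hH.1]; exact h02'
    have h21 : H 2 1 = 0 := by rw [hH.1]; exact h12'
    fin_cases a <;> fin_cases b <;> assumption
  intro a b
  have h0 : G a b + ((-A) • spinTensor d a b + (-C) • (if a = b then 1 else 0)) = 0 := hall a b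
  rw [neg_smul, neg_smul, ← neg_add, ← sub_eq_add_neg] at h0
  exact sub_eq_zero.mp h0


/-! ### Contractions that determine the moments -/

theorem sum_spinVec_mul_self (d : ℕ) : ∑ a, spinVec d a * spinVec d a = (casimir d : ℂ) • 1 := by
  rw [← spin_casimir', Fin.sum_univ_three]
  rfl

theorem sum_spinVec_mul_mul (d : ℕ) (b : Fin 3) :
    ∑ a, spinVec d a * (spinVec d b * spinVec d a) = ((casimir d : ℂ) - 1) • spinVec d b := by
  have h : ∀ a, spinVec d a * (spinVec d b * spinVec d a) =
      spinVec d a * spinVec d a * spinVec d b + spinVec d a *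
        (Complex.I • ∑ e, (leviCivita b a e : ℂ) • spinVec d e) := by
    intro a
    rw [← spinVec_commutator]
    noncomm_ring
  simp only [h, Finset.sum_add_distrib, ← Finset.sum_mul, sum_spinVec_mul_self, mul_smul_comm]
  have h2 : ∑ a, Complex.I • (spinVec d a * ∑ e, (leviCivita b a e : ℂ) • spinVec d e) =
      (-1 : ℂ) • spinVec d b := by
    have hxy := spin_comm_xy d
    have hyz := spin_comm_yz d
    have hzx := spin_comm_zx d
    rw [← Finset.smul_sum]
    have h3 : ∑ a, spinVec d a * ∑ e, (leviCivita b a e : ℂ) • spinVec d e =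
        Complex.I • spinVec d b := by
      fin_cases b <;>
        simp only [spinVec, leviCivita, Fin.sum_univ_three, Fin.zero_eta, Fin.mk_one,
          Fin.reduceFinMk, Matrix.cons_val, Fin.val_zero, Fin.val_one, Fin.val_two, Nat.cast_zero,
          Nat.cast_one, Nat.cast_ofNat] <;> norm_num
      · rw [← hyz, sub_eq_add_neg]
      · rw [← hzx]; abel
      · rw [← hxy, sub_eq_add_neg]
    rw [h3, smul_smul, Complex.I_mul_I]
  rw [h2, smul_mul_assoc, one_mul]
  module

theorem sum_spinVec_mul_spinTensor (d : ℕ) (b : Fin 3) :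
    ∑ a, spinVec d a * spinTensor d a b = ((casimir d : ℂ) - 1 / 2) • spinVec d b := by
  have h : ∀ a, spinVec d a * spinTensor d a b = (1 / 2 : ℂ) • (spinVec d a * spinVec d a *
      spinVec d b) + (1 / 2 : ℂ) • (spinVec d a * (spinVec d b * spinVec d a)) := by
    intro a
    rw [spinTensor, mul_smul_comm, mul_add, smul_add, Matrix.mul_assoc]
  simp only [h, Finset.sum_add_distrib, ← Finset.smul_sum, ← Finset.sum_mul,
    sum_spinVec_mul_self, sum_spinVec_mul_mul, smul_mul_assoc, one_mul]
  module

/-- The magnetic quantum number of a basis vector. -/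
def magnetic (d : ℕ) (m : Fin (d + 1)) : ℝ := (d : ℝ) / 2 - (m : ℕ)

theorem sum_dir_mul_rotatedState (d : ℕ) (m : Fin (d + 1)) (ϑ φ : ℝ) (i l : Fin (d + 1)) :
    ∑ a, (dir a ϑ φ : ℂ) * (spinVec d a * rotatedState d m ϑ φ) i l =
      (magnetic d m : ℂ) * rotatedState d m ϑ φ i l := by
  have h := congrFun (congrFun (spinAlong_mul_rotatedState d m ϑ φ) i) l
  rw [spinAlong_eq_sum, Finset.sum_mul, Matrix.sum_apply, Matrix.smul_apply] at h
  simp only [smul_mul_assoc, Matrix.smul_apply, smul_eq_mul] at h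
  rw [h, magnetic]
  push_cast
  rfl

theorem sum_dir_mul_rotatedState' (d : ℕ) (m : Fin (d + 1)) (ϑ φ : ℝ) (i l : Fin (d + 1)) :
    ∑ a, (dir a ϑ φ : ℂ) * (rotatedState d m ϑ φ * spinVec d a) i l =
      (magnetic d m : ℂ) * rotatedState d m ϑ φ i l := by
  have h := congrFun (congrFun (rotatedState_mul_spinAlong d m ϑ φ) i) l
  rw [spinAlong_eq_sum, Finset.mul_sum, Matrix.sum_apply, Matrix.smul_apply] at h
  simp only [mul_smul_comm, Matrix.smul_apply, smul_eq_mul] at h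
  rw [h, magnetic]
  push_cast
  rfl

/-- Contracting an index of the direction with the spin produces J_n next to its own eigenstate,
that is, the number m. -/
theorem sum_spinVec_mul_secondMoment (d : ℕ) (m : Fin (d + 1)) (b : Fin 3) :
    ∑ a, spinVec d a * secondMoment d m a b = (magnetic d m : ℂ) • momentOp d m (dir b) := by
  have hc := continuous_dir
  ext i l
  simp only [Matrix.sum_apply, secondMoment]
  rw [Finset.sum_congr rfl fun a _ => mul_momentOp_apply m i l (spinVec d a) ((hc a).mul (hc b)),
    ← sphereMean_sum, Matrix.smul_apply, momentOp, Matrix.of_apply, smul_eq_mul,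
    ← sphereMean_const_mul]
  · congr 1
    ext ϑ φ
    have h := sum_dir_mul_rotatedState d m ϑ φ i l
    rw [mul_left_comm, ← h, Finset.mul_sum]
    exact Finset.sum_congr rfl fun a _ => by push_cast; ring
  · intro a _
    exact (Complex.continuous_ofReal.comp ((hc a).mul (hc b))).mul
      ((continuous_const.matrix_mul (continuous_rotatedState d m)).matrix_elem i l)

theorem sum_momentOp_mul_spinVec (d : ℕ) (m : Fin (d + 1)) :
    ∑ a, momentOp d m (dir a) * spinVec d a =
      (magnetic d m : ℂ) • momentOp d m (fun _ _ => 1) := by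
  have hc := continuous_dir
  ext i l
  simp only [Matrix.sum_apply]
  rw [Finset.sum_congr rfl fun a _ => momentOp_mul_apply m i l (spinVec d a) (hc a),
    ← sphereMean_sum, Matrix.smul_apply, momentOp, Matrix.of_apply, smul_eq_mul,
    ← sphereMean_const_mul]
  · congr 1
    ext ϑ φ
    rw [sum_dir_mul_rotatedState']
    simp
  · intro a _
    exact (Complex.continuous_ofReal.comp (hc a)).mul
      (((continuous_rotatedState d m).matrix_mul continuous_const).matrix_elem i l)

theorem sum_secondMoment (d : ℕ) (m : Fin (d + 1)) :
    ∑ a, secondMoment d m a a = momentOp d m fun _ _ => 1 := by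
  have h := momentOp_sum m (Finset.univ : Finset (Fin 3)) (fun _ => (1 : ℝ))
    (p := fun a ϑ φ => dir a ϑ φ * dir a ϑ φ) fun a => (continuous_dir a).mul (continuous_dir a)
  simp only [one_mul, sum_dir_mul_dir, Complex.ofReal_one, one_smul] at h
  exact h.symm

theorem trace_momentOp_one (d : ℕ) (m : Fin (d + 1)) :
    (momentOp d m fun _ _ => 1).trace = 1 := by
  simp only [Matrix.trace, Matrix.diag, momentOp, Matrix.of_apply]
  rw [← sphereMean_sum, ← sphereMean_one]
  · congr 1
    ext ϑ φ
    have h := trace_rotatedState d m ϑ φ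
    simp only [Matrix.trace, Matrix.diag] at h
    simp [h]
  · intro i _
    exact continuous_mul_rotatedState m i i (p := fun _ _ => 1) continuous_const

/-- The coefficient of the spin tensor in the second moments. -/
def tensorCoeff (d : ℕ) (m : Fin (d + 1)) : ℝ :=
  2 * (3 * magnetic d m ^ 2 - casimir d) / (((d : ℝ) + 1) * casimir d * (4 * casimir d - 3))

/-- The coefficient of the unit tensor in the second moments. -/
def scalarCoeff (d : ℕ) (m : Fin (d + 1)) : ℝ :=
  (1 / ((d : ℝ) + 1) - tensorCoeff d m * casimir d) / 3

theorem casimir_pos {d : ℕ} (hd : 2 ≤ d) : 0 < casimir d ∧ 0 < 4 * casimir d - 3 := by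
  have : (2 : ℝ) ≤ d := by exact_mod_cast hd
  constructor <;> rw [casimir] <;> nlinarith

/-- Two linear equations determine the two coefficients of the second moments: contracting the
indices with each other gives an average of trace one, and contracting both with the spin gives m².
The first moment appears only multiplied by m, which may be zero. Spin 1/2 is excluded because
4j(j+1) - 3 vanishes there. -/
theorem moments_eq {d : ℕ} (hd : 2 ≤ d) (m : Fin (d + 1)) :
    (∀ a b, secondMoment d m a b = (tensorCoeff d m : ℂ) • spinTensor d a b +
      (scalarCoeff d m : ℂ) • (if a = b then 1 else 0)) ∧
    (momentOp d m fun _ _ => 1) = (1 / ((d : ℂ) + 1)) • 1 ∧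
    ∀ b, (magnetic d m : ℂ) • momentOp d m (dir b) =
      ((magnetic d m ^ 2 / (((d : ℝ) + 1) * casimir d) : ℝ) : ℂ) • spinVec d b := by
  obtain ⟨A, C, h⟩ := (isTensorOp_secondMoment d m).exists_eq
  have hd0 : ((d : ℂ) + 1) ≠ 0 := by exact_mod_cast Nat.succ_ne_zero d
  have hd0' : ((d : ℝ) + 1) ≠ 0 := by positivity
  obtain ⟨hc1, hc2⟩ := casimir_pos hd
  have hc1' : (casimir d : ℂ) ≠ 0 := by exact_mod_cast hc1.ne'
  have h1 : (momentOp d m fun _ _ => 1) = (A * casimir d + 3 * C) • 1 := by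
    rw [← sum_secondMoment]
    simp only [h, if_true, Finset.sum_add_distrib, ← Finset.smul_sum, spinTensor, ← two_smul ℂ,
      sum_spinVec_mul_self]
    simp only [Finset.sum_const, Finset.card_univ, Fintype.card_fin]
    module
  have h2 : ((d : ℂ) + 1) * (A * casimir d + 3 * C) = 1 := by
    have := trace_momentOp_one d m
    rw [h1, Matrix.trace_smul, Matrix.trace_one, Fintype.card_fin, smul_eq_mul] at this
    push_cast at this
    rw [mul_comm]; exact this
  have h3 : ∀ b, (magnetic d m : ℂ) • momentOp d m (dir b) =
      (A * (casimir d - 1 / 2) + C) • spinVec d b := by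
    intro b
    rw [← sum_spinVec_mul_secondMoment]
    simp only [h, mul_add, Finset.sum_add_distrib, mul_smul_comm, ← Finset.smul_sum,
      sum_spinVec_mul_spinTensor, mul_ite, mul_one, mul_zero, Finset.sum_ite_eq',
      Finset.mem_univ, if_true]
    module
  have h4 : (A * (casimir d - 1 / 2) + C) * casimir d * ((d : ℂ) + 1) = (magnetic d m : ℂ) ^ 2 := by
    have e : (magnetic d m : ℂ) • (magnetic d m : ℂ) • momentOp d m (fun _ _ => 1) =
        ((A * (casimir d - 1 / 2) + C) * casimir d) • 1 := by
      rw [← sum_momentOp_mul_spinVec, Finset.smul_sum]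
      simp only [← smul_mul_assoc, h3]
      simp only [smul_mul_assoc, ← Finset.smul_sum, sum_spinVec_mul_self, smul_smul]
    have e2 := congrArg Matrix.trace e
    rw [smul_smul, Matrix.trace_smul, trace_momentOp_one, Matrix.trace_smul, Matrix.trace_one,
      Fintype.card_fin] at e2
    simp only [smul_eq_mul] at e2
    push_cast at e2
    linear_combination -e2
  have hA : A = (tensorCoeff d m : ℂ) := by
    have hc2' : (4 * casimir d - 3 : ℂ) ≠ 0 := by exact_mod_cast hc2.ne'
    rw [tensorCoeff]
    push_cast
    rw [eq_div_iff (mul_ne_zero (mul_ne_zero hd0 hc1') hc2')]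
    linear_combination 6 * h4 - 2 * (casimir d : ℂ) * h2
  have hC : C = (scalarCoeff d m : ℂ) := by
    rw [scalarCoeff]
    push_cast
    rw [← hA]
    field_simp
    linear_combination h2
  refine ⟨fun a b => by rw [h, hA, hC], ?_, fun b => ?_⟩
  · rw [h1]
    congr 1
    rw [eq_div_iff hd0]
    linear_combination h2
  · rw [h3]
    congr 1
    push_cast
    rw [eq_div_iff (mul_ne_zero hd0 hc1')]
    linear_combination h4


/-! Measure-and-operate strategies. -/

theorem traceFst_kronecker_one_mul {ι : Type} [Fintype ι] (P ρ : Op ι) (X : Op (Fin 2)) :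
    traceFst ((P ⊗ₖ (1 : Op (Fin 2))) * (ρ ⊗ₖ X)) = (P * ρ).trace • X := by
  rw [← Matrix.mul_kronecker_mul, one_mul, traceFst_kronecker]

theorem ketBra_eq_sum (ψ : Fin 2 → ℂ) :
    ketBra ψ = ∑ q, ∑ r, (ψ q * star (ψ r)) • Matrix.single q r (1 : ℂ) := by
  ext a b
  fin_cases a <;> fin_cases b <;> simp [ketBra, Matrix.vecMulVec_apply, Fin.sum_univ_two]

/-- The fidelity of a measure-and-operate strategy. -/
theorem gateFidelity_measureAndOperate {ι : Type} [Fintype ι] [DecidableEq ι] {k : ℕ}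
    (P : Fin k → Op ι) (r : Fin k → ℕ) (K : ∀ y, Fin (r y) → Op (Fin 2))
    (hK : ∀ y, ∑ s, (K y s)ᴴ * K y s = 1) (C : Op (ι × Fin 2) → Op (Fin 2))
    (hC : ∀ ρ, C ρ = ∑ y, ∑ s, K y s * traceFst ((P y ⊗ₖ (1 : Op (Fin 2))) * ρ) * (K y s)ᴴ)
    (V : Op (Fin 2)) (hV : V * Vᴴ = 1) (ρ : Op ι) :
    gateFidelity V C ρ =
      ∑ y, (P y * ρ).trace.re * ((2 + ∑ s, ‖(Vᴴ * K y s).trace‖ ^ 2) / 6) := by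
  rw [gateFidelity_of_expansion V C ρ (fun q l => ∑ y, ∑ s, (P y * ρ).trace •
    (K y s * Matrix.single q l (1 : ℂ) * (K y s)ᴴ)) (by
      intro ψ
      rw [hC]
      simp only [traceFst_kronecker_one_mul]
      rw [ketBra_eq_sum]
      simp only [Fin.sum_univ_two, smul_add, mul_add, add_mul, mul_smul_comm, smul_mul_assoc,
        Finset.sum_add_distrib, Finset.smul_sum, smul_smul, mul_comm (P _ * ρ).trace])]
  -- The first pairing only sees that each operation preserves the trace; the second one, below,
  -- gives the squared overlaps of the Kraus operators with V.
  have h1 : ∀ y, ∑ q, (Vᴴ * (∑ s, (P y * ρ).trace • (K y s * Matrix.single q q (1 : ℂ) *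
      (K y s)ᴴ)) * V).trace = (P y * ρ).trace * 2 := by
    intro y
    have e : ∀ q s, Vᴴ * (K y s * Matrix.single q q (1 : ℂ) * (K y s)ᴴ) * V =
        (Vᴴ * K y s) * Matrix.single q q (1 : ℂ) * ((K y s)ᴴ * V) := by
      intro q s; simp only [Matrix.mul_assoc]
    simp only [Finset.mul_sum, Finset.sum_mul, Matrix.trace_sum, mul_smul_comm, smul_mul_assoc,
      Matrix.trace_smul, smul_eq_mul, e]
    rw [Finset.sum_comm]
    simp only [← Finset.mul_sum, sum_trace_mul_single_mul]
    congr 1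
    have e2 : ∀ s, (Vᴴ * K y s * ((K y s)ᴴ * V)).trace = ((K y s)ᴴ * K y s).trace := by
      intro s
      rw [Matrix.trace_mul_comm, Matrix.mul_assoc, ← Matrix.mul_assoc V, hV, one_mul]
    simp only [e2, ← Matrix.trace_sum, hK, Matrix.trace_one, Fintype.card_fin]
    norm_num
  have h2 : ∀ y, ∑ q, ∑ l, (Vᴴ * (∑ s, (P y * ρ).trace • (K y s * Matrix.single q l (1 : ℂ) *
      (K y s)ᴴ)) * V : Op (Fin 2)) q l = (P y * ρ).trace * ((∑ s, ‖(Vᴴ * K y s).trace‖ ^ 2 : ℝ) : ℂ) := by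
    intro y
    have e : ∀ q l s, Vᴴ * (K y s * Matrix.single q l (1 : ℂ) * (K y s)ᴴ) * V =
        (Vᴴ * K y s) * Matrix.single q l (1 : ℂ) * ((K y s)ᴴ * V) := by
      intro q l s; simp only [Matrix.mul_assoc]
    have e2 : ∀ s, ((‖(Vᴴ * K y s).trace‖ ^ 2 : ℝ) : ℂ) =
        ∑ q, ∑ l, ((Vᴴ * K y s) * Matrix.single q l (1 : ℂ) * ((K y s)ᴴ * V) : Op (Fin 2)) q l := by
      intro s
      rw [sum_mul_single_mul_apply, ← Matrix.conjTranspose_conjTranspose V,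
        ← Matrix.conjTranspose_mul, Matrix.conjTranspose_conjTranspose,
        Matrix.trace_conjTranspose, Complex.star_def, Complex.mul_conj, Complex.normSq_eq_norm_sq]
    simp only [Finset.mul_sum, Finset.sum_mul, Matrix.sum_apply, mul_smul_comm, smul_mul_assoc,
      Matrix.smul_apply, smul_eq_mul, e, Complex.ofReal_sum, e2]
    simp only [Fin.sum_univ_two, Finset.sum_add_distrib]
  have h3 : ∑ q, (Vᴴ * (∑ y, ∑ s, (P y * ρ).trace • (K y s * Matrix.single q q (1 : ℂ) *
      (K y s)ᴴ)) * V).trace + ∑ q, ∑ l, (Vᴴ * (∑ y, ∑ s, (P y * ρ).trace •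
        (K y s * Matrix.single q l (1 : ℂ) * (K y s)ᴴ)) * V : Op (Fin 2)) q l =
      ∑ y, (P y * ρ).trace * ((2 + ∑ s, ‖(Vᴴ * K y s).trace‖ ^ 2 : ℝ) : ℂ) := by
    simp only [Complex.ofReal_add, mul_add, Finset.sum_add_distrib, ← h2, Complex.ofReal_ofNat,
      ← h1]
    simp only [Finset.mul_sum Finset.univ (fun y => ∑ s, (P y * ρ).trace • _),
      Finset.sum_mul Finset.univ (fun y => Vᴴ * ∑ s, (P y * ρ).trace • _), Matrix.trace_sum,
      Matrix.sum_apply]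
    simp only [Fin.sum_univ_two, Finset.sum_add_distrib]
  rw [h3, Complex.re_sum, Finset.sum_div]
  refine Finset.sum_congr rfl fun y _ => ?_
  rw [Complex.re_mul_ofReal, mul_div_assoc]

/-! Averages over the sphere of real functions. -/

theorem sphereAverage_eq {f : ℝ → ℝ → ℝ} (hf : Continuous fun p : ℝ × ℝ => f p.1 p.2) :
    sphereAverage f = (sphereMean fun ϑ φ => (f ϑ φ : ℂ)).re := by
  rw [sphereMean_re (Complex.continuous_ofReal.comp hf)]
  simp

theorem sphereAverage_add {f g : ℝ → ℝ → ℝ} (hf : Continuous fun p : ℝ × ℝ => f p.1 p.2)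
    (hg : Continuous fun p : ℝ × ℝ => g p.1 p.2) :
    sphereAverage (fun ϑ φ => f ϑ φ + g ϑ φ) = sphereAverage f + sphereAverage g := by
  rw [sphereAverage_eq (hf.add hg), sphereAverage_eq hf, sphereAverage_eq hg, ← Complex.add_re,
    ← sphereMean_add (Complex.continuous_ofReal.comp hf) (Complex.continuous_ofReal.comp hg)]
  simp only [Complex.ofReal_add]

theorem sphereAverage_const_mul (c : ℝ) (f : ℝ → ℝ → ℝ) :
    sphereAverage (fun ϑ φ => c * f ϑ φ) = c * sphereAverage f := by
  simp only [sphereAverage, mul_assoc, intervalIntegral.integral_const_mul]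
  ring

theorem sphereAverage_sum {η : Type} (s : Finset η) {f : η → ℝ → ℝ → ℝ}
    (hf : ∀ i ∈ s, Continuous fun p : ℝ × ℝ => f i p.1 p.2) :
    sphereAverage (fun ϑ φ => ∑ i ∈ s, f i ϑ φ) = ∑ i ∈ s, sphereAverage (f i) := by
  rw [sphereAverage_eq (continuous_finsetSum _ hf),
    Finset.sum_congr rfl fun i hi => sphereAverage_eq (hf i hi), ← Complex.re_sum,
    ← sphereMean_sum _ fun i hi => Complex.continuous_ofReal.comp (hf i hi)]
  simp only [Complex.ofReal_sum]

theorem sphereAverage_mono {f g : ℝ → ℝ → ℝ} (hf : Continuous fun p : ℝ × ℝ => f p.1 p.2)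
    (hg : Continuous fun p : ℝ × ℝ => g p.1 p.2) (h : ∀ ϑ ∈ Set.Icc 0 Real.pi,
      ∀ φ ∈ Set.Icc 0 (2 * Real.pi), f ϑ φ ≤ g ϑ φ) :
    sphereAverage f ≤ sphereAverage g := by
  have hf' : Continuous fun p : ℝ × ℝ => f p.1 p.2 * Real.sin p.1 := by fun_prop
  have hg' : Continuous fun p : ℝ × ℝ => g p.1 p.2 * Real.sin p.1 := by fun_prop
  refine mul_le_mul_of_nonneg_left ?_ (by positivity)
  refine intervalIntegral.integral_mono_on Real.pi_pos.le
    ((continuous_inner_integral (f := fun ϑ φ => f ϑ φ * Real.sin ϑ) hf' _ _).intervalIntegrable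
      _ _)
    ((continuous_inner_integral (f := fun ϑ φ => g ϑ φ * Real.sin ϑ) hg' _ _).intervalIntegrable
      _ _) fun ϑ hϑ => ?_
  refine intervalIntegral.integral_mono_on (by positivity)
    (Continuous.intervalIntegrable (hf'.comp (Continuous.prodMk_right ϑ)) _ _)
    (Continuous.intervalIntegrable (hg'.comp (Continuous.prodMk_right ϑ)) _ _) fun φ hφ => ?_
  exact mul_le_mul_of_nonneg_right (h ϑ hϑ φ hφ) (Real.sin_nonneg_of_nonneg_of_le_pi hϑ.1 hϑ.2)

/-- The first two Euler angles are the azimuth and the polar angle of the axis; the third one is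
averaged separately. -/
theorem haarAverage_eq {G : ℝ → ℝ → ℝ → ℝ}
    (hG : Continuous fun p : ℝ × ℝ × ℝ => G p.1 p.2.1 p.2.2) :
    haarAverage G = sphereAverage fun ϑ φ =>
      (1 / (2 * Real.pi)) * ∫ γ in (0 : ℝ)..(2 * Real.pi), G φ ϑ γ := by
  have hc : Continuous fun p : ℝ × ℝ => ∫ γ in (0 : ℝ)..(2 * Real.pi), G p.1 p.2 γ :=
    intervalIntegral.continuous_parametric_intervalIntegral_of_continuous'
      (f := fun (p : ℝ × ℝ) γ => G p.1 p.2 γ)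
      (hG.comp (by fun_prop : Continuous fun p : (ℝ × ℝ) × ℝ => (p.1.1, p.1.2, p.2))) _ _
  have hc' : Continuous fun p : ℝ × ℝ =>
      (∫ γ in (0 : ℝ)..(2 * Real.pi), G p.1 p.2 γ) * Real.sin p.2 := by fun_prop
  simp only [haarAverage, sphereAverage, intervalIntegral.integral_mul_const]
  rw [MeasureTheory.intervalIntegral_intervalIntegral_swap]
  · simp only [intervalIntegral.integral_mul_const, intervalIntegral.integral_const_mul, mul_assoc]
    rw [← mul_assoc (1 / (4 * Real.pi))]
    congr 1
    field_simp
    norm_num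
  · exact (hc'.continuousOn.integrableOn_compact
      (isCompact_uIcc.prod isCompact_uIcc)).mono_set
        (Set.prod_mono Set.uIoc_subset_uIcc Set.uIoc_subset_uIcc)


/-! Bounds on the moments. -/

theorem trace_mul_momentOp {d : ℕ} (m : Fin (d + 1)) (Q : Op (Fin (d + 1))) {p : ℝ → ℝ → ℝ}
    (hp : Continuous fun x : ℝ × ℝ => p x.1 x.2) :
    sphereAverage (fun ϑ φ => p ϑ φ * (Q * rotatedState d m ϑ φ).trace.re) =
      (Q * momentOp d m p).trace.re := by
  have hM := continuous_rotatedState d m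
  have hQ : Continuous fun x : ℝ × ℝ => (Q * rotatedState d m x.1 x.2).trace :=
    (continuous_const.matrix_mul hM).matrix_trace
  have h : (Q * momentOp d m p).trace =
      sphereMean fun ϑ φ => (p ϑ φ : ℂ) * (Q * rotatedState d m ϑ φ).trace := by
    simp only [Matrix.trace, Matrix.diag, mul_momentOp_apply m _ _ Q hp]
    rw [← sphereMean_sum]
    · simp only [Finset.mul_sum]
    · intro i _
      exact (Complex.continuous_ofReal.comp hp).mul
        ((continuous_const.matrix_mul hM).matrix_elem i i)
  rw [h, sphereMean_re ((Complex.continuous_ofReal.comp hp).mul hQ)]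
  simp only [Complex.re_ofReal_mul]

theorem continuous_trace_mul_rotatedState {d : ℕ} (m : Fin (d + 1)) (Q : Op (Fin (d + 1))) :
    Continuous fun x : ℝ × ℝ => (Q * rotatedState d m x.1 x.2).trace.re :=
  Complex.continuous_re.comp
    (continuous_const.matrix_mul (continuous_rotatedState d m)).matrix_trace

theorem sphereAverage_trace_mul_rotatedState {d : ℕ} (hd : 2 ≤ d) (m : Fin (d + 1))
    (Q : Op (Fin (d + 1))) :
    sphereAverage (fun ϑ φ => (Q * rotatedState d m ϑ φ).trace.re) =
      Q.trace.re / ((d : ℝ) + 1) := by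
  have h := trace_mul_momentOp m Q (p := fun _ _ => 1) continuous_const
  simp only [one_mul] at h
  have e : (1 / ((d : ℂ) + 1)) = ((1 / ((d : ℝ) + 1) : ℝ) : ℂ) := by push_cast; rfl
  rw [h, (moments_eq hd m).2.1, mul_smul_comm, mul_one, Matrix.trace_smul, smul_eq_mul, e,
    Complex.re_ofReal_mul]
  ring

theorem trace_mul_rotatedState_nonneg {d : ℕ} (m : Fin (d + 1)) {Q : Op (Fin (d + 1))}
    (hQ : Q.PosSemidef) (ϑ φ : ℝ) : 0 ≤ (Q * rotatedState d m ϑ φ).trace.re := by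
  have h : (Q * rotatedState d m ϑ φ).trace =
      ((rotation d φ ϑ 0)ᴴ * Q * rotation d φ ϑ 0) m m := by
    rw [rotatedState, ← Matrix.mul_assoc, Matrix.trace_mul_comm, ← Matrix.mul_assoc,
      ← Matrix.mul_assoc, Matrix.trace_mul_single, MulOpposite.op_one, one_smul]
  rw [h]
  exact (Complex.nonneg_iff.mp ((hQ.conjTranspose_mul_mul_same _).diag_nonneg)).1

theorem exists_eq_smul_dir (u : Fin 3 → ℝ) :
    ∃ r ϑ φ : ℝ, r ^ 2 = ∑ a, u a ^ 2 ∧ ∀ a, u a = r * dir a ϑ φ := by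
  set r := Real.sqrt (∑ a, u a ^ 2) with hr
  have hs : 0 ≤ ∑ a, u a ^ 2 := Finset.sum_nonneg fun a _ => sq_nonneg _
  have hr2 : r ^ 2 = ∑ a, u a ^ 2 := Real.sq_sqrt hs
  have hr0 : 0 ≤ r := Real.sqrt_nonneg _
  rcases hr0.eq_or_lt with h0 | hpos
  · refine ⟨0, 0, 0, by rw [← hr2, ← h0], fun a => ?_⟩
    have : u a ^ 2 ≤ 0 := by
      rw [← h0] at hr2
      calc u a ^ 2 ≤ ∑ a, u a ^ 2 :=
          Finset.single_le_sum (f := fun a => u a ^ 2) (fun b _ => sq_nonneg _) (Finset.mem_univ a)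
        _ = 0 := by rw [← hr2]; ring
    rw [zero_mul]
    exact pow_eq_zero_iff (two_ne_zero) |>.mp (le_antisymm this (sq_nonneg _))
  · have h3 : r ^ 2 = u 0 ^ 2 + u 1 ^ 2 + u 2 ^ 2 := by rw [hr2, Fin.sum_univ_three]
    let z : ℂ := ⟨u 0, u 1⟩
    have hz : ‖z‖ ^ 2 = u 0 ^ 2 + u 1 ^ 2 := by
      rw [← Complex.normSq_eq_norm_sq, Complex.normSq_apply]; ring
    have hle : |u 2| ≤ r := abs_le_of_sq_le_sq (by nlinarith) hr0
    have h1 : -1 ≤ u 2 / r := by rw [le_div_iff₀ hpos]; linarith [(abs_le.mp hle).1]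
    have h2 : u 2 / r ≤ 1 := by rw [div_le_iff₀ hpos]; linarith [(abs_le.mp hle).2]
    have hsin : r * Real.sin (Real.arccos (u 2 / r)) = ‖z‖ := by
      rw [Real.sin_arccos]
      refine (sq_eq_sq₀ (by positivity) (norm_nonneg _)).mp ?_
      have h5 : 0 ≤ 1 - (u 2 / r) ^ 2 := by nlinarith
      have h6 : r ^ 2 * (u 2 / r) ^ 2 = u 2 ^ 2 := by field_simp
      rw [mul_pow, Real.sq_sqrt h5, hz]
      linarith
    refine ⟨r, Real.arccos (u 2 / r), z.arg, hr2, fun a => ?_⟩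
    fin_cases a <;> simp only [dir, Fin.zero_eta, Fin.mk_one, Fin.reduceFinMk, Matrix.cons_val]
    · rw [← mul_assoc, hsin, Complex.norm_mul_cos_arg]
    · rw [← mul_assoc, hsin, Complex.norm_mul_sin_arg]
    · rw [Real.cos_arccos h1 h2]; field_simp

theorem magnetic_sq_le (d : ℕ) (m : Fin (d + 1)) : magnetic d m ^ 2 ≤ ((d : ℝ) / 2) ^ 2 := by
  have h1 : ((m : ℕ) : ℝ) ≤ d := by exact_mod_cast Nat.lt_succ_iff.mp m.isLt
  have h0 : (0 : ℝ) ≤ (m : ℕ) := Nat.cast_nonneg _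
  rw [magnetic]
  nlinarith

/-- Contracting the spin tensor twice with u gives the square of the spin along u. It is unitarily
equivalent to |u|² J_z², with eigenvalues between 0 and j²|u|². -/
theorem trace_mul_spin_sq {d : ℕ} {Q : Op (Fin (d + 1))} (hQ : Q.PosSemidef) (u : Fin 3 → ℝ) :
    0 ≤ (Q * ∑ a, ∑ b, ((u a * u b : ℝ) : ℂ) • spinTensor d a b).trace.re ∧
    (Q * ∑ a, ∑ b, ((u a * u b : ℝ) : ℂ) • spinTensor d a b).trace.re ≤
      ((d : ℝ) / 2) ^ 2 * (∑ a, u a ^ 2) * Q.trace.re := by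
  obtain ⟨r, ϑ, φ, hr, hu⟩ := exists_eq_smul_dir u
  set R := rotation d φ ϑ 0 with hR
  have e1 : ∑ a, ∑ b, ((u a * u b : ℝ) : ℂ) • spinTensor d a b =
      ((r : ℂ) ^ 2) • (R * (spinZ d * spinZ d) * Rᴴ) := by
    have e2 : ∑ a, ∑ b, ((u a * u b : ℝ) : ℂ) • spinTensor d a b =
        ((r : ℂ) ^ 2) • (spinAlong d ϑ φ * spinAlong d ϑ φ) := by
      have h1 : ((r : ℂ) ^ 2) • (spinAlong d ϑ φ * spinAlong d ϑ φ) =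
          ∑ a, ∑ b, ((u a * u b : ℝ) : ℂ) • (spinVec d a * spinVec d b) := by
        rw [spinAlong_eq_sum, Finset.sum_mul_sum, Finset.smul_sum]
        refine Finset.sum_congr rfl fun a _ => ?_
        rw [Finset.smul_sum]
        refine Finset.sum_congr rfl fun b _ => ?_
        rw [hu, hu, smul_mul_smul_comm, smul_smul]
        congr 1
        push_cast
        ring
      have h2 : ∑ a, ∑ b, ((u a * u b : ℝ) : ℂ) • (spinVec d b * spinVec d a) =
          ∑ a, ∑ b, ((u a * u b : ℝ) : ℂ) • (spinVec d a * spinVec d b) := by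
        rw [Finset.sum_comm]
        exact Finset.sum_congr rfl fun a _ => Finset.sum_congr rfl fun b _ => by
          rw [mul_comm (u b)]
      have h3 : ∀ a b, ((u a * u b : ℝ) : ℂ) • spinTensor d a b =
          (1 / 2 : ℂ) • (((u a * u b : ℝ) : ℂ) • (spinVec d a * spinVec d b)) +
          (1 / 2 : ℂ) • (((u a * u b : ℝ) : ℂ) • (spinVec d b * spinVec d a)) := by
        intro a b
        rw [spinTensor, smul_comm, smul_add, smul_add]
      simp only [h3, Finset.sum_add_distrib, ← Finset.smul_sum, h2, h1]
      rw [← add_smul]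
      norm_num
    have e3 : spinAlong d ϑ φ = R * spinZ d * Rᴴ := by
      rw [hR, rotation_mul_spinZ, Matrix.mul_assoc, rotation_mul_conjTranspose, mul_one]
    have e4 : R * spinZ d * Rᴴ * (R * spinZ d * Rᴴ) = R * (spinZ d * spinZ d) * Rᴴ := by
      calc R * spinZ d * Rᴴ * (R * spinZ d * Rᴴ) = R * spinZ d * (Rᴴ * R) * (spinZ d * Rᴴ) := by
            simp only [Matrix.mul_assoc]
        _ = _ := by rw [hR, rotation_conjTranspose_mul, mul_one]; simp only [Matrix.mul_assoc]
    rw [e2, e3, e4]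
  set D := Rᴴ * Q * R with hD
  have hDpos : ∀ k, 0 ≤ (D k k).re := fun k =>
    (Complex.nonneg_iff.mp ((hQ.conjTranspose_mul_mul_same R).diag_nonneg)).1
  have e4 : (Q * ∑ a, ∑ b, ((u a * u b : ℝ) : ℂ) • spinTensor d a b).trace.re =
      r ^ 2 * ∑ k, (D k k).re * magnetic d k ^ 2 := by
    have : (Q * (R * (spinZ d * spinZ d) * Rᴴ)).trace = (D * (spinZ d * spinZ d)).trace := by
      rw [← Matrix.mul_assoc, Matrix.trace_mul_comm, ← Matrix.mul_assoc, ← Matrix.mul_assoc]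
    rw [e1, mul_smul_comm, Matrix.trace_smul, this, smul_eq_mul, ← Complex.ofReal_pow,
      Complex.re_ofReal_mul]
    congr 1
    rw [spinZ, Matrix.diagonal_mul_diagonal, Matrix.trace, Complex.re_sum]
    refine Finset.sum_congr rfl fun k _ => ?_
    rw [Matrix.diag_apply, Matrix.mul_diagonal, ← Complex.re_mul_ofReal, magnetic]
    push_cast
    ring_nf
  have e5 : Q.trace.re = ∑ k, (D k k).re := by
    have : Q.trace = D.trace := by
      rw [hD, Matrix.trace_mul_comm, ← Matrix.mul_assoc, hR, rotation_mul_conjTranspose, one_mul]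
    rw [this, Matrix.trace, Complex.re_sum]
    rfl
  rw [e4, e5, ← hr]
  refine ⟨mul_nonneg (sq_nonneg _)
    (Finset.sum_nonneg fun k _ => mul_nonneg (hDpos k) (sq_nonneg _)), ?_⟩
  rw [mul_comm (((d : ℝ) / 2) ^ 2), mul_assoc, Finset.mul_sum Finset.univ _ (((d : ℝ) / 2) ^ 2)]
  refine mul_le_mul_of_nonneg_left (Finset.sum_le_sum fun k _ => ?_) (sq_nonneg _)
  rw [mul_comm]
  exact mul_le_mul_of_nonneg_right (magnetic_sq_le d k) (hDpos k)

/-- One minus the largest mean square component of the direction, given an outcome of a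
measurement. -/
def directionDeficit (d : ℕ) : ℝ := 4 * ((d : ℝ) + 1) / (((d : ℝ) + 2) * ((d : ℝ) + 3))

/-- The tensor coefficient is increasing in m², so it is estimated by its values at m² = j² and m² =
0. The first bound is an equality at |m| = j, which is where `directionDeficit` comes from; negative
coefficients are controlled by the scalar part alone. -/
theorem tensorCoeff_bounds {d : ℕ} (hd : 5 ≤ d) (m : Fin (d + 1)) :
    tensorCoeff d m * ((d : ℝ) / 2) ^ 2 + scalarCoeff d m ≤
      (1 - directionDeficit d) / ((d : ℝ) + 1) ∧
    (tensorCoeff d m ≤ 0 → scalarCoeff d m ≤ (1 - directionDeficit d) / ((d : ℝ) + 1)) := by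
  have hx : (5 : ℝ) ≤ d := by exact_mod_cast hd
  have hm := magnetic_sq_le d m
  have hm0 := sq_nonneg (magnetic d m)
  have hden : 0 < ((d : ℝ) + 1) * casimir d * (4 * casimir d - 3) := by
    obtain ⟨h1, h2⟩ := casimir_pos (show 2 ≤ d by omega)
    positivity
  have hA1 : tensorCoeff d m ≤ 4 / (((d : ℝ) + 1) * ((d : ℝ) + 2) * ((d : ℝ) + 3)) := by
    rw [tensorCoeff, div_le_div_iff₀ hden (by positivity), casimir]
    have : 2 * (3 * magnetic d m ^ 2 - (d : ℝ) / 2 * (d / 2 + 1)) ≤ (d : ℝ) * (d - 1) := by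
      nlinarith
    calc _ ≤ ((d : ℝ) * (d - 1)) * (((d : ℝ) + 1) * ((d : ℝ) + 2) * ((d : ℝ) + 3)) :=
          mul_le_mul_of_nonneg_right this (by positivity)
      _ = _ := by ring
  have hA2 : -2 / (((d : ℝ) + 1) * (((d : ℝ) - 1) * ((d : ℝ) + 3))) ≤ tensorCoeff d m := by
    have h1 : 0 < ((d : ℝ) + 1) * (((d : ℝ) - 1) * ((d : ℝ) + 3)) := by
      have : (0 : ℝ) < d - 1 := by linarith
      positivity
    rw [tensorCoeff, div_le_div_iff₀ h1 hden, casimir]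
    have : -((d : ℝ) / 2 * (d + 2)) ≤ 2 * (3 * magnetic d m ^ 2 - (d : ℝ) / 2 * (d / 2 + 1)) := by
      nlinarith
    calc _ = -((d : ℝ) / 2 * (d + 2)) * (((d : ℝ) + 1) * (((d : ℝ) - 1) * ((d : ℝ) + 3))) := by ring
      _ ≤ _ := mul_le_mul_of_nonneg_right this h1.le
  have hsub : (0 : ℝ) < d - 1 := by linarith
  constructor
  · have e : tensorCoeff d m * ((d : ℝ) / 2) ^ 2 + scalarCoeff d m =
        1 / (3 * ((d : ℝ) + 1)) + tensorCoeff d m * ((d : ℝ) * (d - 1) / 6) := by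
      rw [scalarCoeff, casimir]; field_simp; ring
    rw [e]
    calc _ ≤ 1 / (3 * ((d : ℝ) + 1)) + 4 / (((d : ℝ) + 1) * ((d : ℝ) + 2) * ((d : ℝ) + 3)) *
          ((d : ℝ) * (d - 1) / 6) := by gcongr
      _ = _ := by rw [directionDeficit]; field_simp; ring
  · intro _
    have e : scalarCoeff d m = 1 / (3 * ((d : ℝ) + 1)) - tensorCoeff d m * ((d : ℝ) * (d + 2) / 12) := by
      rw [scalarCoeff, casimir]; field_simp; ring
    rw [e]
    calc _ ≤ 1 / (3 * ((d : ℝ) + 1)) - -2 / (((d : ℝ) + 1) * (((d : ℝ) - 1) * ((d : ℝ) + 3))) *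
          ((d : ℝ) * (d + 2) / 12) := by gcongr
      _ ≤ _ := by
        rw [directionDeficit, ← sub_nonneg]
        have : (1 - 4 * ((d : ℝ) + 1) / (((d : ℝ) + 2) * ((d : ℝ) + 3))) / ((d : ℝ) + 1) -
            (1 / (3 * ((d : ℝ) + 1)) - -2 / (((d : ℝ) + 1) * (((d : ℝ) - 1) * ((d : ℝ) + 3))) *
          ((d : ℝ) * (d + 2) / 12)) = ((d : ℝ) ^ 2 * (3 * d - 12)) /
            (6 * ((d : ℝ) + 1) * (d + 2) * (d - 1) * (d + 3)) := by
          field_simp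
          ring
        rw [this]
        have : (0 : ℝ) ≤ 3 * d - 12 := by linarith
        positivity

/-- The second moments make the average linear in an expectation of (J·u)², which lies between 0 and
j²|u|² tr Q. The sign of the tensor coefficient decides which end is extremal. -/
theorem sphereAverage_component_sq_le {d : ℕ} (hd : 5 ≤ d) (m : Fin (d + 1))
    {Q : Op (Fin (d + 1))} (hQ : Q.PosSemidef) (u : Fin 3 → ℝ) :
    sphereAverage (fun ϑ φ => (∑ a, dir a ϑ φ * u a) ^ 2 * (Q * rotatedState d m ϑ φ).trace.re) ≤
      (1 - directionDeficit d) * (∑ a, u a ^ 2) * (Q.trace.re / ((d : ℝ) + 1)) := by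
  have hc := continuous_dir
  rw [trace_mul_momentOp m Q (p := fun ϑ φ => (∑ a, dir a ϑ φ * u a) ^ 2) (by fun_prop)]
  have e1 : (momentOp d m fun ϑ φ => (∑ a, dir a ϑ φ * u a) ^ 2) =
      ∑ a, ∑ b, ((u a * u b : ℝ) : ℂ) • secondMoment d m a b := by
    have h := momentOp_sum m (Finset.univ : Finset (Fin 3 × Fin 3)) (fun x => u x.1 * u x.2)
      (p := fun x ϑ φ => dir x.1 ϑ φ * dir x.2 ϑ φ) fun x => (hc x.1).mul (hc x.2)
    rw [Fintype.sum_prod_type] at h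
    rw [← show _ = ∑ a, ∑ b, ((u a * u b : ℝ) : ℂ) • secondMoment d m a b from h]
    congr 1
    ext ϑ φ
    rw [Fintype.sum_prod_type, sq, Finset.sum_mul_sum]
    exact Finset.sum_congr rfl fun a _ => Finset.sum_congr rfl fun b _ => by ring
  have e2 : ∑ a, ∑ b, ((u a * u b : ℝ) : ℂ) • secondMoment d m a b =
      (tensorCoeff d m : ℂ) • (∑ a, ∑ b, ((u a * u b : ℝ) : ℂ) • spinTensor d a b) +
      ((scalarCoeff d m * ∑ a, u a ^ 2 : ℝ) : ℂ) • 1 := by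
    simp only [(moments_eq (show 2 ≤ d by omega) m).1, smul_add, Finset.sum_add_distrib,
      smul_ite, smul_zero, Finset.sum_ite_eq, Finset.mem_univ, if_true]
    congr 1
    · simp only [Finset.smul_sum, smul_smul, mul_comm]
    · simp only [smul_smul, ← Finset.sum_smul]
      congr 1
      push_cast
      rw [Finset.mul_sum]
      exact Finset.sum_congr rfl fun a _ => by ring
  obtain ⟨h1, h2⟩ := trace_mul_spin_sq hQ u
  have hQ0 : 0 ≤ Q.trace.re := (Complex.nonneg_iff.mp hQ.trace_nonneg).1
  have hs : 0 ≤ ∑ a, u a ^ 2 := Finset.sum_nonneg fun a _ => sq_nonneg _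
  obtain ⟨b1, b2⟩ := tensorCoeff_bounds hd m
  rw [e1, e2, mul_add, mul_smul_comm, mul_smul_comm, mul_one, Matrix.trace_add, Matrix.trace_smul,
    Matrix.trace_smul, Complex.add_re, smul_eq_mul, smul_eq_mul, Complex.re_ofReal_mul,
    Complex.re_ofReal_mul]
  set T := (Q * ∑ a, ∑ b, ((u a * u b : ℝ) : ℂ) • spinTensor d a b).trace.re
  set s := ∑ a, u a ^ 2
  have hst : 0 ≤ s * Q.trace.re := mul_nonneg hs hQ0
  have e3 : (1 - directionDeficit d) * s * (Q.trace.re / ((d : ℝ) + 1)) =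
      (1 - directionDeficit d) / ((d : ℝ) + 1) * (s * Q.trace.re) := by ring
  rw [e3]
  rcases le_total (tensorCoeff d m) 0 with hA | hA
  · calc _ ≤ scalarCoeff d m * (s * Q.trace.re) := by nlinarith
      _ ≤ _ := mul_le_mul_of_nonneg_right (b2 hA) hst
  · calc _ ≤ (tensorCoeff d m * ((d : ℝ) / 2) ^ 2 + scalarCoeff d m) * (s * Q.trace.re) := by
          nlinarith [mul_le_mul_of_nonneg_left h2 hA]
      _ ≤ _ := mul_le_mul_of_nonneg_right b1 hst

theorem sphereAverage_normSq_component_le {d : ℕ} (hd : 5 ≤ d) (m : Fin (d + 1))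
    {Q : Op (Fin (d + 1))} (hQ : Q.PosSemidef) (e : Fin 3 → ℂ) :
    sphereAverage (fun ϑ φ =>
        ‖∑ a, (dir a ϑ φ : ℂ) * e a‖ ^ 2 * (Q * rotatedState d m ϑ φ).trace.re) ≤
      (1 - directionDeficit d) * (∑ a, ‖e a‖ ^ 2) * (Q.trace.re / ((d : ℝ) + 1)) := by
  have hc := continuous_dir
  have hQc := continuous_trace_mul_rotatedState m Q
  have h1 := sphereAverage_component_sq_le hd m hQ fun a => (e a).re
  have h2 := sphereAverage_component_sq_le hd m hQ fun a => (e a).im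
  have e1 : ∀ z : ℂ, ‖z‖ ^ 2 = z.re ^ 2 + z.im ^ 2 := by
    intro z; rw [← Complex.normSq_eq_norm_sq, Complex.normSq_apply]; ring
  simp only [e1, Complex.re_sum, Complex.im_sum, Complex.re_ofReal_mul, Complex.im_ofReal_mul,
    add_mul]
  rw [sphereAverage_add (by fun_prop) (by fun_prop), Finset.sum_add_distrib, mul_add, add_mul]
  exact add_le_add h1 h2


/-! The benchmark for learning from a gate. -/

/-- The Pauli matrices, indexed by the axis. -/
def pauliVec : Fin 3 → Op (Fin 2) := ![pauliX, pauliY, pauliZ]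

theorem trace_axisGate_mul_eq_sum (θ ϑ φ : ℝ) (X : Op (Fin 2)) :
    ((axisGate θ ϑ φ)ᴴ * X).trace = Real.cos (θ / 2) * X.trace +
      Complex.I * Real.sin (θ / 2) * ∑ a, (dir a ϑ φ : ℂ) * (pauliVec a * X).trace := by
  rw [trace_axisGate_mul]
  simp only [Fin.sum_univ_three, dir, pauliVec, Matrix.cons_val]
  push_cast
  ring

theorem continuous_trace_axisGate_mul (θ : ℝ) (X : Op (Fin 2)) :
    Continuous fun p : ℝ × ℝ => ((axisGate θ p.1 p.2)ᴴ * X).trace := by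
  simp only [trace_axisGate_mul]
  fun_prop

/-- Parseval's identity for the orthogonal basis of the identity and the Pauli matrices. -/
theorem normSq_trace_add_sum (X : Op (Fin 2)) :
    ‖X.trace‖ ^ 2 + ∑ a, ‖(pauliVec a * X).trace‖ ^ 2 = 2 * (Xᴴ * X).trace.re := by
  simp only [Fin.sum_univ_three, pauliVec, Matrix.cons_val, pauliX, pauliY, pauliZ,
    Matrix.trace_fin_two, Matrix.mul_apply, Fin.sum_univ_two, Matrix.conjTranspose_apply,
    ← Complex.normSq_eq_norm_sq, Complex.normSq_apply, Matrix.of_apply, Matrix.cons_val',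
    Matrix.cons_val_zero, Matrix.cons_val_one, Complex.star_def]
  simp
  ring

/-- Cauchy-Schwarz between the scalar and the Pauli part of X. The unit vector e is the normalized,
in general complex, Pauli part, or any unit vector if that part vanishes. -/
theorem normSq_trace_axisGate_mul_le (X : Op (Fin 2)) :
    ∃ e : Fin 3 → ℂ, ∑ a, ‖e a‖ ^ 2 = 1 ∧ ∀ θ ϑ φ, ‖((axisGate θ ϑ φ)ᴴ * X).trace‖ ^ 2 ≤
      2 * (Xᴴ * X).trace.re * (Real.cos (θ / 2) ^ 2 +
        Real.sin (θ / 2) ^ 2 * ‖∑ a, (dir a ϑ φ : ℂ) * e a‖ ^ 2) := by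
  set T := Real.sqrt (∑ a, ‖(pauliVec a * X).trace‖ ^ 2) with hT
  have hs : 0 ≤ ∑ a, ‖(pauliVec a * X).trace‖ ^ 2 := Finset.sum_nonneg fun a _ => sq_nonneg _
  have hT2 : T ^ 2 = ∑ a, ‖(pauliVec a * X).trace‖ ^ 2 := Real.sq_sqrt hs
  have hT0 : 0 ≤ T := Real.sqrt_nonneg _
  have hex : ∃ e : Fin 3 → ℂ, ∑ a, ‖e a‖ ^ 2 = 1 ∧ ∀ a, (pauliVec a * X).trace = T * e a := by
    rcases hT0.eq_or_lt with h0 | hpos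
    · refine ⟨Pi.single 0 1, by simp [Fin.sum_univ_three], fun a => ?_⟩
      rw [← h0] at hT2
      have h : ‖(pauliVec a * X).trace‖ ^ 2 ≤ 0 := by
        calc _ ≤ ∑ a, ‖(pauliVec a * X).trace‖ ^ 2 := Finset.single_le_sum
              (f := fun a => ‖(pauliVec a * X).trace‖ ^ 2) (fun b _ => sq_nonneg _)
              (Finset.mem_univ a)
          _ = 0 := by rw [← hT2]; ring
      rw [← h0, Complex.ofReal_zero, zero_mul]
      exact norm_eq_zero.mp (pow_eq_zero_iff two_ne_zero |>.mp (le_antisymm h (sq_nonneg _)))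
    · have hc : (T : ℂ) ≠ 0 := by exact_mod_cast hpos.ne'
      refine ⟨fun a => (pauliVec a * X).trace / T, ?_, fun a => by field_simp⟩
      simp only [norm_div, div_pow, ← Finset.sum_div, Complex.norm_real, Real.norm_eq_abs, sq_abs,
        ← hT2]
      exact div_self (by positivity)
  obtain ⟨e, he1, he2⟩ := hex
  refine ⟨e, he1, fun θ ϑ φ => ?_⟩
  rw [trace_axisGate_mul_eq_sum, ← normSq_trace_add_sum, ← hT2]
  simp only [he2, mul_left_comm _ (T : ℂ), ← Finset.mul_sum]
  set x := ∑ a, (dir a ϑ φ : ℂ) * e a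
  set c := Real.cos (θ / 2)
  set s := Real.sin (θ / 2)
  have h1 : ‖(c : ℂ) * X.trace + Complex.I * s * (T * x)‖ ≤
      |c| * ‖X.trace‖ + |s| * ‖x‖ * T := by
    refine (norm_add_le _ _).trans_eq ?_
    simp only [norm_mul, Complex.norm_real, Real.norm_eq_abs, Complex.norm_I, abs_of_nonneg hT0]
    ring
  have h2 : ‖(c : ℂ) * X.trace + Complex.I * s * (T * x)‖ ^ 2 ≤
      (|c| * ‖X.trace‖ + |s| * ‖x‖ * T) ^ 2 := pow_le_pow_left₀ (norm_nonneg _) h1 2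
  rw [mul_left_comm (T : ℂ)]
  refine h2.trans ?_
  rw [← sq_abs c, ← sq_abs s]
  -- The defect in Cauchy-Schwarz is exactly this square, by Lagrange's identity.
  nlinarith [sq_nonneg (|c| * T - |s| * ‖x‖ * ‖X.trace‖)]

theorem sphereAverage_kraus_le {d : ℕ} (hd : 5 ≤ d) (m : Fin (d + 1)) {Q : Op (Fin (d + 1))}
    (hQ : Q.PosSemidef) (θ : ℝ) (X : Op (Fin 2)) :
    sphereAverage (fun ϑ φ => (Q * rotatedState d m ϑ φ).trace.re *
      ‖((axisGate θ ϑ φ)ᴴ * X).trace‖ ^ 2) ≤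
      2 * (Xᴴ * X).trace.re * (1 - Real.sin (θ / 2) ^ 2 * directionDeficit d) *
        (Q.trace.re / ((d : ℝ) + 1)) := by
  obtain ⟨e, he1, he2⟩ := normSq_trace_axisGate_mul_le X
  have hc := continuous_dir
  have hQc := continuous_trace_mul_rotatedState m Q
  have hXc := continuous_trace_axisGate_mul θ X
  have hN : 0 ≤ 2 * (Xᴴ * X).trace.re := by
    rw [← normSq_trace_add_sum]
    exact add_nonneg (sq_nonneg _) (Finset.sum_nonneg fun a _ => sq_nonneg _)
  have h1 := sphereAverage_normSq_component_le hd m hQ e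
  rw [he1, mul_one] at h1
  calc _ ≤ sphereAverage (fun ϑ φ =>
        (2 * (Xᴴ * X).trace.re * Real.cos (θ / 2) ^ 2) * (Q * rotatedState d m ϑ φ).trace.re +
        (2 * (Xᴴ * X).trace.re * Real.sin (θ / 2) ^ 2) *
        (‖∑ a, (dir a ϑ φ : ℂ) * e a‖ ^ 2 * (Q * rotatedState d m ϑ φ).trace.re)) := by
        refine sphereAverage_mono (by fun_prop) (by fun_prop) fun ϑ _ φ _ => ?_
        have h2 := mul_le_mul_of_nonneg_left (he2 θ ϑ φ) (trace_mul_rotatedState_nonneg m hQ ϑ φ)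
        linarith
    _ = (2 * (Xᴴ * X).trace.re * Real.cos (θ / 2) ^ 2) * (Q.trace.re / ((d : ℝ) + 1)) +
        (2 * (Xᴴ * X).trace.re * Real.sin (θ / 2) ^ 2) * sphereAverage (fun ϑ φ =>
        ‖∑ a, (dir a ϑ φ : ℂ) * e a‖ ^ 2 * (Q * rotatedState d m ϑ φ).trace.re) := by
        rw [sphereAverage_add (by fun_prop) (by fun_prop), sphereAverage_const_mul,
          sphereAverage_const_mul, sphereAverage_trace_mul_rotatedState (by omega)]
    _ ≤ _ := by
        have h3 := mul_le_mul_of_nonneg_left h1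
          (mul_nonneg hN (sq_nonneg (Real.sin (θ / 2))))
        have h4 := Real.sin_sq_add_cos_sq (θ / 2)
        have h5 : Real.cos (θ / 2) ^ 2 = 1 - Real.sin (θ / 2) ^ 2 := by linarith
        rw [h5]
        linarith


/-! ### Reduction of an arbitrary probe to rotated weight states -/

theorem integral_exp_int (k : ℤ) :
    ∫ γ in (0 : ℝ)..(2 * Real.pi), Complex.exp (Complex.I * k * γ) =
      if k = 0 then ((2 * Real.pi : ℝ) : ℂ) else 0 := by
  split_ifs with h
  · simp [h]
  · have hk : (Complex.I * k) ≠ 0 := mul_ne_zero Complex.I_ne_zero (by exact_mod_cast h)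
    rw [integral_exp_mul_complex hk]
    have : Complex.exp (Complex.I * k * ((2 * Real.pi : ℝ) : ℂ)) = 1 := by
      rw [Complex.exp_eq_one_iff]
      exact ⟨k, by push_cast; ring⟩
    rw [this]
    simp

/-- The embedding that attaches to a state of the spin the component of `χ` on the `m`-th basis
vector of the spin. -/
def attachComponent {d a : ℕ} (χ : Fin (d + 1) × Fin a → ℂ) (m : Fin (d + 1)) :
    Matrix (Fin (d + 1) × Fin a) (Fin (d + 1)) ℂ :=
  Matrix.of fun x q => if x.1 = q then χ (m, x.2) else 0

/-- The attached auxiliary vector is untouched by rotations of the spin. A POVM on the probe can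
therefore be pulled back to the spin for each weight separately. -/
theorem attachComponent_mul {d a : ℕ} (χ : Fin (d + 1) × Fin a → ℂ) (m : Fin (d + 1))
    (R : Op (Fin (d + 1))) :
    attachComponent χ m * R = (R ⊗ₖ (1 : Op (Fin a))) * attachComponent χ m := by
  ext ⟨i, x⟩ q
  simp only [Matrix.mul_apply, attachComponent, Matrix.of_apply, Fintype.sum_prod_type,
    Matrix.kroneckerMap_apply, Matrix.one_apply, ite_mul, zero_mul, Finset.sum_ite_eq,
    Finset.mem_univ, if_true, mul_ite, mul_one, mul_zero]
  rw [Finset.sum_eq_single q]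
  · simp [mul_comm]
  · intro b _ hb
    simp [hb]
  · simp

theorem trace_attachComponent {d a : ℕ} (χ : Fin (d + 1) × Fin a → ℂ) (m : Fin (d + 1)) :
    ((attachComponent χ m)ᴴ * attachComponent χ m).trace.re =
      ((d : ℝ) + 1) * ∑ x, ‖χ (m, x)‖ ^ 2 := by
  have h : ((attachComponent χ m)ᴴ * attachComponent χ m).trace =
      ((((d : ℝ) + 1) * ∑ x, ‖χ (m, x)‖ ^ 2 : ℝ) : ℂ) := by
    simp only [Matrix.trace, Matrix.diag, Matrix.mul_apply, Matrix.conjTranspose_apply,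
      attachComponent, Matrix.of_apply, Fintype.sum_prod_type]
    have e : ∀ q : Fin (d + 1), ∑ i, ∑ x, star (if i = q then χ (m, x) else 0) *
        (if i = q then χ (m, x) else 0) = ((∑ x, ‖χ (m, x)‖ ^ 2 : ℝ) : ℂ) := by
      intro q
      rw [Finset.sum_eq_single q]
      · push_cast
        refine Finset.sum_congr rfl fun x _ => ?_
        rw [if_pos rfl, Complex.star_def, mul_comm, Complex.mul_conj, Complex.normSq_eq_norm_sq]
        push_cast
        rfl
      · intro b _ hb
        simp [hb]
      · simp
    rw [Finset.sum_congr rfl fun q _ => e q]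
    simp
  rw [h, Complex.ofReal_re]

theorem trace_attachComponent_rotatedState {d a : ℕ} (χ : Fin (d + 1) × Fin a → ℂ)
    (m : Fin (d + 1)) (P : Op (Fin (d + 1) × Fin a)) (ϑ φ : ℝ) :
    (((attachComponent χ m)ᴴ * P * attachComponent χ m) * rotatedState d m ϑ φ).trace =
      ∑ x, ∑ y, star (χ (m, x)) * ((rotation d φ ϑ 0 ⊗ₖ (1 : Op (Fin a)))ᴴ * P *
        (rotation d φ ϑ 0 ⊗ₖ (1 : Op (Fin a)))) (m, x) (m, y) * χ (m, y) := by
  set R := rotation d φ ϑ 0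
  have h : (((attachComponent χ m)ᴴ * P * attachComponent χ m) * rotatedState d m ϑ φ).trace =
      ((attachComponent χ m)ᴴ * ((R ⊗ₖ (1 : Op (Fin a)))ᴴ * P * (R ⊗ₖ (1 : Op (Fin a)))) *
        attachComponent χ m) m m := by
    have e := congrArg Matrix.conjTranspose (attachComponent_mul χ m R)
    rw [Matrix.conjTranspose_mul, Matrix.conjTranspose_mul] at e
    have e2 : (attachComponent χ m)ᴴ * ((R ⊗ₖ (1 : Op (Fin a)))ᴴ * P * (R ⊗ₖ (1 : Op (Fin a)))) *
        attachComponent χ m = Rᴴ * ((attachComponent χ m)ᴴ * P * attachComponent χ m) * R := by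
      calc _ = ((attachComponent χ m)ᴴ * (R ⊗ₖ (1 : Op (Fin a)))ᴴ) * P *
          ((R ⊗ₖ (1 : Op (Fin a))) * attachComponent χ m) := by simp only [Matrix.mul_assoc]
        _ = _ := by rw [← e, ← attachComponent_mul]; simp only [Matrix.mul_assoc]
    rw [e2, rotatedState, ← Matrix.mul_assoc, Matrix.trace_mul_comm, ← Matrix.mul_assoc,
      ← Matrix.mul_assoc, Matrix.trace_mul_single, MulOpposite.op_one, one_smul]
  rw [h]
  generalize (R ⊗ₖ (1 : Op (Fin a)))ᴴ * P * (R ⊗ₖ (1 : Op (Fin a))) = P'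
  rw [Matrix.mul_assoc]
  simp only [Matrix.mul_apply, attachComponent, Matrix.of_apply, Matrix.conjTranspose_apply,
    Fintype.sum_prod_type]
  rw [Finset.sum_eq_single m]
  · refine Finset.sum_congr rfl fun x _ => ?_
    rw [if_pos rfl, Finset.sum_eq_single m]
    · rw [Finset.mul_sum]
      exact Finset.sum_congr rfl fun y _ => by rw [if_pos rfl, mul_assoc]
    · intro b _ hb
      simp [hb]
    · simp
  · intro b _ hb
    simp [hb]
  · simp

theorem trace_mul_ketBra {ι : Type} [Fintype ι] (P : Op ι) (v : ι → ℂ) :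
    (P * ketBra v).trace = ∑ x, ∑ y, star (v x) * P x y * v y := by
  simp only [Matrix.trace, Matrix.diag, Matrix.mul_apply, ketBra, Matrix.vecMulVec_apply,
    Pi.star_apply]
  exact Finset.sum_congr rfl fun x _ => Finset.sum_congr rfl fun y _ => by ring

/-- Averaging over the last Euler angle removes the coherences of the input state. -/
theorem integral_trace_mul_ketBra_rotation {d a : ℕ} (χ : Fin (d + 1) × Fin a → ℂ)
    (P : Op (Fin (d + 1) × Fin a)) (ϑ φ : ℝ) :
    ∫ γ in (0 : ℝ)..(2 * Real.pi),
      (P * ketBra ((rotation d φ ϑ γ ⊗ₖ (1 : Op (Fin a))) *ᵥ χ)).trace =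
      (2 * Real.pi : ℝ) * ∑ m, (((attachComponent χ m)ᴴ * P * attachComponent χ m) *
        rotatedState d m ϑ φ).trace := by
  set R := rotation d φ ϑ 0 with hR
  set P' := (R ⊗ₖ (1 : Op (Fin a)))ᴴ * P * (R ⊗ₖ (1 : Op (Fin a))) with hP'
  -- The last Euler angle enters only through phases given by differences of weights, so the
  -- integral keeps the terms with equal weights.
  have h1 : ∀ γ : ℝ, (P * ketBra ((rotation d φ ϑ γ ⊗ₖ (1 : Op (Fin a))) *ᵥ χ)).trace =
      ∑ x : Fin (d + 1) × Fin a, ∑ y : Fin (d + 1) × Fin a, (star (χ x) * P' x y * χ y) *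
        Complex.exp (Complex.I * (((y.1 : ℕ) : ℤ) - ((x.1 : ℕ) : ℤ) : ℤ) * γ) := by
    intro γ
    have e1 : rotation d φ ϑ γ ⊗ₖ (1 : Op (Fin a)) = (R ⊗ₖ (1 : Op (Fin a))) *
        ((NormedSpace.exp ((-(Complex.I * (γ : ℂ))) • spinZ d)) ⊗ₖ (1 : Op (Fin a))) := by
      rw [rotation_eq_mul, ← Matrix.mul_kronecker_mul, one_mul]
    rw [e1, ← Matrix.mulVec_mulVec, ketBra_mulVec, ← Matrix.mul_assoc, Matrix.trace_mul_comm,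
      ← Matrix.mul_assoc, ← Matrix.mul_assoc, ← hP', trace_mul_ketBra]
    have e2 : ∀ x : Fin (d + 1) × Fin a,
        (((NormedSpace.exp ((-(Complex.I * (γ : ℂ))) • spinZ d)) ⊗ₖ (1 : Op (Fin a))) *ᵥ χ) x =
        Complex.exp (-(Complex.I * (γ : ℂ)) * ((d : ℂ) / 2 - (x.1 : ℕ))) * χ x := by
      intro x
      rw [exp_smul_spinZ, ← Matrix.diagonal_one, Matrix.diagonal_kronecker_diagonal,
        Matrix.mulVec_diagonal, mul_one]
    refine Finset.sum_congr rfl fun x _ => Finset.sum_congr rfl fun y _ => ?_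
    rw [e2, e2, star_mul', Complex.star_def, ← Complex.exp_conj]
    have e3 : (starRingEnd ℂ) (-(Complex.I * (γ : ℂ)) * ((d : ℂ) / 2 - (x.1 : ℕ))) =
        Complex.I * γ * ((d : ℂ) / 2 - (x.1 : ℕ)) := by
      simp only [map_mul, map_neg, map_sub, map_div₀, Complex.conj_I, Complex.conj_ofReal,
        map_natCast, map_ofNat]
      ring
    have e4 : Complex.exp (Complex.I * (((y.1 : ℕ) : ℤ) - ((x.1 : ℕ) : ℤ) : ℤ) * γ) =
        Complex.exp (Complex.I * γ * ((d : ℂ) / 2 - (x.1 : ℕ))) *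
        Complex.exp (-(Complex.I * (γ : ℂ)) * ((d : ℂ) / 2 - (y.1 : ℕ))) := by
      rw [← Complex.exp_add]
      congr 1
      push_cast
      ring
    rw [e3, e4]
    ring
  simp only [h1]
  rw [intervalIntegral.integral_finsetSum]
  · have h2 : ∀ x : Fin (d + 1) × Fin a, ∫ γ in (0 : ℝ)..(2 * Real.pi),
        ∑ y : Fin (d + 1) × Fin a, (star (χ x) * P' x y * χ y) *
        Complex.exp (Complex.I * (((y.1 : ℕ) : ℤ) - ((x.1 : ℕ) : ℤ) : ℤ) * γ) =
        (2 * Real.pi : ℝ) * ∑ z, star (χ x) * P' x (x.1, z) * χ (x.1, z) := by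
      intro x
      rw [intervalIntegral.integral_finsetSum]
      · simp only [intervalIntegral.integral_const_mul, integral_exp_int, Fintype.sum_prod_type]
        rw [Finset.sum_eq_single x.1]
        · rw [Finset.mul_sum]
          refine Finset.sum_congr rfl fun z _ => ?_
          rw [if_pos (sub_self _), mul_comm]
        · intro b _ hb
          refine Finset.sum_eq_zero fun z _ => ?_
          rw [if_neg, mul_zero]
          intro h
          exact hb (Fin.ext (by omega))
        · simp
      · intro y _
        exact Continuous.intervalIntegrable (by fun_prop) _ _
    rw [Finset.sum_congr rfl fun x _ => h2 x, ← Finset.mul_sum, Fintype.sum_prod_type]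
    simp only [trace_attachComponent_rotatedState, ← hR, ← hP']
  · intro x _
    exact Continuous.intervalIntegrable (by fun_prop) _ _

theorem continuous_rotation_euler (d : ℕ) :
    Continuous fun p : ℝ × ℝ × ℝ => rotation d p.1 p.2.1 p.2.2 := by
  simp only [rotation]
  exact (((continuous_exp_smul (spinZ d)).comp continuous_fst).matrix_mul
    ((continuous_exp_smul (spinY d)).comp (continuous_fst.comp continuous_snd))).matrix_mul
    ((continuous_exp_smul (spinZ d)).comp (continuous_snd.comp continuous_snd))

theorem continuous_ketBra_rotation {d a : ℕ} (χ : Fin (d + 1) × Fin a → ℂ) :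
    Continuous fun p : ℝ × ℝ × ℝ =>
      ketBra ((rotation d p.1 p.2.1 p.2.2 ⊗ₖ (1 : Op (Fin a))) *ᵥ χ) := by
  have h : Continuous fun p : ℝ × ℝ × ℝ => rotation d p.1 p.2.1 p.2.2 ⊗ₖ (1 : Op (Fin a)) := by
    refine continuous_matrix fun i l => ?_
    simp only [Matrix.kroneckerMap_apply]
    exact ((continuous_rotation_euler d).matrix_elem _ _).mul continuous_const
  have h2 : Continuous fun p : ℝ × ℝ × ℝ =>
      (rotation d p.1 p.2.1 p.2.2 ⊗ₖ (1 : Op (Fin a))) *ᵥ χ := h.matrix_mulVec continuous_const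
  exact h2.matrix_vecMulVec (continuous_star.comp h2)

theorem haarAverage_trace_mul {d a : ℕ} (χ : Fin (d + 1) × Fin a → ℂ) {k : ℕ}
    (P : Fin k → Op (Fin (d + 1) × Fin a)) {w : Fin k → ℝ → ℝ → ℝ}
    (hw : ∀ y, Continuous fun p : ℝ × ℝ => w y p.1 p.2) :
    haarAverage (fun α β γ => ∑ y,
      (P y * ketBra ((rotation d α β γ ⊗ₖ (1 : Op (Fin a))) *ᵥ χ)).trace.re * w y β α) =
    ∑ y, ∑ m, sphereAverage fun ϑ φ => (((attachComponent χ m)ᴴ * P y * attachComponent χ m) *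
        rotatedState d m ϑ φ).trace.re * w y ϑ φ := by
  have hk := continuous_ketBra_rotation χ
  have hT : ∀ y, Continuous fun p : ℝ × ℝ × ℝ =>
      (P y * ketBra ((rotation d p.1 p.2.1 p.2.2 ⊗ₖ (1 : Op (Fin a))) *ᵥ χ)).trace :=
    fun y => (continuous_const.matrix_mul hk).matrix_trace
  have hT' : ∀ y ϑ φ, Continuous fun γ : ℝ =>
      (P y * ketBra ((rotation d φ ϑ γ ⊗ₖ (1 : Op (Fin a))) *ᵥ χ)).trace := by
    intro y ϑ φ
    have h := hk.comp (by fun_prop : Continuous fun γ : ℝ => (φ, ϑ, γ))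
    exact (continuous_const.matrix_mul h).matrix_trace
  have hw' : ∀ y, Continuous fun p : ℝ × ℝ × ℝ => w y p.2.1 p.1 :=
    fun y => (hw y).comp (by fun_prop : Continuous fun p : ℝ × ℝ × ℝ => (p.2.1, p.1))
  rw [haarAverage_eq (continuous_finsetSum _ fun y _ =>
    (Complex.continuous_re.comp (hT y)).mul (hw' y))]
  have h1 : ∀ y ϑ φ, ∫ γ in (0 : ℝ)..(2 * Real.pi),
      (P y * ketBra ((rotation d φ ϑ γ ⊗ₖ (1 : Op (Fin a))) *ᵥ χ)).trace.re =
      (2 * Real.pi) * ∑ m, (((attachComponent χ m)ᴴ * P y * attachComponent χ m) *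
        rotatedState d m ϑ φ).trace.re := by
    intro y ϑ φ
    have h2 := (Complex.reCLM.intervalIntegral_comp_comm
      ((hT' y ϑ φ).intervalIntegrable (μ := MeasureTheory.volume) 0 (2 * Real.pi)))
    simp only [Complex.reCLM_apply] at h2
    rw [h2, integral_trace_mul_ketBra_rotation, Complex.re_ofReal_mul, Complex.re_sum]
  have h3 : ∀ ϑ φ, (1 / (2 * Real.pi)) * ∫ γ in (0 : ℝ)..(2 * Real.pi), ∑ y,
      (P y * ketBra ((rotation d φ ϑ γ ⊗ₖ (1 : Op (Fin a))) *ᵥ χ)).trace.re * w y ϑ φ =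
      ∑ y, ∑ m, (((attachComponent χ m)ᴴ * P y * attachComponent χ m) *
        rotatedState d m ϑ φ).trace.re * w y ϑ φ := by
    intro ϑ φ
    rw [intervalIntegral.integral_finsetSum (f := fun y γ =>
      (P y * ketBra ((rotation d φ ϑ γ ⊗ₖ (1 : Op (Fin a))) *ᵥ χ)).trace.re * w y ϑ φ) fun y _ =>
      (((Complex.continuous_re.comp (hT' y ϑ φ)).mul continuous_const).intervalIntegrable _ _)]
    simp only [intervalIntegral.integral_mul_const, h1, Finset.mul_sum]
    refine Finset.sum_congr rfl fun y _ => ?_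
    rw [Finset.sum_mul, Finset.mul_sum]
    refine Finset.sum_congr rfl fun m _ => ?_
    field_simp
  simp only [h3]
  have hQ : ∀ y m, Continuous fun p : ℝ × ℝ =>
      (((attachComponent χ m)ᴴ * P y * attachComponent χ m) *
        rotatedState d m p.1 p.2).trace.re * w y p.1 p.2 :=
    fun y m => (continuous_trace_mul_rotatedState m _).mul (hw y)
  rw [sphereAverage_sum _ fun y _ => continuous_finsetSum _ fun m _ => hQ y m]
  exact Finset.sum_congr rfl fun y _ => sphereAverage_sum _ fun m _ => hQ y m

theorem IsMeasureAndOperate.exists_kraus {ι : Type} [Fintype ι] [DecidableEq ι]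
    {C : Op (ι × Fin 2) → Op (Fin 2)} (hC : IsMeasureAndOperate C) :
    ∃ (k : ℕ) (P : Fin k → Op ι) (r : Fin k → ℕ) (K : ∀ y, Fin (r y) → Op (Fin 2)),
      (∀ y, (P y).PosSemidef) ∧ ∑ y, P y = 1 ∧ (∀ y, ∑ s, (K y s)ᴴ * K y s = 1) ∧
      ∀ ρ, C ρ = ∑ y, ∑ s, K y s * traceFst ((P y ⊗ₖ (1 : Op (Fin 2))) * ρ) * (K y s)ᴴ := by
  obtain ⟨k, P, O, hP, hP1, hO, hCO⟩ := hC
  choose r K hK hOK using hO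
  exact ⟨k, P, r, K, hP, hP1, hK, fun ρ => by rw [hCO]; simp only [hOK]⟩

theorem isMeasureAndOperate_of_kraus {ι : Type} [Fintype ι] [DecidableEq ι] {k : ℕ}
    {P : Fin k → Op ι} {r : Fin k → ℕ} {K : ∀ y, Fin (r y) → Op (Fin 2)}
    (hP : ∀ y, (P y).PosSemidef) (hP1 : ∑ y, P y = 1) (hK : ∀ y, ∑ s, (K y s)ᴴ * K y s = 1) :
    IsMeasureAndOperate fun ρ =>
      ∑ y, ∑ s, K y s * traceFst ((P y ⊗ₖ (1 : Op (Fin 2))) * ρ) * (K y s)ᴴ :=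
  ⟨k, P, fun y X => ∑ s, K y s * X * (K y s)ᴴ, hP, hP1,
    fun y => ⟨r y, K y, hK y, fun _ => rfl⟩, fun _ => rfl⟩

theorem continuous_kraus_weight (θ : ℝ) {r : ℕ} (K : Fin r → Op (Fin 2)) :
    Continuous fun p : ℝ × ℝ =>
      (2 + ∑ s, ‖((axisGate θ p.1 p.2)ᴴ * K s).trace‖ ^ 2) / 6 := by
  have := fun s => continuous_trace_axisGate_mul θ (K s)
  fun_prop

theorem gateLearningFidelity_eq {d a : ℕ} (θ : ℝ) (χ : Fin (d + 1) × Fin a → ℂ) {k : ℕ}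
    (P : Fin k → Op (Fin (d + 1) × Fin a)) (r : Fin k → ℕ) (K : ∀ y, Fin (r y) → Op (Fin 2))
    (hK : ∀ y, ∑ s, (K y s)ᴴ * K y s = 1) (C : Op ((Fin (d + 1) × Fin a) × Fin 2) → Op (Fin 2))
    (hC : ∀ ρ, C ρ = ∑ y, ∑ s, K y s * traceFst ((P y ⊗ₖ (1 : Op (Fin 2))) * ρ) * (K y s)ᴴ) :
    gateLearningFidelity d a θ χ C =
      ∑ y, ∑ m, sphereAverage fun ϑ φ => (((attachComponent χ m)ᴴ * P y * attachComponent χ m) *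
        rotatedState d m ϑ φ).trace.re *
          ((2 + ∑ s, ‖((axisGate θ ϑ φ)ᴴ * K y s).trace‖ ^ 2) / 6) := by
  have hF : ∀ α β γ, gateFidelity (rotatedGate θ α β γ) C
      (ketBra ((rotation d α β γ ⊗ₖ (1 : Op (Fin a))) *ᵥ χ)) =
      ∑ y, (P y * ketBra ((rotation d α β γ ⊗ₖ (1 : Op (Fin a))) *ᵥ χ)).trace.re *
        ((2 + ∑ s, ‖((axisGate θ β α)ᴴ * K y s).trace‖ ^ 2) / 6) := by
    intro α β γ
    rw [rotatedGate_eq_axisGate]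
    exact gateFidelity_measureAndOperate P r K hK C hC _ (axisGate_mul_conjTranspose θ β α) _
  simp only [gateLearningFidelity, hF]
  exact haarAverage_trace_mul χ P
    (w := fun y ϑ φ => (2 + ∑ s, ‖((axisGate θ ϑ φ)ᴴ * K y s).trace‖ ^ 2) / 6)
    fun y => continuous_kraus_weight θ (K y)

/-- Every pair of an outcome and a weight is bounded separately, with the pulled-back operator Q in
place of the POVM element. The Kraus operators of an outcome contribute Σ tr K†K = 2, and the
weights tr Q/(d + 1) sum to 1 because χ is a unit vector. -/
theorem gateLearningFidelity_le {d : ℕ} (hd : 5 ≤ d) {a : ℕ} (θ : ℝ)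
    (χ : Fin (d + 1) × Fin a → ℂ) (hχ : ∑ i, ‖χ i‖ ^ 2 = 1)
    (C : Op ((Fin (d + 1) × Fin a) × Fin 2) → Op (Fin 2)) (hC : IsMeasureAndOperate C) :
    gateLearningFidelity d a θ χ C ≤
      1 / 3 + 2 / 3 * (1 - Real.sin (θ / 2) ^ 2 * directionDeficit d) := by
  obtain ⟨k, P, r, K, hP, hP1, hK, hCK⟩ := hC.exists_kraus
  have hd1 : (0 : ℝ) < (d : ℝ) + 1 := by positivity
  have hKc := fun y s => continuous_trace_axisGate_mul θ (K y s)
  rw [gateLearningFidelity_eq θ χ P r K hK C hCK]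
  set κ := 1 - Real.sin (θ / 2) ^ 2 * directionDeficit d
  let Q := fun y m => (attachComponent χ m)ᴴ * P y * attachComponent χ m
  have hQ : ∀ y m, (Q y m).PosSemidef := fun y m => (hP y).conjTranspose_mul_mul_same _
  have h1 : ∀ y m, sphereAverage (fun ϑ φ => (Q y m * rotatedState d m ϑ φ).trace.re *
      ((2 + ∑ s, ‖((axisGate θ ϑ φ)ᴴ * K y s).trace‖ ^ 2) / 6)) ≤
      (1 / 3 + 2 / 3 * κ) * ((Q y m).trace.re / ((d : ℝ) + 1)) := by
    intro y m
    have hQc := continuous_trace_mul_rotatedState m (Q y m)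
    have e1 : ∀ ϑ φ, (Q y m * rotatedState d m ϑ φ).trace.re *
      ((2 + ∑ s, ‖((axisGate θ ϑ φ)ᴴ * K y s).trace‖ ^ 2) / 6) =
        1 / 3 * (Q y m * rotatedState d m ϑ φ).trace.re + ∑ s, 1 / 6 *
        ((Q y m * rotatedState d m ϑ φ).trace.re * ‖((axisGate θ ϑ φ)ᴴ * K y s).trace‖ ^ 2) := by
      intro ϑ φ
      rw [← Finset.mul_sum, ← Finset.mul_sum]
      ring
    have hs : ∀ s, Continuous fun p : ℝ × ℝ => 1 / 6 * ((Q y m * rotatedState d m p.1 p.2).trace.re *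
        ‖((axisGate θ p.1 p.2)ᴴ * K y s).trace‖ ^ 2) := by
      intro s
      have := hKc y s
      fun_prop
    simp only [e1]
    rw [sphereAverage_add (by fun_prop) (continuous_finsetSum _ fun s _ => hs s),
      sphereAverage_const_mul, sphereAverage_trace_mul_rotatedState (by omega),
      sphereAverage_sum _ fun s _ => hs s]
    simp only [sphereAverage_const_mul]
    have e2 : ∑ s, 2 * ((K y s)ᴴ * K y s).trace.re * κ * ((Q y m).trace.re / ((d : ℝ) + 1)) =
        4 * κ * ((Q y m).trace.re / ((d : ℝ) + 1)) := by
      rw [← Finset.sum_mul, ← Finset.sum_mul, ← Finset.mul_sum, ← Complex.re_sum,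
        ← Matrix.trace_sum, hK, Matrix.trace_one, Fintype.card_fin, Complex.natCast_re]
      push_cast
      ring
    have e3 : ∑ s, 1 / 6 * sphereAverage (fun ϑ φ => (Q y m * rotatedState d m ϑ φ).trace.re *
        ‖((axisGate θ ϑ φ)ᴴ * K y s).trace‖ ^ 2) ≤
        1 / 6 * (4 * κ * ((Q y m).trace.re / ((d : ℝ) + 1))) := by
      rw [← e2, ← Finset.mul_sum]
      exact mul_le_mul_of_nonneg_left
        (Finset.sum_le_sum fun s _ => sphereAverage_kraus_le hd m (hQ y m) θ (K y s)) (by norm_num)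
    linarith
  have h2 : ∑ y, ∑ m, (Q y m).trace.re / ((d : ℝ) + 1) = 1 := by
    rw [Finset.sum_comm]
    have e1 : ∀ m, ∑ y, (Q y m).trace.re / ((d : ℝ) + 1) = ∑ x, ‖χ (m, x)‖ ^ 2 := by
      intro m
      rw [← Finset.sum_div, ← Complex.re_sum, ← Matrix.trace_sum]
      simp only [Q]
      rw [← Matrix.sum_mul, ← Matrix.mul_sum, hP1, Matrix.mul_one, trace_attachComponent]
      field_simp
    simp only [e1]
    rw [← hχ, Fintype.sum_prod_type]
  calc _ ≤ ∑ y, ∑ m, (1 / 3 + 2 / 3 * κ) * ((Q y m).trace.re / ((d : ℝ) + 1)) :=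
        Finset.sum_le_sum fun y _ => Finset.sum_le_sum fun m _ => h1 y m
    _ = _ := by simp only [← Finset.mul_sum]; rw [h2, mul_one]


/-! Finite measurements from averages over the sphere. -/

/-- By Carathéodory's theorem the hull is the continuous image of a simplex times a power of the
set. Unused slots receive weight zero and the point `x₀`. -/
theorem isCompact_convexHull_of_isCompact {E : Type} [NormedAddCommGroup E] [NormedSpace ℝ E]
    [FiniteDimensional ℝ E] {s : Set E} (hs : IsCompact s) : IsCompact (convexHull ℝ s) := by
  rcases s.eq_empty_or_nonempty with rfl | ⟨x₀, hx₀⟩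
  · simp
  set N := Module.finrank ℝ E + 1
  have hK : IsCompact ((stdSimplex ℝ (Fin N)) ×ˢ (Set.univ.pi fun _ : Fin N => s)) :=
    (isCompact_stdSimplex ℝ (Fin N)).prod (isCompact_univ_pi fun _ => hs)
  have hΦ : Continuous fun x : (Fin N → ℝ) × (Fin N → E) => ∑ i, x.1 i • x.2 i := by fun_prop
  convert hK.image hΦ using 1
  ext x
  constructor
  · intro hx
    obtain ⟨ι, _, z, w, hz, hai, hw, hw1, hx⟩ := eq_pos_convex_span_of_mem_convexHull hx
    have hcard : Fintype.card ι ≤ Fintype.card (Fin N) := by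
      rw [Fintype.card_fin]
      exact hai.card_le_finrank_succ.trans
        (Nat.succ_le_succ (Submodule.finrank_le _))
    obtain ⟨e⟩ := Function.Embedding.nonempty_of_card_le hcard
    have hout : ∀ i ∉ Set.range e, Function.extend e w 0 i = 0 := fun i hi => by
      rw [Function.extend_apply' _ _ _ fun ⟨a, ha⟩ => hi ⟨a, ha⟩]; rfl
    refine ⟨(Function.extend e w 0, Function.extend e z fun _ => x₀), ⟨⟨?_, ?_⟩, ?_⟩, ?_⟩
    · intro i
      by_cases hi : i ∈ Set.range e
      · obtain ⟨a, rfl⟩ := hi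
        simpa only [e.injective.extend_apply] using (hw a).le
      · exact (hout i hi).ge
    · rw [← hw1]
      exact (Fintype.sum_of_injective e e.injective _ _ hout fun i => by
        rw [e.injective.extend_apply]).symm
    · intro i _
      by_cases hi : i ∈ Set.range e
      · obtain ⟨a, rfl⟩ := hi
        simpa only [e.injective.extend_apply] using hz ⟨a, rfl⟩
      · simpa only [Function.extend_apply' _ _ _ fun ⟨a, ha⟩ => hi ⟨a, ha⟩] using hx₀
    · rw [← hx]
      exact (Fintype.sum_of_injective e e.injective (fun i => w i • z i) _
        (fun i hi => by simp only [hout i hi, zero_smul]) fun i => by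
        simp only [e.injective.extend_apply]).symm
  · rintro ⟨⟨w, z⟩, ⟨⟨hw, hw1⟩, hz⟩, rfl⟩
    exact mem_convexHull_of_exists_fintype w z hw hw1 (fun i => hz i (Set.mem_univ i)) rfl

theorem sphereMean_im {f : ℝ → ℝ → ℂ} (hf : Continuous fun p : ℝ × ℝ => f p.1 p.2) :
    (sphereMean f).im = sphereAverage fun ϑ φ => (f ϑ φ).im := by
  have h := sphereMean_re (f := fun ϑ φ => (-Complex.I) * f ϑ φ) (continuous_const.mul hf)
  rw [sphereMean_const_mul] at h
  simpa using h

theorem sphereAverage_const (c : ℝ) : sphereAverage (fun _ _ => c) = c := by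
  have h := sphereMean_re (f := fun _ _ => (c : ℂ) * 1) continuous_const
  rw [sphereMean_const_mul, sphereMean_one, mul_one] at h
  simpa using h.symm

/-- The average of a continuous function over the sphere is a convex combination of values. -/
theorem sphereMean_mem_convexHull {ι : Type} [Fintype ι] {F : ℝ → ℝ → ι → ℂ}
    (hF : Continuous fun p : ℝ × ℝ => F p.1 p.2) :
    (fun i => sphereMean fun ϑ φ => F ϑ φ i) ∈
      convexHull ℝ ((fun p : ℝ × ℝ => F p.1 p.2) ''
        (Set.Icc 0 Real.pi ×ˢ Set.Icc 0 (2 * Real.pi))) := by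
  classical
  by_contra hp
  have hcpt := isCompact_convexHull_of_isCompact
    (((isCompact_Icc (a := (0 : ℝ)) (b := Real.pi)).prod
      (isCompact_Icc (a := (0 : ℝ)) (b := 2 * Real.pi))).image hF)
  -- A functional separating the average from the hull would commute with averaging and be at most u
  -- at all values, hence also at the average.
  obtain ⟨f, u, hu, hfu⟩ := geometric_hahn_banach_closed_point (convex_convexHull ℝ _)
    hcpt.isClosed hp
  have hi : ∀ i, Continuous fun p : ℝ × ℝ => F p.1 p.2 i := fun i => (continuous_apply i).comp hF
  have hf : ∀ v : ι → ℂ, f v = ∑ i, ((f (Pi.single i 1)) * (v i).re +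
      (f (Pi.single i Complex.I)) * (v i).im) := by
    intro v
    have hv : v = ∑ i, ((v i).re • (Pi.single i 1 : ι → ℂ) +
        (v i).im • (Pi.single i Complex.I : ι → ℂ)) := by
      ext k
      simp only [Finset.sum_apply, Pi.add_apply, Pi.smul_apply, Pi.single_apply]
      rw [Finset.sum_eq_single k]
      · apply Complex.ext <;> simp
      · intro b _ hb
        simp [Ne.symm hb]
      · simp
    conv_lhs => rw [hv]
    simp only [map_sum, map_add, map_smul, smul_eq_mul, mul_comm]
  have hav : f (fun i => sphereMean fun ϑ φ => F ϑ φ i) = sphereAverage fun ϑ φ => f (F ϑ φ) := by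
    rw [hf]
    simp only [hf (F _ _)]
    rw [sphereAverage_sum]
    · refine Finset.sum_congr rfl fun i _ => ?_
      have h1 := hi i
      rw [sphereAverage_add (by fun_prop) (by fun_prop), sphereAverage_const_mul,
        sphereAverage_const_mul, sphereMean_re h1, sphereMean_im h1]
    · intro i _
      have h1 := hi i
      fun_prop
  have hle : sphereAverage (fun ϑ φ => f (F ϑ φ)) ≤ sphereAverage fun _ _ => u :=
    sphereAverage_mono (f.continuous.comp hF) continuous_const fun ϑ hϑ φ hφ =>
      (hu _ (subset_convexHull ℝ _ ⟨(ϑ, φ), ⟨hϑ, hφ⟩, rfl⟩)).le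
  rw [sphereAverage_const] at hle
  linarith

/-- The rotated states form a finite measurement. -/
theorem exists_finite_measurement {d : ℕ} (hd : 2 ≤ d) (m : Fin (d + 1)) :
    ∃ (k : ℕ) (w ϑ φ : Fin k → ℝ), (∀ y, 0 ≤ w y) ∧
      ∑ y, (w y : ℂ) • rotatedState d m (ϑ y) (φ y) = 1 := by
  -- The average of the rotated states is 1/(d + 1) times the identity. A finite convex combination
  -- reproduces it, and multiplying the weights by d + 1 gives a resolution of the identity.
  have h := sphereMean_mem_convexHull
    (F := fun ϑ φ (x : Fin (d + 1) × Fin (d + 1)) => rotatedState d m ϑ φ x.1 x.2)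
    (continuous_pi fun x => continuous_rotatedState_apply d m x.1 x.2)
  rw [mem_convexHull_iff_exists_fintype] at h
  obtain ⟨ι, _, w, z, hw, hw1, hz, hx⟩ := h
  choose p hp hpz using hz
  let e := (Fintype.equivFin ι).symm
  refine ⟨Fintype.card ι, fun y => ((d : ℝ) + 1) * w (e y), fun y => (p (e y)).1,
    fun y => (p (e y)).2, fun y => mul_nonneg (by positivity) (hw _), ?_⟩
  rw [e.sum_comp (fun i => ((((d : ℝ) + 1) * w i : ℝ) : ℂ) • rotatedState d m (p i).1 (p i).2)]
  have hd0 : ((d : ℂ) + 1) ≠ 0 := by exact_mod_cast Nat.succ_ne_zero d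
  ext i l
  have h1 := congrFun hx (i, l)
  have h2 := congrFun (congrFun (moments_eq hd m).2.1 i) l
  simp only [momentOp, Matrix.of_apply, Complex.ofReal_one, one_mul, Matrix.smul_apply,
    smul_eq_mul] at h2
  rw [h2] at h1
  simp only [← hpz, Finset.sum_apply, Pi.smul_apply, Complex.real_smul] at h1
  simp only [Matrix.sum_apply, Matrix.smul_apply, smul_eq_mul, Complex.ofReal_mul, mul_assoc,
    ← Finset.mul_sum, h1]
  push_cast
  field_simp


/-! The benchmark for learning from a coherent state. -/

theorem ketBra_topKet (d : ℕ) : ketBra (topKet d) = Matrix.single 0 0 1 := by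
  ext i l
  simp only [ketBra, topKet, Matrix.vecMulVec_apply, Pi.star_apply, Pi.single_apply,
    Matrix.single_apply]
  by_cases h1 : i = 0 <;> by_cases h2 : l = 0 <;> simp [h1, h2, eq_comm]

theorem ketBra_coherentKet (d : ℕ) (ϑ φ : ℝ) :
    ketBra (coherentKet d ϑ φ) = rotatedState d 0 ϑ φ := by
  rw [coherentKet, ketBra_mulVec, ketBra_topKet, rotatedState]

theorem rotatedState_zero_posSemidef (d : ℕ) (ϑ φ : ℝ) : (rotatedState d 0 ϑ φ).PosSemidef := by
  rw [← ketBra_coherentKet]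
  exact Matrix.posSemidef_vecMulVec_self_star _

theorem coherentFidelity_eq {d : ℕ} (θ : ℝ) {k : ℕ} (P : Fin k → Op (Fin (d + 1)))
    (r : Fin k → ℕ) (K : ∀ y, Fin (r y) → Op (Fin 2)) (hK : ∀ y, ∑ s, (K y s)ᴴ * K y s = 1)
    (C : Op (Fin (d + 1) × Fin 2) → Op (Fin 2))
    (hC : ∀ ρ, C ρ = ∑ y, ∑ s, K y s * traceFst ((P y ⊗ₖ (1 : Op (Fin 2))) * ρ) * (K y s)ᴴ) :
    coherentFidelity d θ C = ∑ y, sphereAverage fun ϑ φ =>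
      (P y * rotatedState d 0 ϑ φ).trace.re *
        ((2 + ∑ s, ‖((axisGate θ ϑ φ)ᴴ * K y s).trace‖ ^ 2) / 6) := by
  have hF : ∀ ϑ φ, gateFidelity (axisGate θ ϑ φ) C (ketBra (coherentKet d ϑ φ)) = _ := fun ϑ φ =>
    gateFidelity_measureAndOperate P r K hK C hC _ (axisGate_mul_conjTranspose θ ϑ φ) _
  simp only [coherentFidelity, hF]
  simp only [ketBra_coherentKet]
  exact sphereAverage_sum _ fun y _ =>
    (continuous_trace_mul_rotatedState 0 (P y)).mul (continuous_kraus_weight θ (K y))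

/-- Learning from a coherent state is a special case of learning from a gate. -/
theorem exists_gateLearningFidelity_eq {d : ℕ} (θ : ℝ) (C : Op (Fin (d + 1) × Fin 2) → Op (Fin 2))
    (hC : IsMeasureAndOperate C) :
    ∃ (χ : Fin (d + 1) × Fin 1 → ℂ) (C' : Op ((Fin (d + 1) × Fin 1) × Fin 2) → Op (Fin 2)),
      ∑ i, ‖χ i‖ ^ 2 = 1 ∧ IsMeasureAndOperate C' ∧
        coherentFidelity d θ C = gateLearningFidelity d 1 θ χ C' := by
  obtain ⟨k, P, r, K, hP, hP1, hK, hCK⟩ := hC.exists_kraus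
  -- The probe is |j, j⟩ with a one-dimensional auxiliary system; rotating it prepares the coherent
  -- state, and only the weight m = j survives.
  let χ : Fin (d + 1) × Fin 1 → ℂ := fun x => if x.1 = 0 then 1 else 0
  let P' : Fin k → Op (Fin (d + 1) × Fin 1) := fun y => P y ⊗ₖ (1 : Op (Fin 1))
  have hP' : ∀ y, (P' y).PosSemidef := fun y => (hP y).kronecker Matrix.PosSemidef.one
  have hP1' : ∑ y, P' y = 1 := by
    have : ∑ y, P' y = (∑ y, P y) ⊗ₖ (1 : Op (Fin 1)) := by
      ext i l
      simp only [P', Matrix.sum_apply, Matrix.kroneckerMap_apply, Finset.sum_mul]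
    rw [this, hP1, Matrix.one_kronecker_one]
  refine ⟨χ, _, ?_, isMeasureAndOperate_of_kraus hP' hP1' hK, ?_⟩
  · simp only [χ, Fintype.sum_prod_type, Fin.sum_univ_one]
    rw [Finset.sum_eq_single 0] <;> simp +contextual
  · rw [coherentFidelity_eq θ P r K hK C hCK,
      gateLearningFidelity_eq θ χ P' r K hK _ fun _ => rfl]
    refine Finset.sum_congr rfl fun y _ => ?_
    have h0 : (attachComponent χ 0)ᴴ * P' y * attachComponent χ 0 = P y := by
      ext i l
      simp [Matrix.mul_apply, attachComponent, χ, P', Fintype.sum_prod_type]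
    have hm : ∀ m, m ≠ 0 → attachComponent χ m = 0 := by
      intro m hm
      ext i l
      simp [attachComponent, χ, hm]
    rw [Finset.sum_eq_single 0]
    · simp only [h0]
    · intro m _ hm0
      simp only [hm m hm0, Matrix.mul_zero, Matrix.trace_zero, Complex.zero_re,
        zero_mul]
      exact sphereAverage_const 0
    · simp

theorem trace_axisGate_mul_axisGate (θ ϑ φ ϑ' φ' : ℝ) :
    ((axisGate θ ϑ φ)ᴴ * axisGate θ ϑ' φ').trace =
      ((2 * (Real.cos (θ / 2) ^ 2 + Real.sin (θ / 2) ^ 2 * ∑ a, dir a ϑ φ * dir a ϑ' φ') : ℝ) :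
        ℂ) := by
  have h : ∀ ϑ φ, (axisGate θ ϑ φ).trace = 2 * (Real.cos (θ / 2) : ℂ) ∧
      (pauliX * axisGate θ ϑ φ).trace = -2 * Complex.I * Real.sin (θ / 2) * dir 0 ϑ φ ∧
      (pauliY * axisGate θ ϑ φ).trace = -2 * Complex.I * Real.sin (θ / 2) * dir 1 ϑ φ ∧
      (pauliZ * axisGate θ ϑ φ).trace = -2 * Complex.I * Real.sin (θ / 2) * dir 2 ϑ φ := by
    intro ϑ φ
    obtain ⟨h1, h2, h3, h4, h5, h6, h7, h8, h9⟩ := pauli_mul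
    obtain ⟨t1, t2, t3⟩ := trace_pauli
    simp only [axisGate, mul_sub, mul_add, mul_smul_comm, mul_one, h1, h2, h3, h4, h5, h6, h7, h8,
      h9, Matrix.trace_sub, Matrix.trace_add, Matrix.trace_smul, smul_eq_mul, t1, t2, t3,
      Matrix.trace_one, Fintype.card_fin, dir, Matrix.cons_val]
    push_cast
    refine ⟨?_, ?_, ?_, ?_⟩ <;> ring
  obtain ⟨g1, g2, g3, g4⟩ := h ϑ' φ'
  rw [trace_axisGate_mul_eq_sum]
  simp only [Fin.sum_univ_three, pauliVec, Matrix.cons_val, g1, g2, g3, g4]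
  push_cast
  linear_combination (-2 * Complex.sin (θ / 2) ^ 2 * (dir 0 ϑ φ * dir 0 ϑ' φ' +
    dir 1 ϑ φ * dir 1 ϑ' φ' + dir 2 ϑ φ * dir 2 ϑ' φ')) * Complex.I_sq

/-- The strategy measures the direction with rotated coherent states and applies the gate about the
estimated axis. The fidelity is a convex quadratic function of the cosine t between the true and the
estimated axis. Its tangent at t = 1 is a lower bound that needs only the first moments, where the
mean of t is j/(j + 1). -/
theorem exists_coherentFidelity_ge {d : ℕ} (hd : 2 ≤ d) (θ : ℝ) :
    ∃ C : Op (Fin (d + 1) × Fin 2) → Op (Fin 2), IsMeasureAndOperate C ∧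
      1 - 4 / 3 * Real.sin (θ / 2) ^ 2 / ((d : ℝ) / 2 + 1) ≤ coherentFidelity d θ C := by
  obtain ⟨k, w, ϑ', φ', hw, hw1⟩ := exists_finite_measurement hd (0 : Fin (d + 1))
  let P : Fin k → Op (Fin (d + 1)) := fun y => (w y : ℂ) • rotatedState d 0 (ϑ' y) (φ' y)
  let K : ∀ y : Fin k, Fin 1 → Op (Fin 2) := fun y _ => axisGate θ (ϑ' y) (φ' y)
  have hP : ∀ y, (P y).PosSemidef := fun y =>
    (rotatedState_zero_posSemidef d _ _).smul (Complex.zero_le_real.mpr (hw y))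
  have hK : ∀ y, ∑ s, (K y s)ᴴ * K y s = 1 := fun y => by
    rw [Fin.sum_univ_one]; exact axisGate_conjTranspose_mul _ _ _
  refine ⟨_, isMeasureAndOperate_of_kraus hP hw1 hK, ?_⟩
  rw [coherentFidelity_eq θ P (fun _ => 1) K hK _ fun _ => rfl]
  set c := Real.cos (θ / 2)
  set s := Real.sin (θ / 2)
  have hcs : s ^ 2 + c ^ 2 = 1 := Real.sin_sq_add_cos_sq (θ / 2)
  have hdir := continuous_dir
  have hd0 : (0 : ℝ) < (d : ℝ) := by exact_mod_cast (show 0 < d by omega)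
  have htr : ∀ y, (P y).trace.re = w y := fun y => by
    simp only [P, Matrix.trace_smul, trace_rotatedState, smul_eq_mul, mul_one, Complex.ofReal_re]
  have hsum : ∑ y, w y = (d : ℝ) + 1 := by
    have h := congrArg (fun X => (Matrix.trace X).re) hw1
    simp only [Matrix.trace_sum, Matrix.trace_smul, trace_rotatedState, smul_eq_mul, mul_one,
      Complex.re_sum, Complex.ofReal_re, Matrix.trace_one, Fintype.card_fin,
      Complex.natCast_re] at h
    rw [h]
    push_cast
    rfl
  have hmag : magnetic d 0 = (d : ℝ) / 2 := by simp [magnetic]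
  have hfirst : ∀ b, momentOp d 0 (dir b) =
      ((1 / (((d : ℝ) + 1) * ((d : ℝ) / 2 + 1)) : ℝ) : ℂ) • spinVec d b := by
    intro b
    have h := (moments_eq hd (0 : Fin (d + 1))).2.2 b
    have h3 : (d : ℂ) ≠ 0 := by exact_mod_cast hd0.ne'
    have hm0 : (d : ℂ) / 2 ≠ 0 := div_ne_zero h3 two_ne_zero
    rw [hmag] at h
    have h2 := congrArg (fun X => (((d : ℝ) / 2)⁻¹ : ℂ) • X) h
    simp only [smul_smul] at h2
    push_cast at h2
    rw [inv_mul_cancel₀ hm0, one_smul] at h2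
    rw [h2]
    congr 1
    rw [casimir]
    push_cast
    field_simp
  have hdot : ∀ y, sphereAverage (fun ϑ φ => (∑ a, dir a (ϑ' y) (φ' y) * dir a ϑ φ) *
      (P y * rotatedState d 0 ϑ φ).trace.re) =
      ((d : ℝ) / 2) / (((d : ℝ) + 1) * ((d : ℝ) / 2 + 1)) * w y := by
    intro y
    rw [trace_mul_momentOp 0 (P y) (p := fun ϑ φ => ∑ a, dir a (ϑ' y) (φ' y) * dir a ϑ φ)
        (by fun_prop), momentOp_sum 0 _ (fun a => dir a (ϑ' y) (φ' y)) hdir]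
    have e : ∑ a, ((dir a (ϑ' y) (φ' y) : ℝ) : ℂ) • momentOp d 0 (dir a) =
        ((1 / (((d : ℝ) + 1) * ((d : ℝ) / 2 + 1)) : ℝ) : ℂ) • spinAlong d (ϑ' y) (φ' y) := by
      rw [spinAlong_eq_sum, Finset.smul_sum]
      exact Finset.sum_congr rfl fun a _ => by rw [hfirst, smul_comm]
    rw [e]
    simp only [P, mul_smul_comm, smul_mul_assoc, rotatedState_mul_spinAlong, Matrix.trace_smul,
      trace_rotatedState, smul_eq_mul, mul_one]
    have e2 : ((d : ℂ) / 2 - ((0 : Fin (d + 1)) : ℕ)) = (((d : ℝ) / 2 : ℝ) : ℂ) := by simp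
    rw [e2, ← Complex.ofReal_mul, ← Complex.ofReal_mul, Complex.ofReal_re]
    ring
  have hy : ∀ y, w y / ((d : ℝ) + 1) * (1 - 4 / 3 * s ^ 2 / ((d : ℝ) / 2 + 1)) ≤
      sphereAverage fun ϑ φ => (P y * rotatedState d 0 ϑ φ).trace.re *
        ((2 + ∑ i, ‖((axisGate θ ϑ φ)ᴴ * K y i).trace‖ ^ 2) / 6) := by
    intro y
    have hPc := continuous_trace_mul_rotatedState 0 (P y)
    have hwc := continuous_kraus_weight θ (K y)
    calc _ = sphereAverage (fun ϑ φ => (1 - 4 / 3 * s ^ 2) * (P y * rotatedState d 0 ϑ φ).trace.re +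
          4 / 3 * s ^ 2 * ((∑ a, dir a (ϑ' y) (φ' y) * dir a ϑ φ) *
            (P y * rotatedState d 0 ϑ φ).trace.re)) := by
          rw [sphereAverage_add (by fun_prop) (by fun_prop), sphereAverage_const_mul,
            sphereAverage_const_mul, hdot, sphereAverage_trace_mul_rotatedState hd, htr]
          field_simp
          ring
      _ ≤ _ := by
          refine sphereAverage_mono (by fun_prop) (by fun_prop) fun ϑ _ φ _ => ?_
          have hp := trace_mul_rotatedState_nonneg 0 (hP y) ϑ φ
          have e : ∑ a, dir a (ϑ' y) (φ' y) * dir a ϑ φ = ∑ a, dir a ϑ φ * dir a (ϑ' y) (φ' y) :=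
            Finset.sum_congr rfl fun a _ => mul_comm _ _
          rw [Fin.sum_univ_one, trace_axisGate_mul_axisGate, Complex.norm_real, Real.norm_eq_abs,
            sq_abs, e]
          set t := ∑ a, dir a ϑ φ * dir a (ϑ' y) (φ' y)
          -- The tangent at t = 1; the difference of the two sides is (2/3) s⁴ (1 - t)².
          have h1 : 1 - 4 / 3 * s ^ 2 + 4 / 3 * s ^ 2 * t ≤
              (2 + (2 * (c ^ 2 + s ^ 2 * t)) ^ 2) / 6 := by
            have hc2 : c ^ 2 = 1 - s ^ 2 := by linarith
            rw [hc2]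
            nlinarith [sq_nonneg (s ^ 2 * (1 - t))]
          calc _ = (P y * rotatedState d 0 ϑ φ).trace.re *
                (1 - 4 / 3 * s ^ 2 + 4 / 3 * s ^ 2 * t) := by ring
            _ ≤ _ := mul_le_mul_of_nonneg_left h1 hp
  calc _ = ∑ y, w y / ((d : ℝ) + 1) * (1 - 4 / 3 * s ^ 2 / ((d : ℝ) / 2 + 1)) := by
        rw [← Finset.sum_mul, ← Finset.sum_div, hsum, div_self (by positivity), one_mul]
    _ ≤ _ := Finset.sum_le_sum fun y _ => hy y

/-- The explicit coherent-state strategy is also a gate strategy, and the upper bound for gate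
strategies also covers coherent states. So one pair of bounds holds for both suprema. -/
theorem benchmark_bounds {d : ℕ} (hd : 5 ≤ d) (θ : ℝ) {B : ℝ}
    (hB : B = coherentBenchmark d θ ∨ B = gateBenchmark d θ) :
    1 - 4 / 3 * Real.sin (θ / 2) ^ 2 / ((d : ℝ) / 2 + 1) ≤ B ∧
      B ≤ 1 - 2 / 3 * Real.sin (θ / 2) ^ 2 * directionDeficit d := by
  have hub : 1 / 3 + 2 / 3 * (1 - Real.sin (θ / 2) ^ 2 * directionDeficit d) =
      1 - 2 / 3 * Real.sin (θ / 2) ^ 2 * directionDeficit d := by ring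
  obtain ⟨C, hC, hle⟩ := exists_coherentFidelity_ge (show 2 ≤ d by omega) θ
  obtain ⟨χ, C', hχ, hC', hCC'⟩ := exists_gateLearningFidelity_eq θ C hC
  have hgate : ∀ F, (∃ (a : ℕ) (χ : Fin (d + 1) × Fin a → ℂ)
      (C : Op ((Fin (d + 1) × Fin a) × Fin 2) → Op (Fin 2)),
      ∑ i, ‖χ i‖ ^ 2 = 1 ∧ IsMeasureAndOperate C ∧ F = gateLearningFidelity d a θ χ C) →
      F ≤ 1 - 2 / 3 * Real.sin (θ / 2) ^ 2 * directionDeficit d := by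
    rintro F ⟨a, χ, C, hχ, hC, rfl⟩
    rw [← hub]
    exact gateLearningFidelity_le hd θ χ hχ C hC
  have hcoh : ∀ F, (∃ C : Op (Fin (d + 1) × Fin 2) → Op (Fin 2),
      IsMeasureAndOperate C ∧ F = coherentFidelity d θ C) →
      F ≤ 1 - 2 / 3 * Real.sin (θ / 2) ^ 2 * directionDeficit d := by
    rintro F ⟨C, hC, rfl⟩
    obtain ⟨χ, C', hχ, hC', h⟩ := exists_gateLearningFidelity_eq θ C hC
    exact hgate _ ⟨1, χ, C', hχ, hC', h⟩
  rcases hB with rfl | rfl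
  · exact ⟨hle.trans (le_csSup ⟨_, hcoh⟩ ⟨C, hC, rfl⟩), csSup_le ⟨_, C, hC, rfl⟩ hcoh⟩
  · exact ⟨hle.trans (le_csSup ⟨_, hgate⟩ ⟨1, χ, C', hχ, hC', hCC'⟩),
      csSup_le ⟨_, 1, χ, C', hχ, hC', hCC'⟩ hgate⟩


/-! The number of accesses with a quantum advantage. -/

/-- Both bounds have the same term of order 1/j; the constant 8/3 is obtained from 1 - cos θ ≤ 2. -/
theorem benchmark_asymptotics {d : ℕ} (hd : 5 ≤ d) (θ : ℝ) {j : ℝ} (hj : j = (d : ℝ) / 2) {B : ℝ}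
    (hB : B = coherentBenchmark d θ ∨ B = gateBenchmark d θ) :
    1 - 2 * (1 - Real.cos θ) / (3 * j) ≤ B ∧
      B ≤ 1 - 2 * (1 - Real.cos θ) / (3 * j) + 8 / 3 / j ^ 2 := by
  obtain ⟨h1, h2⟩ := benchmark_bounds hd θ hB
  have hx : (5 : ℝ) ≤ d := by exact_mod_cast hd
  have hj0 : 0 < j := by rw [hj]; positivity
  have hD0 : 0 ≤ 1 - Real.cos θ := by linarith [Real.cos_le_one θ]
  have hD2 : 1 - Real.cos θ ≤ 2 := by linarith [Real.neg_one_le_cos θ]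
  have hdj : (d : ℝ) = 2 * j := by rw [hj]; ring
  rw [sin_half_sq, directionDeficit, hdj] at h2
  rw [sin_half_sq, hdj] at h1
  set D := 1 - Real.cos θ
  constructor
  · refine le_trans ?_ h1
    have e : 1 - 4 / 3 * (D / 2) / (2 * j / 2 + 1) - (1 - 2 * D / (3 * j)) =
        2 * D / (3 * j * (j + 1)) := by field_simp; ring
    have : 0 ≤ 2 * D / (3 * j * (j + 1)) := by positivity
    linarith
  · refine h2.trans ?_
    have e : 1 - 2 * D / (3 * j) + 8 / 3 / j ^ 2 -
        (1 - 2 / 3 * (D / 2) * (4 * (2 * j + 1) / ((2 * j + 2) * (2 * j + 3)))) =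
        (8 * (2 * j + 2) * (2 * j + 3) - D * j * (16 * j + 12)) /
          (3 * j ^ 2 * ((2 * j + 2) * (2 * j + 3))) := by
      field_simp
      ring
    have h3 : 0 ≤ 8 * (2 * j + 2) * (2 * j + 3) - D * j * (16 * j + 12) := by
      have : D * (j * (16 * j + 12)) ≤ 2 * (j * (16 * j + 12)) :=
        mul_le_mul_of_nonneg_right hD2 (by positivity)
      nlinarith
    have : 0 ≤ (8 * (2 * j + 2) * (2 * j + 3) - D * j * (16 * j + 12)) /
          (3 * j ^ 2 * ((2 * j + 2) * (2 * j + 3))) := by positivity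
    linarith

/-- An antitone sequence that crosses a threshold does so once, at a place determined by an
approximation. -/
theorem exists_crossing {F : ℕ → ℝ} (hF : Antitone F) {B D c j : ℝ} (hD : 0 < D) (hD2 : D ≤ 2)
    (hc : 0 ≤ c) (hj : 2 * (3 * c / D ^ 2 + 1) + 2 ≤ j)
    (h : ∀ k : ℕ, ((k + 1 : ℕ) : ℝ) ≤ (1 / D + 1) * j →
      |F k - B - D * (j - ((k + 1 : ℕ) : ℝ) * D) / (3 * j ^ 2)| ≤ c / j ^ 2) :
    ∃ N : ℕ, 1 ≤ N ∧ (∀ n : ℕ, 1 ≤ n → (B < F (n - 1) ↔ n ≤ N)) ∧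
      |(N : ℝ) - j / D| ≤ 3 * c / D ^ 2 + 2 := by
  -- Chosen so that at n ≥ j/D + R the main term D(j - nD)/3 is at most -(c + D²/3), which beats the
  -- error c.
  set R := 3 * c / D ^ 2 + 1 with hR
  have hR1 : 1 ≤ R := by rw [hR]; have : 0 ≤ 3 * c / D ^ 2 := by positivity
                         linarith
  have hRD : R * D ^ 2 = 3 * c + D ^ 2 := by rw [hR]; field_simp
  have hj0 : 0 < j := by linarith
  have hj2 : 0 < j ^ 2 := by positivity
  have hjD : 0 < j / D := by positivity
  have hDj : D * (j / D) = j := by field_simp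
  have h' : ∀ k : ℕ, ((k + 1 : ℕ) : ℝ) ≤ (1 / D + 1) * j →
      D * (j - ((k + 1 : ℕ) : ℝ) * D) / 3 - c ≤ (F k - B) * j ^ 2 ∧
      (F k - B) * j ^ 2 ≤ D * (j - ((k + 1 : ℕ) : ℝ) * D) / 3 + c := by
    intro k hk
    have h1 := abs_le.mp (h k hk)
    have e1 : D * (j - ((k + 1 : ℕ) : ℝ) * D) / (3 * j ^ 2) * j ^ 2 =
        D * (j - ((k + 1 : ℕ) : ℝ) * D) / 3 := by field_simp
    have e2 : c / j ^ 2 * j ^ 2 = c := by field_simp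
    have h2 := mul_le_mul_of_nonneg_right h1.1 hj2.le
    have h3 := mul_le_mul_of_nonneg_right h1.2 hj2.le
    rw [neg_mul, e2, sub_mul, e1] at h2
    rw [e2, sub_mul, e1] at h3
    constructor <;> linarith
  have hex : ∃ k, F k ≤ B ∧ ((k + 1 : ℕ) : ℝ) ≤ j / D + R + 1 := by
    have hpos : 0 < j / D + R := by positivity
    have hn1 : 1 ≤ ⌈j / D + R⌉₊ := Nat.one_le_iff_ne_zero.mpr (Nat.ceil_pos.mpr hpos).ne'
    refine ⟨⌈j / D + R⌉₊ - 1, ?_⟩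
    have hle : (⌈j / D + R⌉₊ : ℝ) ≤ j / D + R + 1 := (Nat.ceil_lt_add_one hpos.le).le
    have hge : j / D + R ≤ (⌈j / D + R⌉₊ : ℝ) := Nat.le_ceil _
    have h1 := (h' (⌈j / D + R⌉₊ - 1) (by
      rw [Nat.sub_add_cancel hn1]
      have : (1 / D + 1) * j = j / D + j := by ring
      linarith)).2
    rw [Nat.sub_add_cancel hn1] at h1 ⊢
    refine ⟨?_, hle⟩
    have h2 : D * (j - (⌈j / D + R⌉₊ : ℝ) * D) ≤ -(R * D ^ 2) := by
      have := mul_le_mul_of_nonneg_left hge (sq_nonneg D)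
      nlinarith
    have h3 : (F (⌈j / D + R⌉₊ - 1) - B) * j ^ 2 ≤ 0 := by nlinarith [sq_nonneg D]
    have := nonpos_of_mul_nonpos_left h3 hj2
    linarith
  obtain ⟨k₁, hk₁, hk₁'⟩ := hex
  classical
  have hfind : ∃ k, F k ≤ B := ⟨k₁, hk₁⟩
  -- The first index k with F k ≤ B. Since access n has index n - 1, this k is also the number of
  -- accesses above the threshold.
  set N := Nat.find hfind with hN
  have hNk : N ≤ k₁ := Nat.find_min' hfind hk₁
  have hNk' : (N : ℝ) ≤ k₁ := by exact_mod_cast hNk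
  have hNR : (N : ℝ) ≤ j / D + R := by push_cast at hk₁'; linarith
  have hNB : F N ≤ B := Nat.find_spec hfind
  refine ⟨N, ?_, fun n hn => ?_, ?_⟩
  -- The first access is above the threshold because j is large compared with R.
  · by_contra hlt
    have h0 : N = 0 := by omega
    rw [h0] at hNB
    have h1 := (h' 0 (by
      have : (1 / D + 1) * j = j / D + j := by ring
      push_cast
      linarith)).1
    have h2 : (F 0 - B) * j ^ 2 ≤ 0 := mul_nonpos_of_nonpos_of_nonneg (by linarith) hj2.le
    push_cast at h1
    have h3 : 2 * (R * D ^ 2) ≤ 2 * R * D * 2 := by nlinarith [mul_pos (by linarith : 0 < R) hD]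
    have h4 : (2 * R + 2) * D ≤ j * D := mul_le_mul_of_nonneg_right hj hD.le
    nlinarith
  · constructor
    · intro hlt
      by_contra hgt
      have := hF (show N ≤ n - 1 by omega)
      linarith
    · intro hle
      exact not_le.mp (Nat.find_min hfind (show n - 1 < N by omega))
  -- The index N belongs to access N + 1, the first one without advantage. The additional 1 in R
  -- absorbs this shift.
  · have h1 := (h' N (by
      have : (1 / D + 1) * j = j / D + j := by ring
      push_cast
      linarith)).1
    have h2 : (F N - B) * j ^ 2 ≤ 0 := mul_nonpos_of_nonpos_of_nonneg (by linarith) hj2.le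
    have h3 : D * (j - ((N + 1 : ℕ) : ℝ) * D) ≤ 3 * c := by linarith
    have h4 : j / D - R ≤ N := by
      push_cast at h3
      have h5 : D ^ 2 * (j / D - R) ≤ D ^ 2 * N := by
        have : D ^ 2 * (j / D) = D * j := by field_simp
        nlinarith
      exact le_of_mul_le_mul_left h5 (by positivity)
    rw [abs_le]
    constructor <;> linarith

theorem persistence_of_advantage {θ : ℝ} (hθ : θ ∈ Set.Ioo (0 : ℝ) (2 * Real.pi)) :
    ∃ (c : ℝ) (d₀ : ℕ), ∀ d : ℕ, 3 ≤ d → d₀ ≤ d → ∀ j : ℝ, j = (d : ℝ) / 2 →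
      ∀ B : ℝ, (B = coherentBenchmark d θ ∨ B = gateBenchmark d θ) →
        ∃ N : ℕ, 1 ≤ N ∧ (∀ n : ℕ, 1 ≤ n → (B < reuseFidelity d θ n ↔ n ≤ N)) ∧
          |(N : ℝ) - j / (1 - Real.cos θ)| ≤ c := by
  have hcos : Real.cos θ < 1 := by
    refine lt_of_le_of_ne (Real.cos_le_one θ) fun h => ?_
    obtain ⟨n, hn⟩ := (Real.cos_eq_one_iff θ).mp h
    have h2 : (0 : ℝ) < 2 * Real.pi := by positivity
    have h0 : (0 : ℝ) < n := by
      by_contra hneg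
      have := mul_nonpos_of_nonpos_of_nonneg (not_lt.mp hneg) h2.le
      linarith [hθ.1]
    have h1 : (n : ℝ) < 1 := by
      by_contra hge
      have := mul_le_mul_of_nonneg_right (not_lt.mp hge) h2.le
      linarith [hθ.2]
    have h0' : (0 : ℤ) < n := by exact_mod_cast h0
    have h1' : n < (1 : ℤ) := by exact_mod_cast h1
    omega
  have hD : 0 < 1 - Real.cos θ := by linarith
  have hD2 : 1 - Real.cos θ ≤ 2 := by linarith [Real.neg_one_le_cos θ]
  have hθ' : θ ∈ Set.Ico (0 : ℝ) (2 * Real.pi) := ⟨hθ.1.le, hθ.2⟩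
  -- The range n ≤ (1/D + 1) j contains the expected crossing at j/D with a margin j.
  obtain ⟨c₁, hc₁⟩ := accessFidelity_asymptotics (1 / (1 - Real.cos θ) + 1)
  set D := 1 - Real.cos θ
  set c := |c₁| + 8 / 3 with hc
  -- The outer factor 2 converts the condition on j into one on d = 2j; the summand 5 secures the
  -- range of the benchmark bounds.
  refine ⟨3 * c / D ^ 2 + 2, ⌈2 * (2 * (3 * c / D ^ 2 + 1) + 2)⌉₊ + 5, ?_⟩
  intro d hd hd₀ j hj B hB
  have hjR : 2 * (3 * c / D ^ 2 + 1) + 2 ≤ j := by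
    have h1 : (⌈2 * (2 * (3 * c / D ^ 2 + 1) + 2)⌉₊ : ℝ) ≤ d := by exact_mod_cast (by omega)
    have h2 := Nat.le_ceil (2 * (2 * (3 * c / D ^ 2 + 1) + 2))
    rw [hj]
    linarith
  have hj0 : 0 < j := by
    rw [hj]
    have : (3 : ℝ) ≤ d := by exact_mod_cast hd
    linarith
  obtain ⟨hB1, hB2⟩ := benchmark_asymptotics (show 5 ≤ d by omega) θ hj hB
  simp only [reuseFidelity_eq]
  refine exists_crossing (accessFidelity_antitone hd hθ') hD hD2 (by positivity) hjR fun k hk => ?_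
  have h1 := abs_le.mp (hc₁ θ hθ' d hd j hj k hk)
  have h2 : c₁ / j ^ 2 ≤ |c₁| / j ^ 2 := div_le_div_of_nonneg_right (le_abs_self c₁) (by positivity)
  have h3 : c / j ^ 2 = |c₁| / j ^ 2 + 8 / 3 / j ^ 2 := by rw [hc, add_div]
  -- The difference of the approximations to the fidelity and to the benchmark; its zero is n = j/D.
  have e : D * (j - ((k + 1 : ℕ) : ℝ) * D) / (3 * j ^ 2) =
      (1 - D / (3 * j) * ((((k + 1 : ℕ) : ℝ) * D + j) / j)) - (1 - 2 * D / (3 * j)) := by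
    field_simp
    ring
  have h4 : 0 ≤ 8 / 3 / j ^ 2 := by positivity
  rw [e, h3, abs_le]
  constructor <;> linarith [h1.1, h1.2]

end SpinMemory

end

theorem mainTheorem9 :
    -- fidelity of the `n`-th access, with an error uniform in `θ` and in `1 ≤ n ≤ K j`
    (∀ K : ℝ, ∃ c : ℝ, ∀ θ ∈ Set.Ico (0 : ℝ) (2 * Real.pi), ∀ d : ℕ, 3 ≤ d →
      ∀ j : ℝ, j = (d : ℝ) / 2 → ∀ n : ℕ, 1 ≤ n → (n : ℝ) ≤ K * j →
        |SpinMemory.reuseFidelity d θ n -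
          (1 - (1 - Real.cos θ) / (3 * j) * (((n : ℝ) * (1 - Real.cos θ) + j) / j))|
            ≤ c / j ^ 2) ∧
    -- persistence of the advantage over the classical benchmarks of both learning scenarios
    (∀ θ ∈ Set.Ioo (0 : ℝ) (2 * Real.pi), ∃ (c : ℝ) (d₀ : ℕ), ∀ d : ℕ, 3 ≤ d → d₀ ≤ d →
      ∀ j : ℝ, j = (d : ℝ) / 2 →
      ∀ B : ℝ, (B = SpinMemory.coherentBenchmark d θ ∨ B = SpinMemory.gateBenchmark d θ) →
        ∃ N : ℕ, 1 ≤ N ∧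
          (∀ n : ℕ, 1 ≤ n → (B < SpinMemory.reuseFidelity d θ n ↔ n ≤ N)) ∧
          |(N : ℝ) - j / (1 - Real.cos θ)| ≤ c) := by
  refine ⟨fun K => ?_, fun θ hθ => SpinMemory.persistence_of_advantage hθ⟩
  obtain ⟨c, hc⟩ := SpinMemory.accessFidelity_asymptotics K
  refine ⟨c, fun θ hθ d hd j hj n hn hnK => ?_⟩
  obtain ⟨k, rfl⟩ : ∃ k, n = k + 1 := ⟨n - 1, by omega⟩
  rw [SpinMemory.reuseFidelity_eq, Nat.add_sub_cancel]
  exact hc θ hθ d hd j hj k hnK
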